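/- Let $G$ be a simple, simply connected algebraic group over $\mathbb C$ with maximal torus $T$, character lattice $T^*$, (reduced, irreducible) root system $\Phi\subset T^*$, simple roots $\alpha_1,\dots,\alpha_n$, highest root $\theta$, Weyl group $W$ and coroot lattice $Q^\vee$. Let $W_a=W\ltimes Q^\vee$ be the affine Weyl group, with translations $t_\lambda$ ($\lambda\in Q^\vee$) and with simple reflections $s_1,\dots,s_n$ and $s_0=s_\theta t_{-\theta^\vee}$, and let $W_a^-\subset W_a$ be the set of minimal length representatives of $W_a/W$. Let $R$ be a domain of characteristic $0$, $F$ a one-dimensional commutative formal group law over $R$, and $S=R[[x_\mu\mid\mu\in T^*]]/\mathcal J_F$ the formal group algebra of $T^*$, where $\mathcal J_F$ is the closure of the ideal generated by $x_0$ and the elements $x_{\mu+\nu}-F(x_\mu,x_\nu)$; a choice of a $\mathbb Z$-basis of $T^*$ identifies $S$ with a power series ring over $R$ in $n$ variables. Let $\mathcal Q=S[\frac1{x_\alpha},\alpha\in\Phi]$. The group $W_a$ acts on $\mathcal Q$ through $W$. Let $\mathcal Q_{W_a}=\mathcal Q\rtimes R[W_a]$ be the twisted group algebra with left $\mathcal Q$-basis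 $\eta_w$ and product $p\eta_w\,p'\eta_{w'}=p\,w(p')\,\eta_{ww'}$, and let $\mathcal Q_{Q^\vee}=\mathcal Q\rtimes R[Q^\vee]$. Let $\mathrm{pr}:\mathcal Q_{W_a}\to\mathcal Q_{Q^\vee}$ be the map $p\,\eta_{t_\lambda w}\mapsto p\,\eta_{t_\lambda}$ ($w\in W$), and $k:\mathcal Q_{Q^\vee}\to\mathcal Q_{W_a}$ the ring embedding $p\,\eta_{t_\lambda}\mapsto p\,\eta_{t_\lambda}$. Put $X_i=\frac1{x_{\alpha_i}}(1-\eta_{s_i})$ for $1\le i\le n$ and $X_0=\frac1{x_{-\theta}}(1-\eta_{s_0})$. Let $\mathbf D_{W_a}$ be the subalgebra of $\mathcal Q_{W_a}$ generated by $S$ and $X_0,\dots,X_n$, and let $\mathbf D_{Q^\vee}=k(\mathrm{pr}(\mathbf D_{W_a}))$ be the Peterson subalgebra. For every $w\in W_a$ fix a reduced sequence $I_w=(i_1,\dots,i_m)$ of $w$, put $X_{I_w}=X_{i_1}\cdots X_{i_m}$, and for $u\in W_a^-$ put $\mathfrak X_{I_u}=\mathrm{pr}(X_{I_u})$. Assume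 that this choice is $W$-compatible: $I_{uv}$ is the concatenation of $I_u$ and $I_v$ for all $u\in W_a^-$ and $v\in W$. Then the $X_{I_w}$, $w\in W_a$, form a basis of the left $S$-module $\mathbf D_{W_a}$, and the $k(\mathfrak X_{I_u})$, $u\in W_a^-$, form a basis of the left $S$-module $\mathbf D_{Q^\vee}$. There are (unique, finitely supported) coefficients $c_{I_u,I_w},\,d^{I_w}_{I_{w'},I_{w''}},\,\mathfrak d^{I_w}_{I_u,I_v}\in S$ with $$k(\mathfrak X_{I_u})=\sum_{w\in W_a}c_{I_u,I_w}X_{I_w}\quad(u\in W_a^-),$$ where $c_{I_u,I_u}=1$ and $c_{I_u,I_w}=0$ for $w\in W_a^-$, $w\ne u$, with $$X_{I_{w'}}X_{I_{w''}}=\sum_{w\in W_a}d^{I_w}_{I_{w'},I_{w''}}X_{I_w}\quad(w',w''\in W_a),$$ and with $$\mathfrak X_{I_u}\mathfrak X_{I_v}=\sum_{w\in W_a^-}\mathfrak d^{I_w}_{I_u,I_v}\mathfrak X_{I_w}\quad(u,v\in W_a^-).$$ They satisfy, for all $u,v,w_3\in W_a^-$, $$\mathfrak d^{I_{w_3}}_{I_u,I_v}=\sum_{w_2\in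 W_a}c_{I_u,I_{w_2}}\,d^{I_{w_3}}_{I_{w_2},I_v}.$$ -/

import Mathlib

noncomputable section FADA

open MvPowerSeries

namespace FormalGroup
variable {R : Type*} [CommRing R] (F : FormalGroup R)

lemma hasSubst_pair {τ : Type*} {f g : MvPowerSeries τ R} (hf : PowerSeries.HasSubst f)
    (hg : PowerSeries.HasSubst g) : MvPowerSeries.HasSubst ![f, g] :=
  hasSubst_of_constantCoeff_nilpotent fun s => by fin_cases s <;> simpa

lemma hasSubst_neg {τ : Type*} {f : MvPowerSeries τ R} (hf : PowerSeries.HasSubst f) :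
    PowerSeries.HasSubst (-f) := by
  simpa [PowerSeries.HasSubst] using (show IsNilpotent (constantCoeff f) from hf).neg

lemma hasSubst_F {τ : Type*} {f g : MvPowerSeries τ R} (hf : PowerSeries.HasSubst f)
    (hg : PowerSeries.HasSubst g) : PowerSeries.HasSubst (F.toPowerSeries.subst ![f, g]) :=
  IsNilpotent_subst (hasSubst_pair hf hg) (F.zero_constantCoeff ▸ IsNilpotent.zero)

/-- The series `F(X, -X)`. -/
def diag : PowerSeries R := F.toPowerSeries.subst ![PowerSeries.X, -PowerSeries.X]

lemma subst_diag {τ : Type*} {f : MvPowerSeries τ R} (hf : PowerSeries.HasSubst f) :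
    F.diag.subst f = F.toPowerSeries.subst ![f, -f] := by
  rw [diag, PowerSeries.subst, subst_comp_subst_apply
    (hasSubst_pair PowerSeries.HasSubst.X' (hasSubst_neg PowerSeries.HasSubst.X')) hf.const]
  congr! 2 with s
  fin_cases s
  · exact PowerSeries.subst_X hf
  · show PowerSeries.subst f (-PowerSeries.X) = -f
    rw [← PowerSeries.coe_substAlgHom hf, map_neg, PowerSeries.coe_substAlgHom hf,
      PowerSeries.subst_X hf]

lemma two_le_order_diag : 2 ≤ F.diag.order := by
  refine PowerSeries.le_order _ _ fun i hi => ?_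
  have hi' : i < 2 := by exact_mod_cast hi
  have hs : MvPowerSeries.HasSubst ![(PowerSeries.X : PowerSeries R), -PowerSeries.X] :=
    hasSubst_pair PowerSeries.HasSubst.X' (hasSubst_neg PowerSeries.HasSubst.X')
  have hp : ∀ d : Fin 2 →₀ ℕ, PowerSeries.coeff i
      (d.prod fun s e ↦ (![(PowerSeries.X : PowerSeries R), -PowerSeries.X] s) ^ e) =
      if i = d 0 + d 1 then (-1) ^ d 1 else 0 := by
    intro d
    rw [Finsupp.prod_fintype _ _ (by simp), Fin.prod_univ_two]
    simp only [Matrix.cons_val_zero, Matrix.cons_val_one, neg_pow (PowerSeries.X : PowerSeries R)]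
    rw [mul_left_comm, ← pow_add, show ((-1 : PowerSeries R) ^ d 1) = PowerSeries.C ((-1) ^ d 1) by simp,
      PowerSeries.coeff_C_mul, PowerSeries.coeff_X_pow]
    simp
  rw [diag, PowerSeries.coeff, coeff_subst hs]
  change ∑ᶠ d : Fin 2 →₀ ℕ, MvPowerSeries.coeff d F.toPowerSeries • PowerSeries.coeff i
      (d.prod fun s e ↦ (![(PowerSeries.X : PowerSeries R), -PowerSeries.X] s) ^ e) = 0
  simp_rw [hp]
  interval_cases i
  · rw [finsum_eq_single _ 0]
    · simpa using F.zero_constantCoeff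
    · intro d hd
      have : ¬ (0 = d 0 + d 1) := by
        intro h
        apply hd
        ext s
        fin_cases s <;> simp <;> omega
      simp [this]
  · rw [finsum_eq_sum_of_support_subset (s := {Finsupp.single 0 1, Finsupp.single 1 1})]
    · rw [Finset.sum_pair (by simp [Finsupp.single_left_inj])]
      simp [F.lin_coeff_X, F.lin_coeff_Y]
    · intro d hd
      have h1 : 1 = d 0 + d 1 := by
        by_contra h
        simp [h] at hd
      have : (d 0 = 1 ∧ d 1 = 0) ∨ (d 0 = 0 ∧ d 1 = 1) := by omega
      simp only [Finset.coe_insert, Finset.coe_singleton, Set.mem_insert_iff,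
        Set.mem_singleton_iff]
      rcases this with h | h
      · left; ext s; fin_cases s <;> simp [h]
      · right; ext s; fin_cases s <;> simp [h]

/-- Successive approximations `(g, h)` with `F(X, g) = h` and `h` of increasing order. -/
def approx : ℕ → PowerSeries R × PowerSeries R
  | 0 => (0, PowerSeries.X)
  | k + 1 => (F.toPowerSeries.subst ![(approx k).1, -(approx k).2],
      F.toPowerSeries.subst ![(approx k).2, -(approx k).2])

lemma approx_hasSubst (k : ℕ) :
    PowerSeries.HasSubst (F.approx k).1 ∧ PowerSeries.HasSubst (F.approx k).2 := by
  induction k with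
  | zero => exact ⟨PowerSeries.HasSubst.zero', PowerSeries.HasSubst.X'⟩
  | succ k ih => exact ⟨F.hasSubst_F ih.1 (hasSubst_neg ih.2), F.hasSubst_F ih.2 (hasSubst_neg ih.2)⟩

lemma approx_eq (k : ℕ) :
    F.toPowerSeries.subst ![PowerSeries.X, (F.approx k).1] = (F.approx k).2 := by
  induction k with
  | zero => exact add_zero F PowerSeries.HasSubst.X'
  | succ k ih =>
    have h := F.approx_hasSubst k
    show F.toPowerSeries.subst ![_, F.toPowerSeries.subst ![_, _]] = F.toPowerSeries.subst ![_, _]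
    rw [← F.assoc' PowerSeries.HasSubst.X' h.1 (hasSubst_neg h.2), ih]

lemma approx_order (k : ℕ) : ((k + 1 : ℕ) : ℕ∞) ≤ PowerSeries.order (F.approx k).2 := by
  induction k with
  | zero =>
    refine PowerSeries.le_order _ _ fun i hi => ?_
    have hi' : i = 0 := by
      have : i < 0 + 1 := by exact_mod_cast hi
      omega
    simp [hi', approx]
  | succ k ih =>
    have h := (F.approx_hasSubst k).2
    have e : (F.approx (k + 1)).2 = F.diag.subst (F.approx k).2 := (F.subst_diag h).symm
    rw [e, PowerSeries.order_eq_order]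
    refine le_trans ?_ (PowerSeries.le_order_subst _ h _)
    rw [PowerSeries.order_eq_order] at ih
    calc ((k + 1 + 1 : ℕ) : ℕ∞) ≤ ((k + 1 : ℕ) : ℕ∞) * 2 := by norm_cast; omega
      _ ≤ _ := mul_le_mul' ih F.two_le_order_diag

lemma approx_truncTotal {τ : Type*} [Finite τ] {f g g' : MvPowerSeries τ R}
    (hf : PowerSeries.HasSubst f) (hg : PowerSeries.HasSubst g) (hg' : PowerSeries.HasSubst g')
    {n : ℕ} (h : truncTotal n g = truncTotal n g') :
    truncTotal n (F.toPowerSeries.subst ![f, g]) = truncTotal n (F.toPowerSeries.subst ![f, g']) := by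
  rw [truncTotal_subst_eq_truncTotal_subst_truncTotal_of_le (x := fun _ => n)
      (hasSubst_pair hf hg) (fun _ => le_rfl),
    truncTotal_subst_eq_truncTotal_subst_truncTotal_of_le (x := fun _ => n)
      (hasSubst_pair hf hg') (fun _ => le_rfl)]
  congr! 3 with s
  fin_cases s <;> simp [h]

lemma truncTotal_eq_zero_of_le_order {τ : Type*} [Finite τ] {f : MvPowerSeries τ R} {n : ℕ}
    (h : (n : ℕ∞) ≤ f.order) : truncTotal n f = 0 := by
  ext d
  rw [coeff_truncTotal_eq_ite]
  split_ifs with hd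
  · simpa using coeff_of_lt_order (lt_of_lt_of_le (by exact_mod_cast hd) h)
  · simp

lemma approx_succ (k : ℕ) :
    truncTotal (k + 1) (F.approx (k + 1)).1 = truncTotal (k + 1) (F.approx k).1 := by
  have h := F.approx_hasSubst k
  have := F.approx_truncTotal (n := k + 1) h.1 (hasSubst_neg h.2) PowerSeries.HasSubst.zero' (by
    have h2 := F.approx_order k
    rw [PowerSeries.order_eq_order] at h2
    rw [map_neg, truncTotal_eq_zero_of_le_order h2, map_zero, neg_zero])
  refine this.trans ?_
  rw [add_zero F h.1]

/-- The formal inverse of a formal group law. -/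
def invSeries : PowerSeries R := PowerSeries.mk fun n => PowerSeries.coeff n (F.approx n).1

lemma coeff_approx_of_le {n k : ℕ} (h : n ≤ k) :
    PowerSeries.coeff n (F.approx k).1 = PowerSeries.coeff n (F.approx n).1 := by
  induction k, h using Nat.le_induction with
  | base => rfl
  | succ k hk ih =>
    rw [← ih]
    have := congrArg (MvPolynomial.coeff (Finsupp.single () n)) (F.approx_succ k)
    rwa [coeff_truncTotal _ (by simp; omega), coeff_truncTotal _ (by simp; omega)] at this

lemma truncTotal_invSeries (n : ℕ) :
    truncTotal (n + 1) F.invSeries = truncTotal (n + 1) (F.approx n).1 := by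
  ext d
  rw [coeff_truncTotal_eq_ite, coeff_truncTotal_eq_ite]
  split_ifs with hd
  · obtain ⟨m, rfl⟩ : ∃ m, d = Finsupp.single () m := ⟨d (), by ext; simp⟩
    have hm : m ≤ n := by simpa [Nat.lt_succ_iff] using hd
    have := F.coeff_approx_of_le hm
    refine Eq.trans ?_ this.symm
    exact PowerSeries.coeff_mk m _
  · rfl

lemma hasSubst_invSeries : PowerSeries.HasSubst F.invSeries := by
  apply PowerSeries.HasSubst.of_constantCoeff_zero'
  rw [← PowerSeries.coeff_zero_eq_constantCoeff_apply, invSeries, PowerSeries.coeff_mk]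
  simp [approx]

lemma subst_invSeries : F.toPowerSeries.subst ![PowerSeries.X, F.invSeries] = 0 := by
  refine PowerSeries.ext fun n => ?_
  have h1 := F.approx_truncTotal PowerSeries.HasSubst.X' F.hasSubst_invSeries
    (F.approx_hasSubst n).1 (F.truncTotal_invSeries n)
  have h2 := F.approx_order n
  rw [PowerSeries.order_eq_order] at h2
  rw [F.approx_eq n, truncTotal_eq_zero_of_le_order h2] at h1
  have := congrArg (MvPolynomial.coeff (Finsupp.single () n)) h1
  rwa [coeff_truncTotal _ (by simp)] at this

lemma subst_invSeries' {τ : Type*} {f : MvPowerSeries τ R} (hf : PowerSeries.HasSubst f) :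
    F.toPowerSeries.subst ![f, F.invSeries.subst f] = 0 := by
  have := congrArg (PowerSeries.subst f) F.subst_invSeries
  rw [PowerSeries.subst, subst_comp_subst_apply
    (hasSubst_pair PowerSeries.HasSubst.X' F.hasSubst_invSeries) hf.const] at this
  rw [show PowerSeries.subst f (0 : PowerSeries R) = 0 by
    rw [← PowerSeries.coe_substAlgHom hf, map_zero]] at this
  rw [← this]
  congr! 2 with s
  fin_cases s
  · exact (PowerSeries.subst_X hf).symm
  · rfl

lemma hasSubst_invSeries_subst {τ : Type*} {f : MvPowerSeries τ R} (hf : PowerSeries.HasSubst f) :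
    PowerSeries.HasSubst (F.invSeries.subst f) :=
  IsNilpotent_subst hf.const F.hasSubst_invSeries

instance (τ : Type*) : Neg (F.Point τ) where
  neg x := ⟨F.invSeries.subst x.val, F.hasSubst_invSeries_subst x.prop⟩

instance [F.IsComm] (τ : Type*) : AddCommGroup (F.Point τ) where
  zsmul := zsmulRec
  neg_add_cancel x := (add_comm _ _).trans (Subtype.ext (F.subst_invSeries' x.prop))


end FormalGroup

section FormalGroupAlgebra

variable {R T σ : Type*} [CommRing R] [AddCommGroup T] (F : FormalGroup R) [F.IsComm]
  (B : Module.Basis σ ℤ T)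

/-- The formal group algebra `R[[x_μ | μ ∈ T]] / (x_0, x_{μ+ν} - F(x_μ, x_ν))` of a lattice `T`,
realised, after the choice of a `ℤ`-basis `B` of `T`, as the ring of formal power series over `R`
in the variables `x_{B i}`. -/
def FormalGroupAlgebra (_F : FormalGroup R) (_B : Module.Basis σ ℤ T) : Type _ := MvPowerSeries σ R

instance : CommRing (FormalGroupAlgebra F B) := inferInstanceAs (CommRing (MvPowerSeries σ R))

instance : Algebra R (FormalGroupAlgebra F B) := inferInstanceAs (Algebra R (MvPowerSeries σ R))

namespace FormalGroupAlgebra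

/-- The homomorphism `μ ↦ x_μ` from `T` to the group of topologically nilpotent power series with
the group law `(f, g) ↦ F(f, g)`, determined by `B i ↦ X i`. -/
def pointHom : T →ₗ[ℤ] F.Point σ :=
  B.constr ℤ fun i => (⟨MvPowerSeries.X i, PowerSeries.HasSubst.X i⟩ : F.Point σ)

/-- The element `x_μ` of the formal group algebra. -/
def x (μ : T) : FormalGroupAlgebra F B := (pointHom F B μ).val

lemma x_basis (i : σ) : x F B (B i) = (MvPowerSeries.X i : MvPowerSeries σ R) := by
  have h : pointHom F B (B i) = ⟨MvPowerSeries.X i, PowerSeries.HasSubst.X i⟩ :=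
    B.constr_basis ℤ _ i
  exact congrArg Subtype.val h

lemma x_zero : x F B 0 = 0 := by
  simp only [x, map_zero]; rfl

lemma x_add (μ ν : T) :
    x F B (μ + ν) = F.toPowerSeries.subst ![(x F B μ : MvPowerSeries σ R), x F B ν] := by
  simp only [x, map_add]; rfl

variable [Finite σ]

lemma hasSubst_x (g : T →ₗ[ℤ] T) :
    MvPowerSeries.HasSubst (fun i => (x F B (g (B i)) : MvPowerSeries σ R)) :=
  hasSubst_of_constantCoeff_nilpotent fun i => (pointHom F B (g (B i))).prop

/-- The continuous `R`-algebra endomorphism `x_μ ↦ x_{g μ}`. -/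
def map (g : T →ₗ[ℤ] T) : FormalGroupAlgebra F B →ₐ[R] FormalGroupAlgebra F B :=
  (MvPowerSeries.substAlgHom (hasSubst_x F B g) : MvPowerSeries σ R →ₐ[R] MvPowerSeries σ R)

lemma map_apply (g : T →ₗ[ℤ] T) (f : FormalGroupAlgebra F B) :
    map F B g f = MvPowerSeries.subst (fun i => (x F B (g (B i)) : MvPowerSeries σ R))
      (f : MvPowerSeries σ R) :=
  MvPowerSeries.substAlgHom_apply _ _

lemma map_x (g : T →ₗ[ℤ] T) (μ : T) : map F B g (x F B μ) = x F B (g μ) := by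
  let φ : F.Point σ →+ F.Point σ :=
    { toFun := fun p => ⟨MvPowerSeries.subst
          (fun i => (x F B (g (B i)) : MvPowerSeries σ R)) p.val,
        MvPowerSeries.IsNilpotent_subst (hasSubst_x F B g) p.prop⟩
      map_zero' := Subtype.ext (by
        change MvPowerSeries.subst _ (0 : MvPowerSeries σ R) = 0
        rw [← MvPowerSeries.coe_substAlgHom (hasSubst_x F B g), map_zero])
      map_add' := fun p q => Subtype.ext (by
        change MvPowerSeries.subst _ (MvPowerSeries.subst _ _) = MvPowerSeries.subst _ _
        rw [MvPowerSeries.subst_comp_subst_apply (FormalGroup.hasSubst_pair p.prop q.prop)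
          (hasSubst_x F B g)]
        congr! 2 with s
        fin_cases s <;> rfl) }
  have h : φ.toIntLinearMap ∘ₗ pointHom F B = pointHom F B ∘ₗ g := by
    refine B.ext fun i => Subtype.ext ?_
    change MvPowerSeries.subst _ (x F B (B i) : MvPowerSeries σ R) = x F B (g (B i))
    rw [x_basis, MvPowerSeries.subst_X (hasSubst_x F B g)]
  rw [map_apply]
  exact congrArg Subtype.val (LinearMap.congr_fun h μ)

lemma map_id : map F B LinearMap.id = AlgHom.id R _ := by
  ext f : 1
  rw [map_apply]
  simp only [LinearMap.id_apply, x_basis]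
  exact congrFun MvPowerSeries.subst_self f

lemma map_comp (g h : T →ₗ[ℤ] T) : map F B (g ∘ₗ h) = (map F B g).comp (map F B h) := by
  refine AlgHom.ext fun f => ?_
  have e : (fun i => (x F B ((g ∘ₗ h) (B i)) : MvPowerSeries σ R)) = fun i =>
      MvPowerSeries.subst (fun i => (x F B (g (B i)) : MvPowerSeries σ R))
        (x F B (h (B i)) : MvPowerSeries σ R) :=
    funext fun i => (map_x F B g (h (B i))).symm.trans (map_apply F B g _)
  refine (map_apply F B _ f).trans ?_
  refine Eq.trans ?_ (map_apply F B g _).symm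
  refine Eq.trans ?_ (congrArg _ (map_apply F B h f).symm)
  rw [e]
  exact (MvPowerSeries.subst_comp_subst_apply (hasSubst_x F B h) (hasSubst_x F B g) _).symm

end FormalGroupAlgebra

end FormalGroupAlgebra

section Affine

variable {ι R T L σ : Type*} [CommRing R] [AddCommGroup T] [AddCommGroup L]
  (P : RootPairing ι ℤ T L)

/-- The action of the Weyl group on the cocharacter lattice. -/
def coweightAction : P.weylGroup →* MulAut (Multiplicative L) where
  toFun w := AddEquiv.toMultiplicative
    (RootPairing.Equiv.coweightEquiv P P ((w : P.Aut)⁻¹)).toAddEquiv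
  map_one' := by
    ext n
    simp only [Subgroup.coe_one, inv_one]
    rfl
  map_mul' u v := by
    ext n
    simp only [Subgroup.coe_mul, mul_inv_rev]
    rfl

/-- The group `W ⋉ L`, where `L` is the cocharacter lattice, which is the coroot lattice when the
root datum is simply connected; it is then the affine Weyl group. -/
abbrev AffineWeyl : Type _ := Multiplicative L ⋊[coweightAction P] P.weylGroup

lemma coweightAction_ofIdx (i : ι) (l : L) :
    coweightAction P (RootPairing.weylGroup.ofIdx P i) (Multiplicative.ofAdd l) =
      Multiplicative.ofAdd (P.coreflection i l) := by
  have : ((RootPairing.weylGroup.ofIdx P i : P.weylGroup) : P.Aut)⁻¹ =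
      RootPairing.Equiv.reflection P i := RootPairing.Equiv.reflection_inv P i
  simp only [coweightAction, MonoidHom.coe_mk, OneHom.coe_mk, this]
  rfl

namespace AffineWeyl

/-- The translation `t_l`. -/
def t (l : L) : AffineWeyl P := SemidirectProduct.inl (Multiplicative.ofAdd l)

/-- The finite Weyl group inside the affine one. -/
def finiteWeyl : Subgroup (AffineWeyl P) := (SemidirectProduct.inr : P.weylGroup →* _).range

/-- The reflection `s_α` of the finite Weyl group. -/
def s (i : ι) : AffineWeyl P := SemidirectProduct.inr (RootPairing.weylGroup.ofIdx P i)

variable {P} (b : P.Base) (θ : ι)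

/-- The simple reflections, indexed by the affine Dynkin diagram: `none` is the affine node, whose
simple root is `α₀ = -θ + δ`, with `s₀ = s_θ t_{-θ^∨}`. -/
def simple : Option b.support → AffineWeyl P
  | some i => s P i
  | none => s P θ * t P (-P.coroot θ)

/-- The product of the simple reflections in a sequence. -/
def wordProd (l : List (Option b.support)) : AffineWeyl P := (l.map (simple b θ)).prod

/-- The length function with respect to the affine simple reflections. -/
def length (w : AffineWeyl P) : ℕ :=
  sInf {n | ∃ l : List (Option b.support), wordProd b θ l = w ∧ l.length = n}

/-- `l` is a reduced sequence of `w`. -/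
def IsReducedSeq (l : List (Option b.support)) (w : AffineWeyl P) : Prop :=
  wordProd b θ l = w ∧ ∀ l' : List (Option b.support), wordProd b θ l' = w → l.length ≤ l'.length

/-- The minimal length representatives of the cosets in `W_a / W`. -/
def minReps : Set (AffineWeyl P) :=
  {w | ∀ v ∈ finiteWeyl P, length b θ w ≤ length b θ (w * v)}

/-- A choice of reduced sequences is `W`-compatible if `I_{uv}` is the concatenation of
`I_u` and `I_v` for `u` a minimal length representative and `v ∈ W`. -/
def IsCompatible (I : AffineWeyl P → List (Option b.support)) : Prop :=
  ∀ u ∈ minReps b θ, ∀ v ∈ finiteWeyl P, I (u * v) = I u ++ I v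

end AffineWeyl

/-- `θ` is the highest root: `θ - α` is a sum of simple roots for every root `α`. A root system
that has such a root is irreducible. -/
def IsHighestRoot {P : RootPairing ι ℤ T L} (b : P.Base) (θ : ι) : Prop :=
  ∀ i, P.root θ - P.root i ∈ AddSubmonoid.closure (P.root '' b.support)

variable (F : FormalGroup R) [F.IsComm] (B : Module.Basis σ ℤ T)

/-- The multiplicative set generated by the `x_α`, `α` a root. -/
def rootSubmonoid : Submonoid (FormalGroupAlgebra F B) :=
  Submonoid.closure (Set.range fun i => FormalGroupAlgebra.x F B (P.root i))

/-- The ring `𝒬 = S[1/x_α, α ∈ Φ]`. -/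
abbrev RootLocalization : Type _ := Localization (rootSubmonoid P F B)

/-- The element `1 / x_α` of `𝒬`. -/
def xInv (i : ι) : RootLocalization P F B :=
  Localization.mk 1 ⟨FormalGroupAlgebra.x F B (P.root i), Submonoid.subset_closure ⟨i, rfl⟩⟩

variable [Finite σ]

lemma rootSubmonoid_le_comap (w : P.Aut) :
    rootSubmonoid P F B ≤ (rootSubmonoid P F B).comap
      (FormalGroupAlgebra.map F B (RootPairing.Equiv.weightHom P w).toLinearMap).toRingHom := by
  refine Submonoid.closure_le.mpr ?_
  rintro _ ⟨i, rfl⟩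
  refine Submonoid.subset_closure ⟨w.indexEquiv i, ?_⟩
  refine Eq.trans ?_ (FormalGroupAlgebra.map_x F B _ _).symm
  exact congrArg _ (RootPairing.Equiv.root_indexEquiv_eq_smul (P := P) i w)

/-- The endomorphism of `𝒬` induced by an automorphism of the root datum. -/
def localMap (w : P.Aut) : RootLocalization P F B →+* RootLocalization P F B :=
  IsLocalization.map (RootLocalization P F B)
    (FormalGroupAlgebra.map F B (RootPairing.Equiv.weightHom P w).toLinearMap).toRingHom
    (rootSubmonoid_le_comap P F B w)

lemma localMap_algebraMap (w : P.Aut) (f : FormalGroupAlgebra F B) :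
    localMap P F B w (algebraMap _ _ f) = algebraMap _ _
      (FormalGroupAlgebra.map F B (RootPairing.Equiv.weightHom P w).toLinearMap f) :=
  IsLocalization.map_eq _ f

lemma localMap_one : localMap P F B 1 = RingHom.id _ := by
  refine IsLocalization.ringHom_ext (rootSubmonoid P F B) (RingHom.ext fun f => ?_)
  refine (localMap_algebraMap P F B 1 f).trans ?_
  rw [map_one]
  exact congrArg _ (AlgHom.congr_fun (FormalGroupAlgebra.map_id F B) f)

lemma localMap_mul (u v : P.Aut) :
    localMap P F B (u * v) = (localMap P F B u).comp (localMap P F B v) := by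
  refine IsLocalization.ringHom_ext (rootSubmonoid P F B) (RingHom.ext fun f => ?_)
  refine (localMap_algebraMap P F B _ f).trans ?_
  rw [RingHom.comp_apply, RingHom.comp_apply, localMap_algebraMap, localMap_algebraMap, map_mul]
  exact congrArg _ (AlgHom.congr_fun (FormalGroupAlgebra.map_comp F B _ _) f)

/-- The action of `W` on `𝒬`, with `w(x_μ) = x_{w(μ)}`. -/
instance : MulSemiringAction P.weylGroup (RootLocalization P F B) where
  smul w q := localMap P F B w q
  one_smul q := RingHom.congr_fun (localMap_one P F B) q
  mul_smul u v q := RingHom.congr_fun (localMap_mul P F B u v) q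
  smul_zero w := map_zero (localMap P F B w)
  smul_add w := map_add (localMap P F B w)
  smul_one w := map_one (localMap P F B w)
  smul_mul w := map_mul (localMap P F B w)

/-- The affine Weyl group acts on `𝒬` through its quotient `W`: translations act trivially. -/
instance : MulSemiringAction (AffineWeyl P) (RootLocalization P F B) :=
  MulSemiringAction.compHom _ (SemidirectProduct.rightHom : AffineWeyl P →* P.weylGroup)

/-- The restriction of the action of the affine Weyl group on `𝒬` to the lattice of translations. -/
instance : MulSemiringAction (Multiplicative L) (RootLocalization P F B) :=
  MulSemiringAction.compHom _ (SemidirectProduct.inl : Multiplicative L →* AffineWeyl P)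

/-- The twisted group algebra `𝒬_{W_a} = 𝒬 ⋊ R[W_a]`. -/
abbrev TwistedAffine : Type _ := SkewMonoidAlgebra (RootLocalization P F B) (AffineWeyl P)

/-- The twisted group algebra `𝒬_{Q^∨} = 𝒬 ⋊ R[Q^∨]`. -/
abbrev TwistedLattice : Type _ := SkewMonoidAlgebra (RootLocalization P F B) (Multiplicative L)

namespace TwistedAffine

/-- The basis element `η_w`. -/
def η (w : AffineWeyl P) : TwistedAffine P F B := SkewMonoidAlgebra.single w 1

/-- The projection `𝒬_{W_a} → 𝒬_{Q^∨}`, `p η_{t_λ w} ↦ p η_{t_λ}` for `w ∈ W`. -/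
def pr : TwistedAffine P F B →+ TwistedLattice P F B :=
  SkewMonoidAlgebra.mapDomain fun w : AffineWeyl P => w.left

/-- The ring embedding `𝒬_{Q^∨} → 𝒬_{W_a}`, `p η_{t_λ} ↦ p η_{t_λ}`. -/
def k : TwistedLattice P F B →+* TwistedAffine P F B :=
  SkewMonoidAlgebra.mapDomainRingHom
    (f := (SemidirectProduct.inl : Multiplicative L →* AffineWeyl P)) fun _ _ => rfl

variable {P} (b : P.Base) (θ : ι)

/-- The Demazure elements `X_i = (1 / x_{α_i}) (1 - η_{s_i})` and
`X_0 = (1 / x_{-θ}) (1 - η_{s_0})`. -/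
def X : Option b.support → TwistedAffine P F B
  | some i => xInv P F B i • (1 - η P F B (AffineWeyl.simple b θ (some i)))
  | none => xInv P F B (P.reflectionPerm θ θ) • (1 - η P F B (AffineWeyl.simple b θ none))

/-- The product `X_{i_1} ⋯ X_{i_k}` attached to a sequence. -/
def XSeq (l : List (Option b.support)) : TwistedAffine P F B := (l.map (X F B b θ)).prod

/-- The small torus formal affine Demazure algebra `𝐃_{W_a}`: the subalgebra of `𝒬_{W_a}` generated
by `S` and the `X_i`. -/
def demazure : Subring (TwistedAffine P F B) :=
  Subring.closure
    (Set.range (fun f : FormalGroupAlgebra F B => f • (1 : TwistedAffine P F B)) ∪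
      Set.range (X F B b θ))

/-- The element `𝔛_l = pr(X_l)` of `𝒬_{Q^∨}`. -/
def frakX (l : List (Option b.support)) : TwistedLattice P F B := pr P F B (XSeq F B b θ l)

/-- The Peterson subalgebra `k(pr(𝐃_{W_a}))`. -/
def peterson : Set (TwistedAffine P F B) :=
  k P F B '' (pr P F B '' (demazure F B b θ : Set (TwistedAffine P F B)))

end TwistedAffine

end Affine

end FADA

noncomputable section FormalPeterson

open MvPowerSeries

set_option linter.unusedSectionVars false

/-- Setting the variable `X s` to zero does not change a power series modulo `X s`. -/
lemma MvPowerSeries.X_dvd_sub_subst_update {σ R : Type*} [CommRing R] [DecidableEq σ] [Finite σ]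
    (s : σ) (f : MvPowerSeries σ R) :
    (X s : MvPowerSeries σ R) ∣ f - subst (Function.update (X : σ → MvPowerSeries σ R) s 0) f := by
  have ha : HasSubst (Function.update (X : σ → MvPowerSeries σ R) s 0) :=
    hasSubst_of_constantCoeff_zero fun i => by
      rcases eq_or_ne i s with rfl | h
      · simp
      · simp [h]
  rw [X_dvd_iff]
  intro m hm
  rw [map_sub, coeff_subst ha]
  have key : ∀ d : σ →₀ ℕ, (d.prod fun i e =>
      (Function.update (X : σ → MvPowerSeries σ R) s 0 i) ^ e) =
      if d s = 0 then monomial d 1 else 0 := by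
    intro d
    split_ifs with h
    · rw [monomial_one_eq]
      refine Finsupp.prod_congr fun i hi => ?_
      have : i ≠ s := by
        rintro rfl
        exact (Finsupp.mem_support_iff.mp hi) h
      rw [Function.update_of_ne this]
    · rw [Finsupp.prod]
      refine Finset.prod_eq_zero (Finsupp.mem_support_iff.mpr h) ?_
      rw [Function.update_self, zero_pow h]
  simp_rw [key]
  rw [finsum_eq_single _ m]
  · simp [hm]
  · intro d hd
    split_ifs
    · rw [coeff_monomial_ne hd.symm, smul_zero]
    · simp

namespace FormalGroup

variable {R : Type*} [CommRing R] (F : FormalGroup R)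

/-- A formal group law is `X + Y` up to a multiple of `XY`. -/
lemma exists_eq_add_add_mul : ∃ g : MvPowerSeries (Fin 2) R,
    F.toPowerSeries = X 0 + X 1 + X 0 * X 1 * g := by
  classical
  set f : MvPowerSeries (Fin 2) R := F.toPowerSeries - (X 0 + X 1) with hf
  have hX : ∀ i : Fin 2, PowerSeries.HasSubst (X i : MvPowerSeries (Fin 2) R) :=
    fun i => PowerSeries.HasSubst.X i
  have h0 : (X 0 : MvPowerSeries (Fin 2) R) ∣ f := by
    have h := X_dvd_sub_subst_update 0 f
    have e : Function.update (X : Fin 2 → MvPowerSeries (Fin 2) R) 0 0 = ![0, X 1] := by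
      ext i : 1
      fin_cases i <;> simp
    have hs : HasSubst ![(0 : MvPowerSeries (Fin 2) R), X 1] := HasSubst.zero_X
    rw [e, hf, subst_sub hs, subst_add hs, subst_X hs, subst_X hs, zero_add F (hX 1)] at h
    simpa using h
  have h1 : (X 1 : MvPowerSeries (Fin 2) R) ∣ f := by
    have h := X_dvd_sub_subst_update 1 f
    have e : Function.update (X : Fin 2 → MvPowerSeries (Fin 2) R) 1 0 = ![X 0, 0] := by
      ext i : 1
      fin_cases i <;> simp
    have hs : HasSubst ![X 0, (0 : MvPowerSeries (Fin 2) R)] := HasSubst.X_zero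
    rw [e, hf, subst_sub hs, subst_add hs, subst_X hs, subst_X hs, add_zero F (hX 0)] at h
    simpa using h
  obtain ⟨q, hq⟩ := h0
  have h2 : (X 1 : MvPowerSeries (Fin 2) R) ∣ q := by
    rw [X_dvd_iff] at h1 ⊢
    intro m hm
    have := h1 (m + Finsupp.single 0 1) (by simp [hm])
    rwa [hq, X, add_comm m, coeff_add_monomial_mul, one_mul] at this
  obtain ⟨g, rfl⟩ := h2
  exact ⟨g, by rw [mul_assoc, ← hq, hf]; ring⟩

lemma exists_subst_eq {τ : Type*} : ∃ g : MvPowerSeries (Fin 2) R,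
    ∀ a b : MvPowerSeries τ R, PowerSeries.HasSubst a → PowerSeries.HasSubst b →
      F.toPowerSeries.subst ![a, b] = a + b + a * b * g.subst ![a, b] := by
  obtain ⟨g, hg⟩ := F.exists_eq_add_add_mul
  refine ⟨g, fun a b ha hb => ?_⟩
  have hs := hasSubst_pair ha hb
  rw [hg, subst_add hs, subst_add hs, subst_mul hs, subst_mul hs, subst_X hs, subst_X hs]
  rfl

/-- The point given by a variable. -/
def varPoint {τ : Type*} (i : τ) : F.Point τ := ⟨X i, PowerSeries.HasSubst.X i⟩

/-- Substitution of power series in the points of a formal group. -/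
def pointSubst [F.IsComm] {τ τ' : Type*} {a : τ → MvPowerSeries τ' R} (ha : HasSubst a) :
    F.Point τ →+ F.Point τ' where
  toFun p := ⟨subst a p.val, IsNilpotent_subst ha p.prop⟩
  map_zero' := Subtype.ext (by
    change subst a (0 : MvPowerSeries τ R) = 0
    rw [← coe_substAlgHom ha, map_zero])
  map_add' p q := Subtype.ext (by
    change subst a (subst _ _) = subst _ _
    rw [subst_comp_subst_apply (hasSubst_pair p.prop q.prop) ha]
    congr! 2 with s
    fin_cases s <;> rfl)

end FormalGroup

namespace FormalGroupAlgebra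

open FormalGroup

variable {R T σ : Type*} [CommRing R] [AddCommGroup T] (F : FormalGroup R) [F.IsComm]
  (B : Module.Basis σ ℤ T)

lemma subst_varPoint_sub {τ τ' : Type*} {b : τ → MvPowerSeries τ' R} (hb : HasSubst b) (i j : τ)
    (n : ℤ) : subst b (F.varPoint i - n • F.varPoint j).val =
      (F.pointSubst hb (F.varPoint i) - n • F.pointSubst hb (F.varPoint j)).val := by
  rw [← map_zsmul, ← map_sub]
  rfl

lemma hasSubst_x_val (μ : T) : PowerSeries.HasSubst (x F B μ : MvPowerSeries σ R) :=
  (pointHom F B μ).prop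

/-- `f` and its image under `μ ↦ μ - φ(μ) γ` agree modulo `x_γ`. -/
lemma x_dvd_sub_map [Finite σ] (γ : T) (φ : T →ₗ[ℤ] ℤ) (g : T →ₗ[ℤ] T)
    (hg : ∀ μ, g μ = μ - φ μ • γ) (f : FormalGroupAlgebra F B) :
    x F B γ ∣ f - map F B g f := by
  classical
  obtain ⟨q, hq, hqb⟩ : ∃ q : σ → MvPowerSeries (Option σ) R, HasSubst q ∧
      ∀ i, q i = (F.varPoint (some i) - φ (B i) • F.varPoint none).val :=
    ⟨_, hasSubst_of_constantCoeff_nilpotent fun i =>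
      (F.varPoint (some i) - φ (B i) • F.varPoint none).prop, fun _ => rfl⟩
  let a : Option σ → MvPowerSeries σ R := fun o => o.elim (x F B γ) X
  have ha : HasSubst a := hasSubst_of_constantCoeff_nilpotent fun o => by
    rcases o with _ | i
    · exact hasSubst_x_val F B γ
    · exact PowerSeries.HasSubst.X i
  let u : Option σ → MvPowerSeries (Option σ) R := Function.update X none 0
  have hu : HasSubst u := hasSubst_of_constantCoeff_zero fun o => by
    rcases o with _ | i <;> simp [u]
  have hsome : HasSubst (fun i : σ => (X (some i) : MvPowerSeries (Option σ) R)) :=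
    hasSubst_of_constantCoeff_zero fun i => by simp
  suffices key : ∀ f : MvPowerSeries σ R, (x F B γ : MvPowerSeries σ R) ∣
      subst (fun i => (x F B (g (B i)) : MvPowerSeries σ R)) f - f by
    rw [← dvd_neg, neg_sub, map_apply]
    exact key f
  intro f
  have h1 : X none ∣ subst q f - subst u (subst q f) :=
    X_dvd_sub_subst_update none (subst q f)
  rw [subst_comp_subst_apply hq hu] at h1
  have e1 : (fun i => subst u (q i)) = fun i : σ => (X (some i) : MvPowerSeries _ R) := by
    funext i
    have e0 : F.pointSubst hu (F.varPoint none) = 0 := Subtype.ext (by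
      change subst u (X none) = 0
      rw [subst_X hu]
      simp [u])
    rw [hqb, subst_varPoint_sub F hu, e0, smul_zero, sub_zero]
    change subst u (X (some i)) = _
    rw [subst_X hu]
    simp [u]
  rw [e1] at h1
  have h2 := map_dvd (substAlgHom (R := R) ha) h1
  rw [map_sub] at h2
  simp only [coe_substAlgHom] at h2
  rw [subst_comp_subst_apply hq ha, subst_comp_subst_apply hsome ha, subst_X ha] at h2
  have e2 : (fun i => subst a (q i)) = fun i => (x F B (g (B i)) : MvPowerSeries σ R) := by
    funext i
    have e3 : F.pointSubst ha (F.varPoint none) = pointHom F B γ :=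
      Subtype.ext (subst_X ha _)
    have e4 : F.pointSubst ha (F.varPoint (some i)) = pointHom F B (B i) :=
      Subtype.ext ((subst_X ha _).trans (x_basis F B i).symm)
    rw [hqb, subst_varPoint_sub F ha, e3, e4, ← map_zsmul, ← map_sub, hg]
    rfl
  have e5 : (fun i => subst a (X (some i) : MvPowerSeries (Option σ) R)) =
      (X : σ → MvPowerSeries σ R) := funext fun i => subst_X ha _
  rw [e2, e5, subst_self] at h2
  exact h2

lemma exists_x_add_eq (μ ν : T) : ∃ q : FormalGroupAlgebra F B,
    x F B (μ + ν) = x F B μ + x F B ν + x F B μ * x F B ν * q := by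
  obtain ⟨g, hg⟩ := F.exists_subst_eq (τ := σ)
  exact ⟨_, (x_add F B μ ν).trans (hg _ _ (hasSubst_x_val F B μ) (hasSubst_x_val F B ν))⟩

/-- The sum `x_γ + x_{-γ}` is divisible by `x_γ x_{-γ}`. -/
lemma x_mul_x_neg_dvd (γ : T) : x F B γ * x F B (-γ) ∣ x F B γ + x F B (-γ) := by
  obtain ⟨q, hq⟩ := exists_x_add_eq F B γ (-γ)
  rw [add_neg_cancel, x_zero] at hq
  exact ⟨-q, by linear_combination -hq⟩

/-- The ideal of power series of order at least `k`. -/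
def orderIdeal (k : ℕ) : Ideal (FormalGroupAlgebra F B) where
  carrier := {f | (k : ℕ∞) ≤ MvPowerSeries.order (f : MvPowerSeries σ R)}
  zero_mem' := by
    change (k : ℕ∞) ≤ MvPowerSeries.order (0 : MvPowerSeries σ R)
    simp
  add_mem' {f g} hf hg := le_trans (le_min hf hg) MvPowerSeries.min_order_le_add
  smul_mem' c {f} hf := le_trans (le_add_left hf) (MvPowerSeries.le_order_mul (f := c) (g := f))

lemma mem_orderIdeal {k : ℕ} {f : FormalGroupAlgebra F B} :
    f ∈ orderIdeal F B k ↔ (k : ℕ∞) ≤ MvPowerSeries.order (f : MvPowerSeries σ R) := Iff.rfl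

lemma mul_mem_orderIdeal {k l : ℕ} {f g : FormalGroupAlgebra F B} (hf : f ∈ orderIdeal F B k)
    (hg : g ∈ orderIdeal F B l) : f * g ∈ orderIdeal F B (k + l) := by
  rw [mem_orderIdeal] at *
  push_cast
  exact (add_le_add hf hg).trans (MvPowerSeries.le_order_mul (f := f) (g := g))

lemma orderIdeal_anti {k l : ℕ} (h : k ≤ l) : orderIdeal F B l ≤ orderIdeal F B k :=
  fun _ hf => le_trans (Nat.cast_le.mpr h) ((mem_orderIdeal F B).mp hf)

lemma mem_orderIdeal_zero (f : FormalGroupAlgebra F B) : f ∈ orderIdeal F B 0 := by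
  rw [mem_orderIdeal]; simp

/-- The augmentation, sending every `x_μ` to zero. -/
def augmentation : FormalGroupAlgebra F B →+* R :=
  (MvPowerSeries.constantCoeff : MvPowerSeries σ R →+* R)

lemma mem_orderIdeal_one {f : FormalGroupAlgebra F B} :
    f ∈ orderIdeal F B 1 ↔ augmentation F B f = 0 := by
  rw [mem_orderIdeal]
  exact MvPowerSeries.one_le_order_iff_constCoeff_eq_zero (f := f)

lemma isUnit_of_augmentation {f : FormalGroupAlgebra F B} (h : IsUnit (augmentation F B f)) :
    IsUnit f :=
  (MvPowerSeries.isUnit_iff_constantCoeff (φ := f)).mpr h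

section Domain

variable [IsDomain R]

instance : IsDomain (FormalGroupAlgebra F B) :=
  have : NoZeroDivisors (FormalGroupAlgebra F B) :=
    inferInstanceAs (NoZeroDivisors (MvPowerSeries σ R))
  have : Nontrivial (FormalGroupAlgebra F B) := inferInstanceAs (Nontrivial (MvPowerSeries σ R))
  NoZeroDivisors.to_isDomain _

lemma x_mem_orderIdeal (μ : T) : x F B μ ∈ orderIdeal F B 1 := by
  rw [mem_orderIdeal_one]
  exact IsNilpotent.eq_zero (hasSubst_x_val F B μ)

lemma x_add_sub_mem (μ ν : T) :
    x F B (μ + ν) - (x F B μ + x F B ν) ∈ orderIdeal F B 2 := by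
  obtain ⟨q, hq⟩ := exists_x_add_eq F B μ ν
  rw [hq, add_sub_cancel_left]
  exact Ideal.mul_mem_right _ _ (mul_mem_orderIdeal F B (k := 1) (l := 1)
    (x_mem_orderIdeal F B μ) (x_mem_orderIdeal F B ν))

/-- The linear part of `x_μ`. -/
def linearPart (i : σ) : T →+ R where
  toFun μ := MvPowerSeries.coeff (Finsupp.single i 1) (x F B μ : MvPowerSeries σ R)
  map_zero' := by
    rw [x_zero]
    exact map_zero _
  map_add' μ ν := by
    have h := MvPowerSeries.coeff_of_lt_order (d := Finsupp.single i 1)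
      (lt_of_lt_of_le (by simp) (x_add_sub_mem F B μ ν))
    let c : FormalGroupAlgebra F B →+ R :=
      (MvPowerSeries.coeff (Finsupp.single i 1) : MvPowerSeries σ R →ₗ[R] R).toAddMonoidHom
    have h' : c (x F B (μ + ν) - (x F B μ + x F B ν)) = 0 := h
    rw [map_sub, map_add, sub_eq_zero] at h'
    exact h'

lemma linearPart_apply (i : σ) (μ : T) : linearPart F B i μ = (B.repr μ i : R) := by
  have h : (linearPart F B i).toIntLinearMap =
      (Int.castAddHom R).toIntLinearMap ∘ₗ Finsupp.lapply i ∘ₗ B.repr.toLinearMap := by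
    refine B.ext fun j => ?_
    change MvPowerSeries.coeff (Finsupp.single i 1) (x F B (B j) : MvPowerSeries σ R) =
      ((B.repr (B j) i : ℤ) : R)
    classical
    rw [x_basis, MvPowerSeries.coeff_X, B.repr_self, Finsupp.single_apply]
    by_cases h : i = j
    · simp [h]
    · simp [h, Ne.symm h, Finsupp.single_left_inj]
  exact LinearMap.congr_fun h μ

variable [CharZero R]

lemma order_x {μ : T} (hμ : μ ≠ 0) : MvPowerSeries.order (x F B μ : MvPowerSeries σ R) = 1 := by
  obtain ⟨i, hi⟩ : ∃ i, B.repr μ i ≠ 0 := by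
    by_contra! h
    exact hμ (B.repr.map_eq_zero_iff.mp (Finsupp.ext h))
  refine le_antisymm ?_ (by exact_mod_cast x_mem_orderIdeal F B μ)
  have h : linearPart F B i μ ≠ 0 := by
    rw [linearPart_apply]
    exact_mod_cast hi
  simpa using MvPowerSeries.order_le (f := (x F B μ : MvPowerSeries σ R)) h

lemma x_ne_zero {μ : T} (hμ : μ ≠ 0) : x F B μ ≠ 0 := by
  intro h
  have := order_x F B hμ
  rw [h] at this
  change MvPowerSeries.order (0 : MvPowerSeries σ R) = 1 at this
  simp at this

lemma mem_orderIdeal_of_x_mul {μ : T} (hμ : μ ≠ 0) {k : ℕ} {f : FormalGroupAlgebra F B}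
    (h : x F B μ * f ∈ orderIdeal F B (k + 1)) : f ∈ orderIdeal F B k := by
  rw [mem_orderIdeal] at *
  have e : MvPowerSeries.order (x F B μ * f : MvPowerSeries σ R) = _ :=
    MvPowerSeries.order_mul (x F B μ : MvPowerSeries σ R) f
  have h' : ((k + 1 : ℕ) : ℕ∞) ≤ MvPowerSeries.order (x F B μ * f : MvPowerSeries σ R) := h
  rw [e, order_x F B hμ, add_comm] at h'
  push_cast at h'
  exact (ENat.add_le_add_iff_left ENat.one_ne_top).mp h'

end Domain

section Map

variable [Finite σ] [IsDomain R]

lemma map_mem_orderIdeal (g : T →ₗ[ℤ] T) {k : ℕ} {f : FormalGroupAlgebra F B}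
    (hf : f ∈ orderIdeal F B k) : map F B g f ∈ orderIdeal F B k := by
  rw [mem_orderIdeal, map_apply]
  refine le_trans ?_ (MvPowerSeries.le_order_subst (hasSubst_x F B g) _)
  refine le_trans hf ?_
  refine le_mul_of_one_le_left zero_le ?_
  refine le_iInf fun i => ?_
  exact_mod_cast x_mem_orderIdeal F B (g (B i))

lemma augmentation_map (g : T →ₗ[ℤ] T) (f : FormalGroupAlgebra F B) :
    augmentation F B (map F B g f) = augmentation F B f := by
  have h : f - algebraMap R _ (augmentation F B f) ∈ orderIdeal F B 1 := by
    rw [mem_orderIdeal_one, map_sub, sub_eq_zero]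
    exact (MvPowerSeries.constantCoeff_C (σ := σ) _).symm
  have h2 := map_mem_orderIdeal F B g h
  rw [mem_orderIdeal_one, map_sub, map_sub, AlgHom.commutes, sub_eq_zero] at h2
  exact h2.trans (MvPowerSeries.constantCoeff_C (σ := σ) _)

/-- If `γ` is primitive, then `x_γ` is prime to every power series with nonzero constant term. -/
lemma x_dvd_of_dvd_mul {γ : T} (φ : T →ₗ[ℤ] ℤ) (hφ : φ γ = 1) {δ f : FormalGroupAlgebra F B}
    (hδ : augmentation F B δ ≠ 0) (h : x F B γ ∣ δ * f) : x F B γ ∣ f := by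
  let g : T →ₗ[ℤ] T := LinearMap.id - φ.smulRight γ
  have hg : ∀ μ, g μ = μ - φ μ • γ := fun μ => rfl
  have h1 : map F B g (δ * f) = 0 := by
    obtain ⟨q, hq⟩ := h
    rw [hq, map_mul, map_x, hg, hφ, one_smul, sub_self, x_zero, zero_mul]
  rw [map_mul, mul_eq_zero] at h1
  rcases h1 with h1 | h1
  · exact absurd (by rw [← augmentation_map F B g, h1, map_zero]) hδ
  · have := x_dvd_sub_map F B γ φ g hg f
    rwa [h1, sub_zero] at this

end Map

end FormalGroupAlgebra

/-- The word `i, j, i, …` with `k` letters. -/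
def altWord {J : Type*} (i j : J) : ℕ → List J
  | 0 => []
  | k + 1 => i :: altWord j i k

section Words

variable {J G : Type*} [Group G]

lemma length_altWord (i j : J) (k : ℕ) : (altWord i j k).length = k := by
  induction k generalizing i j with
  | zero => rfl
  | succ k ih => simp [altWord, ih]

/-- Deleting a letter from an alternating word leaves an alternating word or a word that cancels. -/
lemma altWord_eq_append {s : J → G} (hs : ∀ j, s j * s j = 1) {i j c : J} {k : ℕ} {A B : List J}
    (h : altWord i j k = A ++ c :: B) :
    (A = [] ∧ c = i ∧ B = altWord j i (k - 1)) ∨ (B = [] ∧ A = altWord i j (k - 1)) ∨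
      ∃ D : List J, ((A ++ B).map s).prod = (D.map s).prod ∧ D.length + 3 ≤ k := by
  induction A generalizing i j k with
  | nil =>
    left
    cases k with
    | zero => simp [altWord] at h
    | succ k =>
      simp only [altWord, List.nil_append, List.cons.injEq] at h
      exact ⟨rfl, h.1.symm, h.2.symm⟩
  | cons a A ih =>
    right
    cases k with
    | zero => simp [altWord] at h
    | succ k =>
      simp only [altWord, List.cons_append, List.cons.injEq] at h
      obtain ⟨rfl, h⟩ := h
      have hk : k = A.length + B.length + 1 := by
        have := congrArg List.length h
        simp only [length_altWord, List.length_append, List.length_cons] at this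
        omega
      rcases ih h with ⟨rfl, -, rfl⟩ | ⟨rfl, rfl⟩ | ⟨D, hD, hDk⟩
      · obtain _ | _ | k := k
        · simp at hk
        · left
          simp [altWord]
        · right
          refine ⟨altWord j i k, ?_, by rw [length_altWord]⟩
          simp only [altWord, Nat.add_sub_cancel, List.cons_append, List.nil_append, List.map_cons,
            List.prod_cons]
          rw [← mul_assoc, hs, one_mul]
      · left
        obtain _ | k := k
        · simp at hk
        · exact ⟨rfl, rfl⟩
      · right
        exact ⟨i :: D, by simpa using hD, by simpa using hDk⟩

/-- A choice of words of minimal length for the elements of a group generated by involutions `s j`,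
subject to the exchange condition. -/
structure ExchangeWords (s : J → G) (I : G → List J) : Prop where
  injective : Function.Injective s
  mul_self : ∀ j, s j * s j = 1
  prod_eq : ∀ w, ((I w).map s).prod = w
  le : ∀ l : List J, (I (l.map s).prod).length ≤ l.length
  exchange : ∀ w j, (I (s j * w)).length = (I w).length + 1 ∨
    ∀ K : List J, (K.map s).prod = w → ∃ A c B, K = A ++ c :: B ∧
      s j * w = ((A ++ B).map s).prod

namespace ExchangeWords

variable {s : J → G} {I : G → List J} (h : ExchangeWords s I)
include h

lemma le_of_prod_eq {w : G} {l : List J} (hl : (l.map s).prod = w) :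
    (I w).length ≤ l.length := hl ▸ h.le l

lemma mul_mul_cancel (j : J) (w : G) : s j * (s j * w) = w := by
  rw [← mul_assoc, h.mul_self, one_mul]

lemma length_mul_lt_of_reduced_cons {j : J} {K : List J} {w : G}
    (hK : ((j :: K).map s).prod = w) (hred : K.length + 1 = (I w).length) :
    (K.map s).prod = s j * w ∧ K.length = (I (s j * w)).length := by
  have e : (K.map s).prod = s j * w := by
    rw [← hK, List.map_cons, List.prod_cons, h.mul_mul_cancel]
  refine ⟨e, le_antisymm ?_ (h.le_of_prod_eq e)⟩
  have := h.le_of_prod_eq (l := j :: I (s j * w)) (w := w) (by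
    rw [List.map_cons, List.prod_cons, h.prod_eq, h.mul_mul_cancel])
  simp only [List.length_cons] at this
  omega

/-- If `w` has a reduced word starting with an alternating word in `i, j` and `s j` is a left
descent, then the alternating part can be extended, unless it satisfies a braid relation. -/
lemma extend_altWord {i j : J} (hij : i ≠ j) {k : ℕ} {K : List J} {w : G}
    (hw : ((altWord i j (k + 1) ++ K).map s).prod = w)
    (hred : (k + 1) + K.length = (I w).length) (hj : (I (s j * w)).length < (I w).length) :
    ((altWord i j (k + 1)).map s).prod = ((altWord j i (k + 1)).map s).prod ∨
    ∃ K', ((altWord j i (k + 2) ++ K').map s).prod = w ∧ K'.length + 1 = K.length := by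
  obtain ⟨A, c, B, hAB, hprod⟩ := ((h.exchange w j).resolve_left (by omega)) _ hw
  rcases List.append_eq_append_iff.mp hAB with ⟨A', rfl, hK⟩ | ⟨B', hA, hB⟩
  · right
    refine ⟨A' ++ B, ?_, by rw [hK]; simp; omega⟩
    rw [← h.mul_mul_cancel j w, hprod, altWord]
    simp
  · rcases B' with _ | ⟨c', B'⟩
    · right
      simp only [List.append_nil] at hA
      simp only [List.nil_append] at hB
      refine ⟨B, ?_, by rw [← hB]; simp⟩
      rw [← h.mul_mul_cancel j w, hprod, altWord, hA]
      simp
    · left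
      simp only [List.cons_append, List.cons.injEq] at hB
      obtain ⟨rfl, rfl⟩ := hB
      have e : s j * ((altWord i j (k + 1)).map s).prod = ((A ++ B').map s).prod := by
        rw [← hw] at hprod
        simp only [List.map_append, List.prod_append, ← mul_assoc] at hprod
        simpa [← mul_assoc] using mul_right_cancel hprod
      rcases altWord_eq_append h.mul_self hA with ⟨rfl, rfl, rfl⟩ | ⟨rfl, rfl⟩ | ⟨D, hD, hDk⟩
      · exfalso
        simp only [altWord, List.map_cons, List.prod_cons, Nat.add_sub_cancel, List.nil_append,
          ← mul_assoc] at e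
        have e2 : s j * s c = 1 := mul_eq_right.mp e
        exact hij (h.injective (mul_left_cancel (e2.trans (h.mul_self j).symm)))
      · rw [List.append_nil, Nat.add_sub_cancel] at e
        rw [show altWord j i (k + 1) = j :: altWord i j k from rfl, List.map_cons, List.prod_cons,
          ← e, h.mul_mul_cancel]
      · exfalso
        rw [hD] at e
        have := h.le_of_prod_eq (l := j :: (D ++ K)) (w := w) (by
          rw [← hw, List.map_cons, List.prod_cons, List.map_append, List.prod_append, ← e,
            List.map_append, List.prod_append, mul_assoc, h.mul_mul_cancel])
        simp only [List.length_cons, List.length_append] at this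
        omega

/-- An element with two left descents `i ≠ j` has a reduced word starting with a side of a braid
relation. -/
lemma exists_braid {i j : J} (hij : i ≠ j) {w : G} (hi : (I (s i * w)).length < (I w).length)
    (hj : (I (s j * w)).length < (I w).length) :
    ∃ (k : ℕ) (K : List J),
      ((altWord i j (k + 1)).map s).prod = ((altWord j i (k + 1)).map s).prod ∧
      ((altWord i j (k + 1) ++ K).map s).prod = w ∧ (k + 1) + K.length = (I w).length := by
  suffices key : ∀ (n : ℕ) (i j : J) (k : ℕ) (K : List J), i ≠ j →
      (I (s i * w)).length < (I w).length → (I (s j * w)).length < (I w).length →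
      K.length = n → ((altWord i j (k + 1) ++ K).map s).prod = w →
      (k + 1) + K.length = (I w).length →
      ∃ (k : ℕ) (K : List J),
      ((altWord i j (k + 1)).map s).prod = ((altWord j i (k + 1)).map s).prod ∧
      ((altWord i j (k + 1) ++ K).map s).prod = w ∧ (k + 1) + K.length = (I w).length by
    refine key _ i j 0 (I (s i * w)) hij hi hj rfl ?_ ?_
    · simp only [altWord, List.cons_append, List.nil_append, List.map_cons, List.prod_cons,
        h.prod_eq, h.mul_mul_cancel]
    · have := h.le_of_prod_eq (l := i :: I (s i * w)) (w := w) (by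
        rw [List.map_cons, List.prod_cons, h.prod_eq, h.mul_mul_cancel])
      simp only [List.length_cons] at this
      omega
  intro n
  induction n with
  | zero =>
    intro i j k K hij hi hj hK hw hred
    rcases h.extend_altWord hij hw hred hj with hb | ⟨K', -, hK'⟩
    · exact ⟨k, K, hb, hw, hred⟩
    · omega
  | succ n ih =>
    intro i j k K hij hi hj hK hw hred
    rcases h.extend_altWord hij hw hred hj with hb | ⟨K', hw', hK'⟩
    · exact ⟨k, K, hb, hw, hred⟩
    · obtain ⟨k', K'', h1, h2, h3⟩ := ih j i (k + 1) K' hij.symm hj hi (by omega) hw' (by omega)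
      refine ⟨k', K'', h1.symm, ?_, h3⟩
      rw [List.map_append, List.prod_append, ← h1, ← List.prod_append, ← List.map_append, h2]

end ExchangeWords

end Words

section Span

variable {J G S A : Type*} [Group G] [CommRing S] [Ring A] [Module S A] [IsScalarTower S A A]

/-- Generators `X j` of an algebra that satisfy twisted Leibniz, quadratic and braid relations. -/
structure DemazureRelations (S : Type*) {A : Type*} [CommRing S] [Ring A] [Module S A]
    (s : J → G) (I : G → List J) (X : J → A) : Prop where
  leibniz : ∀ j (f : S), ∃ g d : S, ∀ a : A, X j * (f • a) = g • (X j * a) + d • a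
  quadratic : ∀ j, ∃ c : S, X j * X j = c • X j
  braid : ∀ i j k, i ≠ j → ((altWord i j k).map s).prod = ((altWord j i k).map s).prod →
    (I ((altWord i j k).map s).prod).length = k →
    ((altWord i j k).map X).prod - ((altWord j i k).map X).prod ∈
      Submodule.span S ((fun K : List J => (K.map X).prod) '' {K | K.length < k})

/-- The span of the products along the chosen words of length less than `n`. -/
def wordSpan (S : Type*) {A : Type*} [CommRing S] [Ring A] [Module S A] (I : G → List J)
    (X : J → A) (n : ℕ) : Submodule S A :=
  Submodule.span S ((fun v => ((I v).map X).prod) '' {v | (I v).length < n})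

omit [IsScalarTower S A A] [Group G] in
lemma wordSpan_mono (I : G → List J) (X : J → A) {m n : ℕ} (hmn : m ≤ n) :
    wordSpan S I X m ≤ wordSpan S I X n :=
  Submodule.span_mono (Set.image_mono fun _ hv => lt_of_lt_of_le hv hmn)

variable {s : J → G} {I : G → List J} {X : J → A} (h : ExchangeWords s I)
  (hX : DemazureRelations S s I X)
include h hX

omit [IsScalarTower S A A] h in
lemma DemazureRelations.mul_mem {j : J} {p : Set A} {N : Submodule S A}
    (hp : ∀ a ∈ p, a ∈ N) (hjp : ∀ a ∈ p, X j * a ∈ N) {a : A} (ha : a ∈ Submodule.span S p) :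
    X j * a ∈ N := by
  have hle : Submodule.span S p ≤ N := Submodule.span_le.mpr hp
  induction ha using Submodule.span_induction with
  | mem a ha => exact hjp a ha
  | zero => simp
  | add a b _ _ ha hb => rw [mul_add]; exact add_mem ha hb
  | smul f a ha iha =>
    obtain ⟨g, d, e⟩ := hX.leibniz j f
    rw [e]
    exact add_mem (N.smul_mem _ iha) (N.smul_mem _ (hle ha))

omit [IsScalarTower S A A] h in
lemma DemazureRelations.mul_mem_wordSpan {n : ℕ}
    (hA : ∀ K : List J, K.length < n + 1 → (K.map X).prod ∈ wordSpan S I X (n + 1)) {j : J}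
    {a : A} (ha : a ∈ wordSpan S I X n) : X j * a ∈ wordSpan S I X (n + 1) := by
  refine hX.mul_mem ?_ ?_ ha
  · rintro _ ⟨v, hv, rfl⟩
    exact hA _ (Nat.lt_succ_of_lt hv)
  · rintro _ ⟨v, hv, rfl⟩
    exact hA (j :: I v) (by simpa using hv)

/-- Products along two reduced words of the same element agree up to shorter words. -/
lemma DemazureRelations.reduced_sub_mem {n : ℕ}
    (hA : ∀ K : List J, K.length < n → (K.map X).prod ∈ wordSpan S I X n)
    (hR : ∀ m < n, ∀ K K' : List J, (K.map s).prod = (K'.map s).prod →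
      (I (K.map s).prod).length = m → K.length = m → K'.length = m →
      (K.map X).prod - (K'.map X).prod ∈ wordSpan S I X m)
    (K K' : List J) (he : (K.map s).prod = (K'.map s).prod)
    (hl : (I (K.map s).prod).length = n) (hK : K.length = n) (hK' : K'.length = n) :
    (K.map X).prod - (K'.map X).prod ∈ wordSpan S I X n := by
  have same : ∀ (w : G) (i : J) (K K' : List J), ((i :: K).map s).prod = w →
      ((i :: K').map s).prod = w → (I w).length = n → (i :: K).length = n →
      (i :: K').length = n →
      ((i :: K).map X).prod - ((i :: K').map X).prod ∈ wordSpan S I X n := by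
    intro w i K K' h1 h2 hw hK hK'
    obtain _ | n := n
    · simp at hK
    simp only [List.length_cons, Nat.add_right_cancel_iff] at hK hK'
    obtain ⟨e1, e2⟩ := h.length_mul_lt_of_reduced_cons h1 (by omega)
    obtain ⟨e1', -⟩ := h.length_mul_lt_of_reduced_cons h2 (by omega)
    simp only [List.map_cons, List.prod_cons]
    rw [← mul_sub]
    exact hX.mul_mem_wordSpan hA (hR n (Nat.lt_succ_self n) K K' (e1.trans e1'.symm)
      (by rw [e1, ← e2, hK]) hK hK')
  obtain ⟨w, hw⟩ : ∃ w, (K.map s).prod = w := ⟨_, rfl⟩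
  rw [hw] at he hl
  rcases K with _ | ⟨i, K⟩
  · subst hK
    rw [List.length_nil] at hK'
    rw [List.length_eq_zero_iff.mp hK', sub_self]
    exact zero_mem _
  rcases K' with _ | ⟨j, K'⟩
  · subst hK'
    simp at hK
  by_cases hij : i = j
  · subst hij
    exact same w i K K' hw he.symm hl hK hK'
  simp only [List.length_cons] at hK hK'
  obtain ⟨-, hi⟩ := h.length_mul_lt_of_reduced_cons hw (by omega)
  obtain ⟨-, hj⟩ := h.length_mul_lt_of_reduced_cons he.symm (by omega)
  obtain ⟨k, D, hb, hD, hDk⟩ := h.exists_braid hij (w := w) (by omega) (by omega)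
  have hD' : ((altWord j i (k + 1) ++ D).map s).prod = w := by
    rw [List.map_append, List.prod_append, ← hb, ← List.prod_append, ← List.map_append, hD]
  have s1 := same w i K (altWord j i k ++ D) hw hD hl (by simp [hK])
    (by simp [length_altWord]; omega)
  have s2 := same w j K' (altWord i j k ++ D) he.symm hD' hl (by simp [hK'])
    (by simp [length_altWord]; omega)
  have s3 : ((altWord i j (k + 1) ++ D).map X).prod - ((altWord j i (k + 1) ++ D).map X).prod ∈
      wordSpan S I X n := by
    have hred : (I ((altWord i j (k + 1)).map s).prod).length = k + 1 := by
      refine le_antisymm ((h.le _).trans_eq (length_altWord ..)) ?_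
      have := h.le_of_prod_eq (l := I ((altWord i j (k + 1)).map s).prod ++ D) (w := w) (by
        rw [List.map_append, List.prod_append, h.prod_eq, ← List.prod_append, ← List.map_append,
          hD])
      rw [List.length_append] at this
      omega
    have hbr := hX.braid i j (k + 1) hij hb hred
    rw [List.map_append, List.map_append, List.prod_append, List.prod_append, ← sub_mul]
    generalize ((altWord i j (k + 1)).map X).prod - ((altWord j i (k + 1)).map X).prod = a at hbr
    induction hbr using Submodule.span_induction with
    | mem a ha =>
      obtain ⟨E, hE, rfl⟩ := ha
      have := hA (E ++ D) (by
        have : E.length < k + 1 := hE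
        rw [List.length_append]
        omega)
      rwa [List.map_append, List.prod_append] at this
    | zero => simp
    | add a b _ _ ha hb => rw [add_mul]; exact add_mem ha hb
    | smul f a _ iha => rw [smul_mul_assoc]; exact Submodule.smul_mem _ _ iha
  have : ((i :: K).map X).prod - ((j :: K').map X).prod =
      (((i :: K).map X).prod - ((i :: (altWord j i k ++ D)).map X).prod) +
      (((altWord i j (k + 1) ++ D).map X).prod - ((altWord j i (k + 1) ++ D).map X).prod) -
      (((j :: K').map X).prod - ((j :: (altWord i j k ++ D)).map X).prod) := by
    simp only [altWord, List.cons_append]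
    abel
  rw [this]
  exact sub_mem (add_mem s1 s3) s2

/-- Products along arbitrary words are combinations of products along the chosen words. -/
theorem DemazureRelations.prod_mem_wordSpan (K : List J) :
    (K.map X).prod ∈ wordSpan S I X (K.length + 1) := by
  suffices key : ∀ n, (∀ K : List J, K.length < n → (K.map X).prod ∈ wordSpan S I X n) ∧
      (∀ m < n, ∀ K K' : List J, (K.map s).prod = (K'.map s).prod →
      (I (K.map s).prod).length = m → K.length = m → K'.length = m →
      (K.map X).prod - (K'.map X).prod ∈ wordSpan S I X m) from
    (key (K.length + 1)).1 K (Nat.lt_succ_self _)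
  intro n
  induction n with
  | zero => exact ⟨fun K hK => absurd hK (Nat.not_lt_zero _), fun m hm => absurd hm
      (Nat.not_lt_zero _)⟩
  | succ n ih =>
    obtain ⟨hA, hR⟩ := ih
    have hRn := hX.reduced_sub_mem h hA hR
    refine ⟨?_, fun m hm => ?_⟩
    · intro K hK
      rcases Nat.lt_succ_iff_lt_or_eq.mp hK with hK | hK
      · exact wordSpan_mono I X (Nat.le_succ n) (hA K hK)
      rcases K with _ | ⟨i, K⟩
      · have e : I 1 = [] := List.length_eq_zero_iff.mp
          (Nat.le_zero.mp (h.le_of_prod_eq (l := []) rfl))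
        exact Submodule.subset_span ⟨1, by simp [e], by simp [e]⟩
      obtain _ | n := n
      · simp at hK
      simp only [List.length_cons, Nat.add_right_cancel_iff] at hK
      have hmem := hA K (by omega)
      rw [List.map_cons, List.prod_cons]
      refine hX.mul_mem (N := wordSpan S I X (n + 1 + 1)) ?_ ?_ hmem
      · rintro _ ⟨v, hv, rfl⟩
        exact Submodule.subset_span ⟨v, Nat.lt_succ_of_lt hv, rfl⟩
      rintro _ ⟨v, hv, rfl⟩
      have hv : (I v).length < n + 1 := hv
      rcases Nat.lt_succ_iff_lt_or_eq.mp hv with hvn | hvn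
      · exact wordSpan_mono I X (Nat.le_succ _) (hA (i :: I v) (by simpa using hvn))
      have hiv : ((i :: I v).map s).prod = s i * v := by
        rw [List.map_cons, List.prod_cons, h.prod_eq]
      change X i * ((I v).map X).prod ∈ _
      rcases h.exchange v i with hl | hl
      · have := hRn (i :: I v) (I (s i * v)) (by rw [h.prod_eq, hiv]) (by rw [hiv]; omega)
          (by simp [hvn]) (by omega)
        rw [List.map_cons, List.prod_cons] at this
        rw [← sub_add_cancel (X i * _) ((I (s i * v)).map X).prod]
        exact add_mem (wordSpan_mono I X (Nat.le_succ _) this)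
          (Submodule.subset_span ⟨s i * v, by simp; omega, rfl⟩)
      · obtain ⟨E, c, E', hE, hp⟩ := hl _ (h.prod_eq v)
        have hlen := h.le_of_prod_eq hp.symm
        have hlen2 := congrArg List.length hE
        simp only [List.length_append, List.length_cons] at hlen hlen2
        have hpv : ((i :: I (s i * v)).map s).prod = v := by
          rw [List.map_cons, List.prod_cons, h.prod_eq, h.mul_mul_cancel]
        have hlen3 := h.le_of_prod_eq hpv
        rw [List.length_cons] at hlen3
        have hsub := hR n (Nat.lt_succ_self n) (I v) (i :: I (s i * v)) (by rw [hpv, h.prod_eq])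
          (by rw [h.prod_eq, hvn]) hvn (by rw [List.length_cons]; omega)
        have h1 := hX.mul_mem_wordSpan hA (j := i) hsub
        obtain ⟨c, hc⟩ := hX.quadratic i
        have h2 : X i * ((i :: I (s i * v)).map X).prod ∈ wordSpan S I X (n + 1) := by
          rw [List.map_cons, List.prod_cons, ← mul_assoc, hc, smul_mul_assoc]
          refine Submodule.smul_mem _ _ ?_
          have := hA (i :: I (s i * v)) (by rw [List.length_cons]; omega)
          rwa [List.map_cons, List.prod_cons] at this
        have h3 := add_mem h1 h2
        rw [← mul_add, sub_add_cancel] at h3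
        exact wordSpan_mono I X (Nat.le_succ _) h3
    · rcases Nat.lt_succ_iff_lt_or_eq.mp hm with hm | rfl
      · exact hR m hm
      · exact hRn

end Span

section AffineRoots

variable {ι T L : Type*} [AddCommGroup T] [AddCommGroup L] {P : RootPairing ι ℤ T L}

lemma RootPairing.toLinearMap_smul_coweightAction (g : P.weylGroup) (μ : T)
    (l : Multiplicative L) :
    P.toLinearMap (g • μ) (coweightAction P g l).toAdd = P.toLinearMap μ l.toAdd := by
  have h := LinearMap.congr_fun (RootPairing.Hom.weight_coweight_transpose_apply P P l.toAdd
    ((g : P.Aut)⁻¹).toHom) (g • μ)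
  have e : ((g : P.Aut)⁻¹).toHom.weightMap (g • μ) = μ := inv_smul_smul (g : P.Aut) μ
  change P.toLinearMap (((g : P.Aut)⁻¹).toHom.weightMap (g • μ)) l.toAdd =
    P.toLinearMap (g • μ) (((g : P.Aut)⁻¹).toHom.coweightMap l.toAdd) at h
  rw [e] at h
  exact h.symm

lemma RootPairing.weylGroup_smul_root (g : P.weylGroup) (i : ι) :
    g • P.root i = P.root ((g : P.Aut).indexEquiv i) :=
  (RootPairing.Equiv.root_indexEquiv_eq_smul (P := P) i (g : P.Aut)).symm

lemma RootPairing.toLinearMap_smul_coroot (g : P.weylGroup) (μ : T) (i : ι) :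
    P.toLinearMap (g • μ) (P.coroot ((g : P.Aut).indexEquiv i)) =
      P.toLinearMap μ (P.coroot i) := by
  refine Eq.trans ?_
    (RootPairing.toLinearMap_smul_coweightAction g μ (Multiplicative.ofAdd (P.coroot i)))
  congr 1
  refine Eq.trans ?_ (RootPairing.Hom.coroot_coweightMap_apply P P i ((g : P.Aut)⁻¹).toHom).symm
  congr 1

lemma RootPairing.root_reflectionPerm_self_eq (i : ι) :
    P.root (P.reflectionPerm i i) = -P.root i := by
  simp

lemma RootPairing.weylGroup_smul_zsmul (g : P.weylGroup) (n : ℤ) (μ : T) :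
    g • n • μ = n • g • μ :=
  map_zsmul (DistribSMul.toAddMonoidHom T g) n μ

namespace AffineWeyl

/-- The action of the affine Weyl group on `T ⊕ ℤδ`. -/
def act (w : AffineWeyl P) (v : T × ℤ) : T × ℤ :=
  (w.right • v.1, v.2 - P.toLinearMap (w.right • v.1) w.left.toAdd)

lemma act_one (v : T × ℤ) : act (1 : AffineWeyl P) v = v := by
  simp [act]

lemma act_mul (w w' : AffineWeyl P) (v : T × ℤ) : act (w * w') v = act w (act w' v) := by
  refine Prod.ext (mul_smul _ _ _) ?_
  simp only [act, SemidirectProduct.mul_left, SemidirectProduct.mul_right, toAdd_mul, map_add,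
    mul_smul, RootPairing.toLinearMap_smul_coweightAction]
  ring

lemma act_neg (w : AffineWeyl P) (v : T × ℤ) : act w (-v) = -act w v := by
  refine Prod.ext (by simp [act]) ?_
  simp only [act, Prod.fst_neg, Prod.snd_neg, smul_neg, map_neg, LinearMap.neg_apply]
  ring

lemma act_sub (w : AffineWeyl P) (v v' : T × ℤ) : act w (v - v') = act w v - act w v' := by
  refine Prod.ext (by simp [act, smul_sub]) ?_
  simp only [act, Prod.fst_sub, Prod.snd_sub, smul_sub, map_sub, LinearMap.sub_apply]
  ring

lemma act_zsmul (w : AffineWeyl P) (n : ℤ) (v : T × ℤ) : act w (n • v) = n • act w v := by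
  refine Prod.ext (RootPairing.weylGroup_smul_zsmul _ _ _) ?_
  simp only [act, Prod.smul_fst, Prod.smul_snd, RootPairing.weylGroup_smul_zsmul, map_zsmul,
    LinearMap.smul_apply, smul_sub]

lemma ext_act {w w' : AffineWeyl P} (h : ∀ v, act w v = act w' v) : w = w' := by
  have hr : w.right = w'.right := by
    refine Subtype.ext (RootPairing.Equiv.weightHom_injective P (LinearEquiv.ext fun μ => ?_))
    exact congrArg Prod.fst (h (μ, 0))
  refine SemidirectProduct.ext (Multiplicative.toAdd.injective ?_) hr
  have hp : P.toLinearMap.flip w.left.toAdd = P.toLinearMap.flip w'.left.toAdd := by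
    ext μ
    have := congrArg Prod.snd (h (w.right⁻¹ • μ, 0))
    simp only [act, ← hr, smul_inv_smul] at this
    simpa using this
  exact P.flip.toPerfPair.injective hp

variable (b : P.Base) (θ : ι)

/-- The root index of the finite part of a simple affine root. -/
def rootIdx : Option b.support → ι
  | some i => i
  | none => P.reflectionPerm θ θ

/-- The simple affine roots. -/
def simpleRoot (j : Option b.support) : T × ℤ :=
  (P.root (rootIdx b θ j), if j = none then 1 else 0)

lemma act_inr (g : P.weylGroup) (v : T × ℤ) :
    act (SemidirectProduct.inr g : AffineWeyl P) v = (g • v.1, v.2) := by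
  simp [act]

lemma act_t (l : L) (v : T × ℤ) : act (t P l) v = (v.1, v.2 - P.toLinearMap v.1 l) := by
  simp [act, t]

lemma act_simple (j : Option b.support) (v : T × ℤ) :
    act (simple b θ j) v =
      v - P.toLinearMap v.1 (P.coroot (rootIdx b θ j)) • simpleRoot b θ j := by
  rcases j with _ | i
  · rw [simple, act_mul, act_t, s, act_inr]
    refine Prod.ext ?_ ?_
    · simp [simpleRoot, rootIdx, P.reflection_apply]
      module
    · simp [simpleRoot, rootIdx]
  · rw [simple, s, act_inr]
    refine Prod.ext ?_ ?_
    · simp [simpleRoot, rootIdx, P.reflection_apply]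
    · simp [simpleRoot]

lemma simple_mul_self (j : Option b.support) : simple b θ j * simple b θ j = 1 := by
  refine ext_act fun v => ?_
  rw [act_one, act_mul, act_simple b θ j v, act_sub, act_zsmul, act_simple, act_simple]
  have : P.toLinearMap (simpleRoot b θ j).1 (P.coroot (rootIdx b θ j)) = 2 := by
    simp [simpleRoot]
  rw [this]
  module

lemma act_simpleRoot_self (j : Option b.support) :
    act (simple b θ j) (simpleRoot b θ j) = -simpleRoot b θ j := by
  rw [act_simple]
  have : P.toLinearMap (simpleRoot b θ j).1 (P.coroot (rootIdx b θ j)) = 2 := by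
    simp [simpleRoot]
  rw [this]
  module

/-- An element that maps a simple root to a simple root conjugates the simple reflections. -/
lemma mul_simple_eq {w : AffineWeyl P} {i j : Option b.support}
    (h : act w (simpleRoot b θ j) = simpleRoot b θ i) :
    w * simple b θ j = simple b θ i * w := by
  refine ext_act fun v => ?_
  have hi : (w.right : P.Aut).indexEquiv (rootIdx b θ j) = rootIdx b θ i := by
    refine P.root.injective ?_
    rw [← RootPairing.weylGroup_smul_root]
    exact congrArg Prod.fst h
  rw [act_mul, act_mul, act_simple, act_simple, act_sub, act_zsmul, h, ← hi]
  congr 2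
  exact (RootPairing.toLinearMap_smul_coroot w.right v.1 _).symm

/-- The positive affine roots. -/
def IsPosRoot (v : T × ℤ) : Prop :=
  ∃ i, P.root i = v.1 ∧ (0 < v.2 ∨ v.2 = 0 ∧ b.IsPos i)

variable {b}

lemma not_isPosRoot_neg {v : T × ℤ} (h : IsPosRoot b v) : ¬ IsPosRoot b (-v) := by
  rintro ⟨j, hj, h'⟩
  obtain ⟨i, hi, h⟩ := h
  have hij : j = P.reflectionPerm i i := P.root.injective (by
    rw [RootPairing.root_reflectionPerm_self_eq, hi, hj]; rfl)
  simp only [Prod.snd_neg] at h'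
  rcases h with h | ⟨h, hp⟩
  · rcases h' with h' | h' <;> omega
  · rcases h' with h' | ⟨-, h'⟩
    · omega
    · rw [hij] at h'
      exact (RootPairing.Base.IsPos.neg_iff_not b i).mp h' hp

end AffineWeyl

section Highest

variable {b : P.Base} {θ : ι}

lemma RootPairing.Base.height_add_of_mem_closure {i j : ι} {m : T}
    (hm : m ∈ AddSubmonoid.closure (P.root '' b.support)) (h : P.root j = P.root i + m) :
    b.height i ≤ b.height j ∧ (b.height i = b.height j → m = 0) := by
  have key : ∀ m ∈ AddSubmonoid.closure (P.root '' b.support), ∃ f : ι → ℤ, (∀ k, 0 ≤ f k) ∧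
      m = ∑ k ∈ b.support, f k • P.root k := by
    intro m hm
    induction hm using AddSubmonoid.closure_induction with
    | mem m hm =>
      classical
      obtain ⟨k, hk, rfl⟩ := hm
      refine ⟨Pi.single k 1, fun l => ?_, ?_⟩
      · by_cases h : l = k
        · subst h; simp
        · simp [h]
      · rw [Finset.sum_eq_single k]
        · simp
        · intro l _ hl; simp [hl]
        · intro h; exact absurd hk h
    | zero => exact ⟨0, fun _ => le_rfl, by simp⟩
    | add m m' _ _ h h' =>
      obtain ⟨f, hf, rfl⟩ := h
      obtain ⟨f', hf', rfl⟩ := h'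
      exact ⟨f + f', fun k => add_nonneg (hf k) (hf' k), by
        simp [add_smul, Finset.sum_add_distrib]⟩
  obtain ⟨f, hf, rfl⟩ := key m hm
  obtain ⟨g, -, -, hg⟩ := b.exists_root_eq_sum_int i
  have hj : P.root j = ∑ k ∈ b.support, (g + f) k • P.root k := by
    rw [h, hg, ← Finset.sum_add_distrib]
    simp [add_smul]
  rw [b.height_eq_sum hg, b.height_eq_sum hj]
  simp only [Pi.add_apply, Finset.sum_add_distrib]
  have hpos : 0 ≤ ∑ k ∈ b.support, f k := Finset.sum_nonneg fun k _ => hf k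
  refine ⟨by omega, fun he => ?_⟩
  have h0 : ∑ k ∈ b.support, f k = 0 := by omega
  rw [Finset.sum_eq_zero_iff_of_nonneg fun k _ => hf k] at h0
  exact Finset.sum_eq_zero fun k hk => by rw [h0 k hk, zero_smul]

variable (hθ : IsHighestRoot b θ)
include hθ

lemma IsHighestRoot.height_le (i : ι) :
    b.height i ≤ b.height θ ∧ (b.height i = b.height θ → i = θ) := by
  obtain ⟨h1, h2⟩ := RootPairing.Base.height_add_of_mem_closure (hθ i)
    (add_sub_cancel (P.root i) (P.root θ)).symm
  exact ⟨h1, fun h => P.root.injective (sub_eq_zero.mp (h2 h)).symm⟩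

lemma IsHighestRoot.height_pos : 0 < b.height θ := by
  have h1 := (hθ.height_le (P.reflectionPerm θ θ)).1
  have h2 : b.height (P.reflectionPerm θ θ) = -b.height θ := b.height_reflectionPerm_self θ
  have := b.height_ne_zero θ
  omega

lemma IsHighestRoot.height_reflection (i : ι) :
    b.height (P.reflectionPerm θ i) = b.height i - P.pairing i θ * b.height θ := by
  have : P.root (P.reflectionPerm θ i) = P.root i + (-P.pairing i θ) • P.root θ := by
    rw [P.root_reflectionPerm, P.reflection_apply_root]
    module
  rw [b.height_add_zsmul this]
  simp
  ring

/-- Positive roots pair to `0`, `1` or `2` with the highest coroot, and to `2` only if they are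
the highest root. -/
lemma IsHighestRoot.pairing_of_isPos {i : ι} (hi : b.IsPos i) :
    0 ≤ P.pairing i θ ∧ P.pairing i θ ≤ 2 ∧ (P.pairing i θ = 2 → i = θ) := by
  have h0 : 0 < b.height i := hi
  have hp := hθ.height_pos
  obtain ⟨h1, h2⟩ := hθ.height_le i
  have h3 := (hθ.height_le (P.reflectionPerm θ i)).1
  have h4 := (hθ.height_le (P.reflectionPerm (P.reflectionPerm θ i) (P.reflectionPerm θ i))).1
  have h5 : b.height (P.reflectionPerm (P.reflectionPerm θ i) (P.reflectionPerm θ i)) =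
    -b.height (P.reflectionPerm θ i) := b.height_reflectionPerm_self _
  rw [h5] at h4
  rw [hθ.height_reflection] at h3 h4
  refine ⟨?_, ?_, fun h => h2 ?_⟩
  · by_contra hlt
    nlinarith
  · by_contra hlt
    nlinarith
  · rw [h] at h4
    omega

lemma IsHighestRoot.pairing_of_not_isPos {i : ι} (hi : ¬ b.IsPos i) :
    P.pairing i θ ≤ 0 ∧ -2 ≤ P.pairing i θ ∧
      (P.pairing i θ = -2 → i = P.reflectionPerm θ θ) := by
  have h := hθ.pairing_of_isPos ((RootPairing.Base.IsPos.neg_iff_not b i).mpr hi)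
  change 0 ≤ P.pairing (P.reflectionPerm i i) θ ∧ P.pairing (P.reflectionPerm i i) θ ≤ 2 ∧
    (P.pairing (P.reflectionPerm i i) θ = 2 → P.reflectionPerm i i = θ) at h
  rw [P.pairing_reflectionPerm_self_left] at h
  refine ⟨by omega, by omega, fun h' => ?_⟩
  have h3 := h.2.2 (by omega)
  refine P.root.injective ?_
  rw [RootPairing.root_reflectionPerm_self_eq, ← h3, RootPairing.root_reflectionPerm_self_eq,
    neg_neg]

end Highest

namespace AffineWeyl

variable {b : P.Base} {θ : ι} (hθ : IsHighestRoot b θ)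

lemma isPosRoot_simpleRoot (j : Option b.support) : IsPosRoot b (simpleRoot b θ j) := by
  rcases j with _ | i
  · exact ⟨_, rfl, Or.inl (by simp [simpleRoot])⟩
  · exact ⟨i, rfl, Or.inr ⟨by simp [simpleRoot], RootPairing.Base.isPos_of_mem_support i.2⟩⟩

include hθ in
/-- A simple reflection permutes the positive affine roots other than its own root. -/
lemma isPosRoot_act_simple [Finite ι] [P.IsReduced] {j : Option b.support} {v : T × ℤ}
    (hv : IsPosRoot b v) (hne : v ≠ simpleRoot b θ j) : IsPosRoot b (act (simple b θ j) v) := by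
  obtain ⟨k, hk, h⟩ := hv
  obtain ⟨m, n⟩ := v
  simp only at hk h
  subst hk
  rcases j with _ | i
  · have e : act (simple b θ none) (P.root k, n) =
        (P.root (P.reflectionPerm θ k), n + P.pairing k θ) := by
      rw [act_simple]
      refine Prod.ext ?_ ?_
      · simp [simpleRoot, rootIdx, P.reflection_apply]
        module
      · simp [simpleRoot, rootIdx]
    rw [e]
    refine ⟨_, rfl, ?_⟩
    simp only
    have hh := hθ.height_reflection k
    have hpos := hθ.height_pos
    by_cases hp : b.IsPos k
    · obtain ⟨h1, h2, h3⟩ := hθ.pairing_of_isPos hp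
      by_cases h0 : n + P.pairing k θ = 0
      · have : P.pairing k θ = 0 := by
          rcases h with h | h <;> omega
        right
        refine ⟨h0, ?_⟩
        rw [RootPairing.Base.isPos_iff, hh, this]
        have : 0 < b.height k := hp
        simpa using this
      · left
        rcases h with h | h <;> omega
    · obtain ⟨h1, h2, h3⟩ := hθ.pairing_of_not_isPos hp
      have hn : 0 < n := h.resolve_right fun h => hp h.2
      have hk : ¬ (n = 1 ∧ P.pairing k θ = -2) := by
        rintro ⟨rfl, h'⟩
        exact hne (by rw [h3 h']; simp [simpleRoot, rootIdx])
      by_cases h0 : n + P.pairing k θ = 0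
      · right
        refine ⟨h0, ?_⟩
        rw [RootPairing.Base.isPos_iff', hh]
        have hb := (hθ.height_le (P.reflectionPerm k k)).1
        have hb2 : b.height (P.reflectionPerm k k) = -b.height k :=
          b.height_reflectionPerm_self k
        have : P.pairing k θ ≤ -1 := by omega
        nlinarith
      · left
        by_contra hlt
        apply hk
        omega
  · have e : act (simple b θ (some i)) (P.root k, n) =
        (P.root (P.reflectionPerm i k), n) := by
      rw [act_simple]
      refine Prod.ext ?_ ?_
      · simp [simpleRoot, rootIdx, P.reflection_apply]
      · simp [simpleRoot]
    rw [e]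
    refine ⟨_, rfl, ?_⟩
    rcases h with h | ⟨rfl, h⟩
    · exact Or.inl h
    · refine Or.inr ⟨rfl, h.reflectionPerm i.2 ?_⟩
      rintro rfl
      exact hne (by simp [simpleRoot, rootIdx])

include hθ in
/-- If a word maps a simple root to a negative root, then multiplication by the simple reflection
amounts to the deletion of a letter. -/
lemma wordProd_mul_simple [Finite ι] [P.IsReduced] (K : List (Option b.support))
    (j : Option b.support) (h : ¬ IsPosRoot b (act (wordProd b θ K) (simpleRoot b θ j))) :
    ∃ A c B, K = A ++ c :: B ∧ wordProd b θ K * simple b θ j = wordProd b θ (A ++ B) := by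
  induction K with
  | nil =>
    exact absurd (by simpa [wordProd, act_one] using isPosRoot_simpleRoot j) h
  | cons i K ih =>
    by_cases hK : IsPosRoot b (act (wordProd b θ K) (simpleRoot b θ j))
    · refine ⟨[], i, K, rfl, ?_⟩
      have he : act (wordProd b θ K) (simpleRoot b θ j) = simpleRoot b θ i := by
        by_contra hne
        refine h ?_
        have := isPosRoot_act_simple hθ hK hne
        rwa [← act_mul] at this
      have := mul_simple_eq b θ he
      rw [List.nil_append, wordProd, List.map_cons, List.prod_cons, mul_assoc]
      change simple b θ i * (wordProd b θ K * simple b θ j) = _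
      rw [this, ← mul_assoc, simple_mul_self, one_mul]
    · obtain ⟨A, c, B, rfl, hp⟩ := ih hK
      refine ⟨i :: A, c, B, rfl, ?_⟩
      simp only [wordProd, List.cons_append, List.map_cons, List.prod_cons, mul_assoc] at hp ⊢
      rw [hp]

lemma wordProd_reverse (K : List (Option b.support)) :
    wordProd b θ K.reverse = (wordProd b θ K)⁻¹ := by
  induction K with
  | nil => simp [wordProd]
  | cons i K ih =>
    simp only [wordProd, List.reverse_cons, List.map_append, List.prod_append, List.map_cons,
      List.prod_cons, mul_inv_rev] at ih ⊢
    rw [ih]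
    rw [List.map_nil, List.prod_nil, mul_one]
    congr 1
    exact eq_inv_of_mul_eq_one_left (simple_mul_self b θ i)

include hθ in
lemma simple_mul_wordProd [Finite ι] [P.IsReduced] (K : List (Option b.support))
    (j : Option b.support) (h : ¬ IsPosRoot b (act (wordProd b θ K)⁻¹ (simpleRoot b θ j))) :
    ∃ A c B, K = A ++ c :: B ∧ simple b θ j * wordProd b θ K = wordProd b θ (A ++ B) := by
  rw [← wordProd_reverse] at h
  obtain ⟨A, c, B, hK, hp⟩ := wordProd_mul_simple hθ K.reverse j h
  refine ⟨B.reverse, c, A.reverse, ?_, ?_⟩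
  · rw [← K.reverse_reverse, hK]
    simp
  · rw [← List.reverse_append, wordProd_reverse, ← hp, wordProd_reverse, mul_inv_rev, inv_inv,
      inv_eq_of_mul_eq_one_left (simple_mul_self b θ j)]

lemma simpleRoot_injective : Function.Injective (simpleRoot b θ) := by
  intro i j h
  have h1 := congrArg Prod.fst h
  have h2 := congrArg Prod.snd h
  rcases i with _ | i <;> rcases j with _ | j
  · rfl
  · simp [simpleRoot] at h2
  · simp [simpleRoot] at h2
  · exact congrArg some (Subtype.ext (P.root.injective h1))

include hθ in
lemma simple_injective [Finite ι] [P.IsReduced] : Function.Injective (simple b θ) := by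
  intro i j hij
  by_contra hne
  have h := isPosRoot_act_simple hθ (isPosRoot_simpleRoot i)
    (simpleRoot_injective.ne hne : simpleRoot b θ i ≠ simpleRoot b θ j)
  rw [← hij, act_simpleRoot_self] at h
  exact not_isPosRoot_neg (isPosRoot_simpleRoot i) h

include hθ in
/-- Reduced words of elements of the finite Weyl group do not end with the affine reflection. -/
lemma ne_none_of_mem_finiteWeyl [Finite ι] [P.IsReduced] {K : List (Option b.support)}
    {j : Option b.support} {v : AffineWeyl P} (hv : v ∈ finiteWeyl P)
    (hK : IsReducedSeq b θ (K ++ [j]) v) : j ≠ none := by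
  rintro rfl
  have hw : wordProd b θ K * simple b θ none = v := by
    rw [← hK.1]
    simp [wordProd]
  by_cases h : IsPosRoot b (act (wordProd b θ K) (simpleRoot b θ none))
  · obtain ⟨g, rfl⟩ := hv
    refine not_isPosRoot_neg h ?_
    rw [← act_neg, ← act_simpleRoot_self, ← act_mul, hw]
    refine ⟨(g : P.Aut).indexEquiv (rootIdx b θ none), ?_, Or.inl ?_⟩
    · rw [← RootPairing.weylGroup_smul_root, act_inr]
      rfl
    · rw [act_inr]
      simp [simpleRoot]
  · obtain ⟨A, c, B, rfl, hp⟩ := wordProd_mul_simple hθ K none h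
    have := hK.2 _ (hp.symm.trans hw)
    simp at this

variable {I : AffineWeyl P → List (Option b.support)}
  (hI : ∀ w, IsReducedSeq b θ (I w) w)

include hθ hI in
/-- Reduced sequences in the affine Weyl group satisfy the exchange condition. -/
theorem exchangeWords [Finite ι] [P.IsReduced] : ExchangeWords (simple b θ) I where
  injective := simple_injective hθ
  mul_self := simple_mul_self b θ
  prod_eq w := (hI w).1
  le l := (hI _).2 l rfl
  exchange w j := by
    by_cases h : IsPosRoot b (act w⁻¹ (simpleRoot b θ j))
    · left
      have h1 : ¬ IsPosRoot b (act (wordProd b θ (I (simple b θ j * w)))⁻¹ (simpleRoot b θ j)) := by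
        rw [(hI _).1, mul_inv_rev, inv_eq_of_mul_eq_one_left (simple_mul_self b θ j), act_mul,
          act_simpleRoot_self, act_neg]
        exact not_isPosRoot_neg h
      obtain ⟨A, c, B, hK, hp⟩ := simple_mul_wordProd hθ _ j h1
      rw [(hI _).1, ← mul_assoc, simple_mul_self, one_mul] at hp
      have h2 := (hI w).2 _ hp.symm
      have h3 := (hI (simple b θ j * w)).2 (j :: I w) (by
        rw [wordProd, List.map_cons, List.prod_cons]
        congr 1
        exact (hI w).1)
      have h4 := congrArg List.length hK
      simp only [List.length_append, List.length_cons] at h2 h3 h4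
      omega
    · right
      intro K hK
      have hK' : wordProd b θ K = w := hK
      rw [← hK'] at h
      obtain ⟨A, c, B, hAB, hp⟩ := simple_mul_wordProd hθ K j h
      rw [hK'] at hp
      exact ⟨A, c, B, hAB, hp⟩

end AffineWeyl

end AffineRoots

section Twisted

variable {ι R T L σ : Type*} [CommRing R] [AddCommGroup T] [AddCommGroup L]
  {P : RootPairing ι ℤ T L} {F : FormalGroup R} [F.IsComm] {B : Module.Basis σ ℤ T}

lemma xInv_mul (i : ι) :
    algebraMap _ (RootLocalization P F B) (FormalGroupAlgebra.x F B (P.root i)) *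
      xInv P F B i = 1 := by
  rw [xInv, ← Localization.mk_one_eq_algebraMap, Localization.mk_mul, mul_one, one_mul]
  exact Localization.mk_self (⟨_, Submonoid.subset_closure ⟨i, rfl⟩⟩ : rootSubmonoid P F B)

lemma rootSubmonoid_le_nonZeroDivisors [IsDomain R] [CharZero R] :
    rootSubmonoid P F B ≤ nonZeroDivisors (FormalGroupAlgebra F B) := by
  refine Submonoid.closure_le.mpr ?_
  rintro _ ⟨i, rfl⟩
  exact mem_nonZeroDivisors_of_ne_zero (FormalGroupAlgebra.x_ne_zero F B (P.ne_zero i))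

instance [IsDomain R] [CharZero R] : IsDomain (RootLocalization P F B) :=
  IsLocalization.isDomain_of_le_nonZeroDivisors _ (M := rootSubmonoid P F B)
    rootSubmonoid_le_nonZeroDivisors

lemma RootLocalization.algebraMap_injective [IsDomain R] [CharZero R] :
    Function.Injective (algebraMap (FormalGroupAlgebra F B) (RootLocalization P F B)) :=
  IsLocalization.injective _ (M := rootSubmonoid P F B) rootSubmonoid_le_nonZeroDivisors

lemma xInv_ne_zero [IsDomain R] [CharZero R] (i : ι) : xInv P F B i ≠ 0 := by
  intro h
  have := xInv_mul (P := P) (F := F) (B := B) i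
  rw [h, mul_zero] at this
  exact zero_ne_one this

variable [Finite σ]

lemma AffineWeyl.smul_algebraMap (w : AffineWeyl P) (f : FormalGroupAlgebra F B) :
    w • algebraMap _ (RootLocalization P F B) f = algebraMap _ _ (FormalGroupAlgebra.map F B
      (RootPairing.Equiv.weightHom P (w.right : P.Aut)).toLinearMap f) :=
  localMap_algebraMap P F B _ f

lemma AffineWeyl.smul_algebraMap_x (w : AffineWeyl P) (μ : T) :
    w • algebraMap _ (RootLocalization P F B) (FormalGroupAlgebra.x F B μ) =
      algebraMap _ _ (FormalGroupAlgebra.x F B (w.right • μ)) := by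
  rw [AffineWeyl.smul_algebraMap, FormalGroupAlgebra.map_x]
  rfl

lemma AffineWeyl.smul_xInv (w : AffineWeyl P) (i : ι) :
    w • xInv P F B i = xInv P F B ((w.right : P.Aut).indexEquiv i) := by
  have h1 := congrArg (w • ·) (xInv_mul (P := P) (F := F) (B := B) i)
  simp only [smul_mul', smul_one, AffineWeyl.smul_algebraMap_x,
    RootPairing.weylGroup_smul_root] at h1
  have h2 := xInv_mul (P := P) (F := F) (B := B) ((w.right : P.Aut).indexEquiv i)
  exact (left_inv_eq_right_inv ((mul_comm _ _).trans h1) h2)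

namespace TwistedAffine

lemma η_mul (w w' : AffineWeyl P) : η P F B w * η P F B w' = η P F B (w * w') := by
  simp [η]

lemma η_one : η P F B (1 : AffineWeyl P) = 1 := rfl

lemma η_mul_smul (w : AffineWeyl P) (q : RootLocalization P F B) (a : TwistedAffine P F B) :
    η P F B w * (q • a) = (w • q) • (η P F B w * a) := by
  induction a using SkewMonoidAlgebra.induction_on with
  | zero => simp
  | single g c => simp [η, SkewMonoidAlgebra.smul_single, smul_mul']
  | add a a' h h' => rw [smul_add, mul_add, mul_add, smul_add, h, h']

lemma smul_η (w : AffineWeyl P) (q : RootLocalization P F B) :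
    q • η P F B w = SkewMonoidAlgebra.single w q := by
  simp [η, SkewMonoidAlgebra.smul_single]

instance : IsScalarTower (FormalGroupAlgebra F B) (TwistedAffine P F B) (TwistedAffine P F B) :=
  ⟨fun f a c => by
    rw [smul_eq_mul, smul_eq_mul, ← algebraMap_smul (RootLocalization P F B) f a,
      ← algebraMap_smul (RootLocalization P F B) f (a * c), smul_mul_assoc]⟩

lemma η_mul_algebra_smul (w : AffineWeyl P) (f : FormalGroupAlgebra F B)
    (a : TwistedAffine P F B) :
    η P F B w * (f • a) = FormalGroupAlgebra.map F B
      (RootPairing.Equiv.weightHom P (w.right : P.Aut)).toLinearMap f • (η P F B w * a) := by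
  rw [← algebraMap_smul (RootLocalization P F B) f a, η_mul_smul, AffineWeyl.smul_algebraMap,
    algebraMap_smul]

variable (b : P.Base) (θ : ι)

lemma X_eq (j : Option b.support) :
    X F B b θ j = xInv P F B (AffineWeyl.rootIdx b θ j) •
      (1 - η P F B (AffineWeyl.simple b θ j)) := by
  rcases j with _ | i <;> rfl

lemma η_simple (j : Option b.support) : η P F B (AffineWeyl.simple b θ j) =
    1 - FormalGroupAlgebra.x F B (P.root (AffineWeyl.rootIdx b θ j)) • X F B b θ j := by
  rw [X_eq, ← algebraMap_smul (RootLocalization P F B), smul_smul, xInv_mul, one_smul,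
    sub_sub_cancel]

/-- The action of a simple reflection on the formal group algebra. -/
def reflectionMap (F : FormalGroup R) [F.IsComm] (B : Module.Basis σ ℤ T) (j : Option b.support) :
    FormalGroupAlgebra F B →ₐ[R] FormalGroupAlgebra F B :=
  FormalGroupAlgebra.map F B (RootPairing.Equiv.weightHom P
    ((AffineWeyl.simple b θ j).right : P.Aut)).toLinearMap

lemma simple_right_smul (j : Option b.support) (μ : T) :
    (AffineWeyl.simple b θ j).right • μ = μ -
      P.toLinearMap μ (P.coroot (AffineWeyl.rootIdx b θ j)) •
        P.root (AffineWeyl.rootIdx b θ j) :=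
  congrArg Prod.fst (AffineWeyl.act_simple b θ j (μ, 0))

lemma x_dvd_sub_reflectionMap (j : Option b.support) (f : FormalGroupAlgebra F B) :
    FormalGroupAlgebra.x F B (P.root (AffineWeyl.rootIdx b θ j)) ∣
      f - reflectionMap b θ F B j f :=
  FormalGroupAlgebra.x_dvd_sub_map F B _ (P.toLinearMap.flip (P.coroot _)) _
    (simple_right_smul b θ j) f

/-- The formal Demazure operator `f ↦ (f - s_j f) / x_{α_j}`. -/
def demazureOp (F : FormalGroup R) [F.IsComm] (B : Module.Basis σ ℤ T) (j : Option b.support)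
    (f : FormalGroupAlgebra F B) : FormalGroupAlgebra F B :=
  (x_dvd_sub_reflectionMap b θ j f).choose

lemma x_mul_demazureOp (j : Option b.support) (f : FormalGroupAlgebra F B) :
    FormalGroupAlgebra.x F B (P.root (AffineWeyl.rootIdx b θ j)) * demazureOp b θ F B j f =
      f - reflectionMap b θ F B j f :=
  (x_dvd_sub_reflectionMap b θ j f).choose_spec.symm

lemma algebraMap_demazureOp (j : Option b.support) (f : FormalGroupAlgebra F B) :
    algebraMap _ (RootLocalization P F B) (demazureOp b θ F B j f) =
      xInv P F B (AffineWeyl.rootIdx b θ j) * (algebraMap _ _ f -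
        algebraMap _ _ (reflectionMap b θ F B j f)) := by
  rw [← map_sub, ← x_mul_demazureOp, map_mul, ← mul_assoc, mul_comm (xInv P F B _), xInv_mul,
    one_mul]

/-- The twisted Leibniz rule. -/
lemma X_mul_smul (j : Option b.support) (f : FormalGroupAlgebra F B) (a : TwistedAffine P F B) :
    X F B b θ j * (f • a) =
      reflectionMap b θ F B j f • (X F B b θ j * a) + demazureOp b θ F B j f • a := by
  rw [X_eq, smul_mul_assoc, smul_mul_assoc, sub_mul, sub_mul, one_mul, one_mul,
    η_mul_algebra_smul]
  change _ • (_ - reflectionMap b θ F B j f • _) = _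
  rw [← algebraMap_smul (RootLocalization P F B) f,
    ← algebraMap_smul (RootLocalization P F B) (reflectionMap b θ F B j f),
    ← algebraMap_smul (RootLocalization P F B) (reflectionMap b θ F B j f),
    ← algebraMap_smul (RootLocalization P F B) (demazureOp b θ F B j f),
    algebraMap_demazureOp, mul_sub, sub_smul, smul_sub, smul_sub, smul_sub, smul_smul, smul_smul,
    smul_smul, smul_smul, mul_comm (algebraMap _ _ (reflectionMap b θ F B j f))]
  abel

lemma exists_X_mul_X (j : Option b.support) : ∃ c : FormalGroupAlgebra F B,
    X F B b θ j * X F B b θ j = c • X F B b θ j := by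
  obtain ⟨c, hc⟩ := FormalGroupAlgebra.x_mul_x_neg_dvd F B
    (P.root (AffineWeyl.rootIdx b θ j))
  refine ⟨c, ?_⟩
  have h1 : xInv P F B (AffineWeyl.rootIdx b θ j) +
      AffineWeyl.simple b θ j • xInv P F B (AffineWeyl.rootIdx b θ j) = algebraMap _ _ c := by
    have e := congrArg (algebraMap _ (RootLocalization P F B)) hc
    rw [map_mul, map_mul, map_add] at e
    have e1 := xInv_mul (P := P) (F := F) (B := B) (AffineWeyl.rootIdx b θ j)
    have e2 := congrArg (AffineWeyl.simple b θ j • ·) e1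
    simp only [smul_mul', smul_one, AffineWeyl.smul_algebraMap_x, simple_right_smul] at e2
    have e3 : P.root (AffineWeyl.rootIdx b θ j) - P.toLinearMap
        (P.root (AffineWeyl.rootIdx b θ j)) (P.coroot (AffineWeyl.rootIdx b θ j)) •
        P.root (AffineWeyl.rootIdx b θ j) = -P.root (AffineWeyl.rootIdx b θ j) := by
      rw [P.root_coroot_two]
      module
    rw [e3] at e2
    generalize algebraMap _ (RootLocalization P F B) (FormalGroupAlgebra.x F B
      (P.root (AffineWeyl.rootIdx b θ j))) = p at *
    generalize algebraMap _ (RootLocalization P F B) (FormalGroupAlgebra.x F B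
      (-P.root (AffineWeyl.rootIdx b θ j))) = q at *
    generalize xInv P F B (AffineWeyl.rootIdx b θ j) = p' at *
    generalize AffineWeyl.simple b θ j • p' = q' at *
    generalize algebraMap _ (RootLocalization P F B) c = r at *
    linear_combination (p' * q') * e - q' * e1 - p' * e2 + (r * q * q') * e1 + r * e2
  rw [X_eq, smul_mul_assoc, sub_mul, one_mul, η_mul_smul, mul_sub, mul_one, η_mul,
    AffineWeyl.simple_mul_self, η_one, ← algebraMap_smul (RootLocalization P F B) c, ← h1]
  simp only [smul_sub, smul_smul, add_mul, add_smul,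
    mul_comm (AffineWeyl.simple b θ j • xInv P F B (AffineWeyl.rootIdx b θ j))]
  abel

/-- The sum of the coefficients. -/
def coeffSum : TwistedAffine P F B →ₗ[RootLocalization P F B] RootLocalization P F B :=
  (Finsupp.linearCombination (RootLocalization P F B) fun _ : AffineWeyl P => 1) ∘ₗ
    SkewMonoidAlgebra.coeffLinearEquiv.toLinearMap

lemma coeffSum_single (w : AffineWeyl P) (q : RootLocalization P F B) :
    coeffSum (SkewMonoidAlgebra.single w q : TwistedAffine P F B) = q := by
  simp [coeffSum, SkewMonoidAlgebra.coeffLinearEquiv, SkewMonoidAlgebra.coeffAddEquiv]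

lemma coeffSum_mul_X (a : TwistedAffine P F B) (j : Option b.support) :
    coeffSum (a * X F B b θ j) = 0 := by
  induction a using SkewMonoidAlgebra.induction_on with
  | zero => simp
  | single g c =>
    rw [← smul_η, X_eq, smul_mul_assoc, η_mul_smul, mul_sub, mul_one, η_mul, map_smul, map_smul,
      map_sub]
    simp [η, coeffSum_single]
  | add a a' h h' => rw [add_mul, map_add, h, h', add_zero]

/-- The composite Demazure operator attached to a word. -/
def demazureOps (F : FormalGroup R) [F.IsComm] (B : Module.Basis σ ℤ T)
    (K : List (Option b.support)) (f : FormalGroupAlgebra F B) : FormalGroupAlgebra F B :=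
  K.foldr (demazureOp b θ F B) f

lemma demazureOps_append (K K' : List (Option b.support)) (f : FormalGroupAlgebra F B) :
    demazureOps b θ F B (K ++ K') f = demazureOps b θ F B K (demazureOps b θ F B K' f) := by
  simp [demazureOps]

lemma XSeq_append (K K' : List (Option b.support)) :
    XSeq F B b θ (K ++ K') = XSeq F B b θ K * XSeq F B b θ K' := by
  simp [XSeq]

lemma XSeq_cons (j : Option b.support) (K : List (Option b.support)) :
    XSeq F B b θ (j :: K) = X F B b θ j * XSeq F B b θ K := by
  simp [XSeq]

lemma coeffSum_XSeq_mul (K : List (Option b.support)) (f : FormalGroupAlgebra F B) :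
    coeffSum (XSeq F B b θ K * (f • 1)) =
      algebraMap _ (RootLocalization P F B) (demazureOps b θ F B K f) := by
  induction K using List.reverseRecOn generalizing f with
  | nil =>
    rw [← algebraMap_smul (RootLocalization P F B) f, ← η_one, smul_η]
    simp [XSeq, coeffSum_single, demazureOps]
  | append_singleton K j ih =>
    rw [XSeq_append, mul_assoc, demazureOps_append]
    have e : XSeq F B b θ [j] = X F B b θ j := by simp [XSeq]
    rw [e, X_mul_smul, mul_add, map_add, ih, mul_one]
    have : reflectionMap b θ F B j f • X F B b θ j =
        (reflectionMap b θ F B j f • (1 : TwistedAffine P F B)) * X F B b θ j := by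
      rw [smul_mul_assoc, one_mul]
    rw [this, ← mul_assoc, coeffSum_mul_X, zero_add]
    rfl

end TwistedAffine

end Twisted

section Triangular

variable {ι R T L σ : Type*} [CommRing R] [AddCommGroup T] [AddCommGroup L]
  {P : RootPairing ι ℤ T L} {F : FormalGroup R} [F.IsComm] {B : Module.Basis σ ℤ T} [Finite σ]
  (b : P.Base) (θ : ι)

namespace TwistedAffine

/-- A subring of `𝒬` containing `S`, stable under the Weyl group, and in which the roots attached to
the letters in `C` are invertible. -/
structure IsCoeffRing (C : Set (Option b.support)) (O : Subring (RootLocalization P F B)) :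
    Prop where
  algebraMap_mem : ∀ f : FormalGroupAlgebra F B, algebraMap _ _ f ∈ O
  smul_mem : ∀ (w : AffineWeyl P), ∀ q ∈ O, w • q ∈ O
  xInv_mem : ∀ j ∈ C, xInv P F B (AffineWeyl.rootIdx b θ j) ∈ O

/-- The span over `O` of the `η_w`, for `w` a product of less than `n` letters in `C`. -/
def ηSpan (C : Set (Option b.support)) (O : Subring (RootLocalization P F B)) (n : ℕ) :
    Submodule O (TwistedAffine P F B) :=
  Submodule.span O ((fun K => η P F B (AffineWeyl.wordProd b θ K)) ''
    {K | (∀ j ∈ K, j ∈ C) ∧ K.length < n})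

/-- The span over `O` of the `X_K`, for `K` a word of less than `n` letters in `C`. -/
def XSpan (C : Set (Option b.support)) (O : Subring (RootLocalization P F B)) (n : ℕ) :
    Submodule O (TwistedAffine P F B) :=
  Submodule.span O (XSeq F B b θ '' {K | (∀ j ∈ K, j ∈ C) ∧ K.length < n})

/-- The leading coefficient of `X_K`. -/
def topCoeff (P : RootPairing ι ℤ T L) (F : FormalGroup R) [F.IsComm] (B : Module.Basis σ ℤ T)
    (b : P.Base) (θ : ι) (K : List (Option b.support)) : RootLocalization P F B :=
  K.foldr (fun j q => -(xInv P F B (AffineWeyl.rootIdx b θ j) * AffineWeyl.simple b θ j • q)) 1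

lemma topCoeff_cons (j : Option b.support) (K : List (Option b.support)) :
    topCoeff P F B b θ (j :: K) = -(xInv P F B (AffineWeyl.rootIdx b θ j) *
      AffineWeyl.simple b θ j • topCoeff P F B b θ K) := rfl

lemma wordProd_cons (j : Option b.support) (K : List (Option b.support)) :
    AffineWeyl.wordProd b θ (j :: K) = AffineWeyl.simple b θ j * AffineWeyl.wordProd b θ K := by
  simp [AffineWeyl.wordProd]

lemma topCoeff_ne_zero [IsDomain R] [CharZero R] (K : List (Option b.support)) :
    topCoeff P F B b θ K ≠ 0 := by
  induction K with
  | nil => exact one_ne_zero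
  | cons j K ih =>
    rw [topCoeff_cons, neg_ne_zero]
    exact mul_ne_zero (xInv_ne_zero _) (by rwa [Ne, smul_eq_zero_iff_eq])

variable {b θ} {C : Set (Option b.support)} {O : Subring (RootLocalization P F B)}

lemma XSpan_mono {m n : ℕ} (h : m ≤ n) : XSpan b θ C O m ≤ XSpan b θ C O n :=
  Submodule.span_mono (Set.image_mono fun _ hK => ⟨hK.1, hK.2.trans_le h⟩)

lemma X_mul_smul_η (j : Option b.support) (w : AffineWeyl P) (q : RootLocalization P F B) :
    X F B b θ j * (q • η P F B w) = (xInv P F B (AffineWeyl.rootIdx b θ j) * q) • η P F B w -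
      (xInv P F B (AffineWeyl.rootIdx b θ j) * AffineWeyl.simple b θ j • q) •
        η P F B (AffineWeyl.simple b θ j * w) := by
  rw [X_eq, smul_mul_assoc, sub_mul, one_mul, η_mul_smul, η_mul, smul_sub, smul_smul, smul_smul]

namespace IsCoeffRing

variable (hO : IsCoeffRing b θ C O)
include hO

lemma topCoeff_mem {K : List (Option b.support)} (hK : ∀ j ∈ K, j ∈ C) :
    topCoeff P F B b θ K ∈ O := by
  induction K with
  | nil => exact O.one_mem
  | cons j K ih =>
    rw [List.forall_mem_cons] at hK
    exact O.neg_mem (O.mul_mem (hO.xInv_mem j hK.1) (hO.smul_mem _ _ (ih hK.2)))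

lemma X_mul_mem_ηSpan {j : Option b.support} (hj : j ∈ C) {n : ℕ} {a : TwistedAffine P F B}
    (ha : a ∈ ηSpan b θ C O n) : X F B b θ j * a ∈ ηSpan b θ C O (n + 1) := by
  refine Submodule.span_induction (p := fun a _ => ∀ q ∈ O, X F B b θ j * (q • a) ∈
    ηSpan b θ C O (n + 1)) ?_ ?_ ?_ ?_ ha 1 O.one_mem |> fun h => by rwa [one_smul] at h
  · rintro _ ⟨K, ⟨hK, hn⟩, rfl⟩ q hq
    dsimp only
    rw [X_mul_smul_η]
    refine Submodule.sub_mem _ ?_ ?_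
    · exact Submodule.smul_mem _ (⟨_, O.mul_mem (hO.xInv_mem j hj) hq⟩ : O)
        (Submodule.subset_span ⟨K, ⟨hK, by omega⟩, rfl⟩)
    · refine Submodule.smul_mem _ (⟨_, O.mul_mem (hO.xInv_mem j hj) (hO.smul_mem _ _ hq)⟩ : O)
        (Submodule.subset_span ⟨j :: K, ⟨?_, ?_⟩, ?_⟩)
      · exact List.forall_mem_cons.2 ⟨hj, hK⟩
      · rw [List.length_cons]; omega
      · exact congrArg (η P F B) (wordProd_cons b θ j K)
  · intro q _
    rw [smul_zero, mul_zero]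
    exact Submodule.zero_mem _
  · intro a a' _ _ h h' q hq
    rw [smul_add, mul_add]
    exact Submodule.add_mem _ (h q hq) (h' q hq)
  · intro c a _ h q hq
    have : q • c • a = (q * (c : RootLocalization P F B)) • a := by rw [mul_smul]; rfl
    rw [this]
    exact h _ (O.mul_mem hq c.2)

lemma XSeq_sub_mem {K : List (Option b.support)} (hK : ∀ j ∈ K, j ∈ C) :
    XSeq F B b θ K - topCoeff P F B b θ K • η P F B (AffineWeyl.wordProd b θ K) ∈
      ηSpan b θ C O K.length := by
  induction K with
  | nil =>
    have : XSeq F B b θ [] - topCoeff P F B b θ [] • η P F B (AffineWeyl.wordProd b θ []) = 0 := by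
      simp [XSeq, topCoeff, AffineWeyl.wordProd, η_one]
    rw [this]
    exact Submodule.zero_mem _
  | cons j K ih =>
    rw [List.forall_mem_cons] at hK
    have h1 := hO.X_mul_mem_ηSpan hK.1 (ih hK.2)
    rw [mul_sub, X_mul_smul_η, ← XSeq_cons, ← wordProd_cons] at h1
    have h2 : (xInv P F B (AffineWeyl.rootIdx b θ j) * topCoeff P F B b θ K) •
        η P F B (AffineWeyl.wordProd b θ K) ∈ ηSpan b θ C O (K.length + 1) :=
      Submodule.smul_mem _ (⟨_, O.mul_mem (hO.xInv_mem j hK.1) (hO.topCoeff_mem hK.2)⟩ : O)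
        (Submodule.subset_span ⟨K, ⟨hK.2, by omega⟩, rfl⟩)
    rw [List.length_cons, topCoeff_cons, neg_smul, sub_neg_eq_add]
    convert Submodule.add_mem _ h1 h2 using 1
    abel

lemma η_simple_mul_mem_XSpan {j : Option b.support} (hj : j ∈ C) {n : ℕ}
    {a : TwistedAffine P F B} (ha : a ∈ XSpan b θ C O n) :
    η P F B (AffineWeyl.simple b θ j) * a ∈ XSpan b θ C O (n + 1) := by
  refine Submodule.span_induction (p := fun a _ => η P F B (AffineWeyl.simple b θ j) * a ∈
    XSpan b θ C O (n + 1)) ?_ ?_ ?_ ?_ ha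
  · rintro _ ⟨K, ⟨hK, hn⟩, rfl⟩
    rw [η_simple, sub_mul, one_mul, smul_mul_assoc, ← XSeq_cons,
      ← algebraMap_smul (RootLocalization P F B)]
    refine Submodule.sub_mem _ (Submodule.subset_span ⟨K, ⟨hK, by omega⟩, rfl⟩)
      (Submodule.smul_mem _ (⟨_, hO.algebraMap_mem _⟩ : O) (Submodule.subset_span ⟨j :: K, ⟨?_, ?_⟩,
        rfl⟩))
    · exact List.forall_mem_cons.2 ⟨hj, hK⟩
    · rw [List.length_cons]; omega
  · rw [mul_zero]
    exact Submodule.zero_mem _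
  · intro a a' _ _ h h'
    rw [mul_add]
    exact Submodule.add_mem _ h h'
  · intro c a _ h
    have : c • a = (c : RootLocalization P F B) • a := rfl
    rw [this, η_mul_smul]
    exact Submodule.smul_mem _ (⟨_, hO.smul_mem _ _ c.2⟩ : O) h

lemma η_wordProd_mem_XSpan {K : List (Option b.support)} (hK : ∀ j ∈ K, j ∈ C) :
    η P F B (AffineWeyl.wordProd b θ K) ∈ XSpan b θ C O (K.length + 1) := by
  induction K with
  | nil => exact Submodule.subset_span ⟨[], ⟨hK, by simp⟩, by simp [XSeq, AffineWeyl.wordProd, η_one]⟩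
  | cons j K ih =>
    rw [List.forall_mem_cons] at hK
    rw [wordProd_cons, ← η_mul]
    exact hO.η_simple_mul_mem_XSpan hK.1 (ih hK.2)

lemma ηSpan_le_XSpan (n : ℕ) : ηSpan b θ C O n ≤ XSpan b θ C O n := by
  refine Submodule.span_le.2 ?_
  rintro _ ⟨K, ⟨hK, hn⟩, rfl⟩
  exact XSpan_mono hn (hO.η_wordProd_mem_XSpan hK)

end IsCoeffRing

lemma X_mul_mem_span_altWord {i j c : Option b.support} (hc : c ∈ ({i, j} : Set _)) {n : ℕ}
    {a : TwistedAffine P F B}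
    (ha : a ∈ Submodule.span (FormalGroupAlgebra F B) (XSeq F B b θ ''
      {K | ∃ k < n, K = altWord i j k ∨ K = altWord j i k})) :
    X F B b θ c * a ∈ Submodule.span (FormalGroupAlgebra F B) (XSeq F B b θ ''
      {K | ∃ k < n + 1, K = altWord i j k ∨ K = altWord j i k}) := by
  have hmono : Submodule.span (FormalGroupAlgebra F B) (XSeq F B b θ ''
      {K | ∃ k < n, K = altWord i j k ∨ K = altWord j i k}) ≤ Submodule.span
        (FormalGroupAlgebra F B) (XSeq F B b θ ''
      {K | ∃ k < n + 1, K = altWord i j k ∨ K = altWord j i k}) :=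
    Submodule.span_mono (Set.image_mono fun K ⟨k, hk, h⟩ => ⟨k, by omega, h⟩)
  induction ha using Submodule.span_induction with
  | mem a ha =>
    obtain ⟨K, ⟨k, hk, hK⟩, rfl⟩ := ha
    have key : ∀ i j : Option b.support, ∀ k < n, ∃ r : FormalGroupAlgebra F B,
        X F B b θ i * XSeq F B b θ (altWord i j k) = r • XSeq F B b θ (altWord i j k) ∨
        X F B b θ i * XSeq F B b θ (altWord i j k) = XSeq F B b θ (altWord i j (k + 1)) := by
      intro i j k _
      rcases k with _ | k
      · exact ⟨0, Or.inr (by simp [altWord, XSeq])⟩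
      · obtain ⟨r, hr⟩ := exists_X_mul_X (F := F) (B := B) b θ i
        refine ⟨r, Or.inl ?_⟩
        rw [altWord, XSeq_cons, ← mul_assoc, hr, smul_mul_assoc]
    rcases hc with rfl | rfl <;> rcases hK with rfl | rfl
    · obtain ⟨r, h | h⟩ := key c j k hk
      · rw [h]
        exact Submodule.smul_mem _ _ (Submodule.subset_span ⟨_, ⟨k, by omega, Or.inl rfl⟩, rfl⟩)
      · rw [h]
        exact Submodule.subset_span ⟨_, ⟨k + 1, by omega, Or.inl rfl⟩, rfl⟩
    · rw [← XSeq_cons]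
      exact Submodule.subset_span ⟨_, ⟨k + 1, by omega, Or.inl rfl⟩, rfl⟩
    · rw [← XSeq_cons]
      exact Submodule.subset_span ⟨_, ⟨k + 1, by omega, Or.inr rfl⟩, rfl⟩
    · obtain ⟨r, h | h⟩ := key c i k hk
      · rw [h]
        exact Submodule.smul_mem _ _ (Submodule.subset_span ⟨_, ⟨k, by omega, Or.inr rfl⟩, rfl⟩)
      · rw [h]
        exact Submodule.subset_span ⟨_, ⟨k + 1, by omega, Or.inr rfl⟩, rfl⟩
  | zero =>
    rw [mul_zero]
    exact Submodule.zero_mem _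
  | add a a' _ _ h h' =>
    rw [mul_add]
    exact Submodule.add_mem _ h h'
  | smul f a ha h =>
    rw [X_mul_smul]
    exact Submodule.add_mem _ (Submodule.smul_mem _ _ h) (Submodule.smul_mem _ _ (hmono ha))

lemma XSeq_mem_span_altWord {i j : Option b.support} {K : List (Option b.support)}
    (hK : ∀ c ∈ K, c ∈ ({i, j} : Set _)) :
    XSeq F B b θ K ∈ Submodule.span (FormalGroupAlgebra F B) (XSeq F B b θ ''
      {K' | ∃ k < K.length + 1, K' = altWord i j k ∨ K' = altWord j i k}) := by
  induction K with
  | nil => exact Submodule.subset_span ⟨[], ⟨0, by simp, Or.inl rfl⟩, rfl⟩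
  | cons c K ih =>
    rw [List.forall_mem_cons] at hK
    rw [XSeq_cons]
    exact X_mul_mem_span_altWord hK.1 (ih hK.2)

/-- The alternating words in `i` and `j`, enumerated by increasing length. -/
def altEnum {J : Type*} (i j : J) (p : ℕ) : List J :=
  if p % 2 = 1 then altWord i j ((p + 1) / 2) else altWord j i ((p + 1) / 2)

lemma IsCoeffRing.XSpan_le_span_altEnum {i j : Option b.support}
    (hO : IsCoeffRing b θ {i, j} O) {m : ℕ} (hm : 0 < m) :
    XSpan b θ {i, j} O m ≤ Submodule.span O
      (Set.range fun p : Fin (2 * m - 1) => XSeq F B b θ (altEnum i j p)) := by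
  refine Submodule.span_le.2 ?_
  rintro _ ⟨K, ⟨hK, hn⟩, rfl⟩
  refine Submodule.span_induction (p := fun a _ => a ∈ Submodule.span O
      (Set.range fun p : Fin (2 * m - 1) => XSeq F B b θ (altEnum i j p))) ?_ ?_ ?_ ?_
      (XSeq_mem_span_altWord (F := F) (B := B) hK)
  · rintro _ ⟨K', ⟨k, hk, hK'⟩, rfl⟩
    refine Submodule.subset_span ?_
    rcases k with _ | k
    · refine ⟨⟨0, by omega⟩, ?_⟩
      have : K' = [] := by rcases hK' with rfl | rfl <;> rfl
      simp [altEnum, altWord, this]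
    · rcases hK' with rfl | rfl
      · refine ⟨⟨2 * k + 1, by omega⟩, ?_⟩
        have h1 : (2 * k + 1) % 2 = 1 := by omega
        have h2 : (2 * k + 1 + 1) / 2 = k + 1 := by omega
        simp only [altEnum, h1, h2, if_true]
      · refine ⟨⟨2 * k + 2, by omega⟩, ?_⟩
        have h1 : ¬ (2 * k + 2) % 2 = 1 := by omega
        have h2 : (2 * k + 2 + 1) / 2 = k + 1 := by omega
        simp only [altEnum, h1, h2, if_false]
  · exact Submodule.zero_mem _
  · intro a a' _ _ h h'
    exact Submodule.add_mem _ h h'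
  · intro f a _ h
    rw [← algebraMap_smul (RootLocalization P F B)]
    exact Submodule.smul_mem _ (⟨_, hO.algebraMap_mem f⟩ : O) h

/-- If the leading coefficients of the two alternating words of length `m` agree, then their
difference is an `O`-combination of shorter alternating words. -/
lemma IsCoeffRing.exists_sub_eq_sum {i j : Option b.support}
    (hO : IsCoeffRing b θ {i, j} O) {m : ℕ} (hm : 0 < m)
    (hprod : AffineWeyl.wordProd b θ (altWord i j m) = AffineWeyl.wordProd b θ (altWord j i m))
    (htop : topCoeff P F B b θ (altWord i j m) = topCoeff P F B b θ (altWord j i m)) :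
    ∃ q : Fin (2 * m - 1) → O, XSeq F B b θ (altWord i j m) - XSeq F B b θ (altWord j i m) =
      ∑ p, q p • XSeq F B b θ (altEnum i j p) := by
  have hmem : ∀ (k : ℕ) (i' j' : Option b.support), i' ∈ ({i, j} : Set _) → j' ∈ ({i, j} : Set _) →
      ∀ c ∈ altWord i' j' k, c ∈ ({i, j} : Set _) := by
    intro k
    induction k with
    | zero => intro _ _ _ _ c hc; simp [altWord] at hc
    | succ k ih =>
      intro i' j' hi hj c hc
      rw [altWord, List.mem_cons] at hc
      rcases hc with rfl | hc
      · exact hi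
      · exact ih j' i' hj hi c hc
  have h1 := hO.XSeq_sub_mem (hmem m i j (by simp) (by simp))
  have h2 := hO.XSeq_sub_mem (hmem m j i (by simp) (by simp))
  rw [length_altWord] at h1 h2
  have h3 := hO.XSpan_le_span_altEnum hm (hO.ηSpan_le_XSpan m (Submodule.sub_mem _ h1 h2))
  rw [hprod, htop, sub_sub_sub_cancel_right] at h3
  obtain ⟨q, hq⟩ := (Submodule.mem_span_range_iff_exists_fun O).1 h3
  exact ⟨q, hq.symm⟩

end TwistedAffine

end Triangular

section LeadingForm

variable {J J' V V' : Type*}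

/-- The terms `p(μ) · M'` obtained by applying an operator `Δ` with `Δ(x_μ) = p(μ)` and
`Δ(fg) = Δ(f)g + s(f)Δ(g)` to the product of the `x_μ`, `μ ∈ M`. -/
def leibnizTerms (s : V → V) (p : V → ℤ) : List V → List (ℤ × List V)
  | [] => []
  | μ :: M => (p μ, M) :: (leibnizTerms s p M).map fun c => (c.1, s μ :: c.2)

/-- The result of applying such operators successively. -/
def iterLeibniz (s : J → V → V) (p : J → V → ℤ) : List J → List V → ℤ
  | [], _ => 1
  | j :: K, M => ((leibnizTerms (s j) (p j) M).map fun c => c.1 * iterLeibniz s p K c.2).sum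

lemma leibnizTerms_map {s : V → V} {p : V → ℤ} {s' : V' → V'} {p' : V' → ℤ} (f : V → V')
    (hs : ∀ v, s' (f v) = f (s v)) (hp : ∀ v, p' (f v) = p v) (M : List V) :
    leibnizTerms s' p' (M.map f) = (leibnizTerms s p M).map fun c => (c.1, c.2.map f) := by
  induction M with
  | nil => rfl
  | cons μ M ih =>
    rw [List.map_cons, leibnizTerms, leibnizTerms, ih, List.map_cons, List.map_map, List.map_map, hp]
    congr 2
    funext c
    simp [hs]

lemma iterLeibniz_map {s : J → V → V} {p : J → V → ℤ} {s' : J' → V' → V'} {p' : J' → V' → ℤ}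
    (g : J' → J) (f : V → V') (hs : ∀ j v, s' j (f v) = f (s (g j) v))
    (hp : ∀ j v, p' j (f v) = p (g j) v) (K : List J') (M : List V) :
    iterLeibniz s p (K.map g) M = iterLeibniz s' p' K (M.map f) := by
  induction K generalizing M with
  | nil => rfl
  | cons j K ih =>
    rw [List.map_cons, iterLeibniz, iterLeibniz, leibnizTerms_map f (hs j) (hp j), List.map_map]
    congr 2
    funext c
    simp [ih]

lemma length_of_mem_leibnizTerms {s : V → V} {p : V → ℤ} {M : List V} {c : ℤ × List V}
    (hc : c ∈ leibnizTerms s p M) : c.2.length + 1 = M.length := by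
  induction M generalizing c with
  | nil => simp [leibnizTerms] at hc
  | cons μ M ih =>
    rw [leibnizTerms, List.mem_cons, List.mem_map] at hc
    rcases hc with rfl | ⟨c', hc', rfl⟩
    · rfl
    · simp [ih hc']

lemma altWord_map {J J' : Type*} (g : J → J') (i j : J) (k : ℕ) :
    (altWord i j k).map g = altWord (g i) (g j) k := by
  induction k generalizing i j with
  | zero => rfl
  | succ k ih => simp [altWord, ih]

lemma take_altWord {J : Type*} (i j : J) {l m : ℕ} (h : l ≤ m) :
    (altWord i j m).take l = altWord i j l := by
  induction l generalizing i j m with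
  | zero => rfl
  | succ l ih =>
    obtain ⟨m, rfl⟩ : ∃ m', m = m' + 1 := ⟨m - 1, by omega⟩
    rw [altWord, List.take_succ_cons, ih j i (by omega)]
    rfl

lemma exists_altWord_append_drop {J : Type*} (i j : J) {l m : ℕ} (h0 : 0 < l) (h : l < m) :
    ∃ A c B, altWord i j l ++ (altWord j i m).drop l = A ++ c :: c :: B := by
  induction l generalizing i j m with
  | zero => omega
  | succ l ih =>
    obtain ⟨m, rfl⟩ : ∃ m', m = m' + 1 := ⟨m - 1, by omega⟩
    rcases l with _ | l
    · obtain ⟨m, rfl⟩ : ∃ m', m = m' + 1 := ⟨m - 1, by omega⟩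
      exact ⟨[], i, altWord j i m, by simp [altWord]⟩
    · obtain ⟨A, c, B, h⟩ := ih j i (m := m) (by omega) (by omega)
      exact ⟨i :: A, c, B, by
        rw [altWord, show altWord j i (m + 1) = j :: altWord i j m from rfl, List.drop_succ_cons,
          List.cons_append, h, List.cons_append]⟩

end LeadingForm

section Rank2

variable {ι R T L σ : Type*} [CommRing R] [AddCommGroup T] [AddCommGroup L]
  {P : RootPairing ι ℤ T L} {F : FormalGroup R} [F.IsComm] {B : Module.Basis σ ℤ T} [Finite σ]
  {b : P.Base} {θ : ι} [IsDomain R] [CharZero R]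

open FormalGroupAlgebra

/-- Modulo terms of order two, `μ ↦ x_μ` is additive. -/
def FormalGroupAlgebra.xModSq (F : FormalGroup R) [F.IsComm] (B : Module.Basis σ ℤ T) :
    T →+ FormalGroupAlgebra F B ⧸ orderIdeal F B 2 :=
  AddMonoidHom.mk' (fun μ => Ideal.Quotient.mk _ (x F B μ)) fun μ ν => by
    rw [← map_add, Ideal.Quotient.eq]
    exact x_add_sub_mem F B μ ν

namespace TwistedAffine

lemma x_root_ne_zero (k : ι) : x F B (P.root k) ≠ 0 := x_ne_zero F B (P.ne_zero k)

lemma demazureOp_add (j : Option b.support) (f g : FormalGroupAlgebra F B) :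
    demazureOp b θ F B j (f + g) = demazureOp b θ F B j f + demazureOp b θ F B j g := by
  refine mul_left_cancel₀ (x_root_ne_zero (P := P) (AffineWeyl.rootIdx b θ j)) ?_
  rw [mul_add, x_mul_demazureOp, x_mul_demazureOp, x_mul_demazureOp, map_add]
  ring

lemma demazureOp_mul (j : Option b.support) (f g : FormalGroupAlgebra F B) :
    demazureOp b θ F B j (f * g) =
      demazureOp b θ F B j f * g + reflectionMap b θ F B j f * demazureOp b θ F B j g := by
  refine mul_left_cancel₀ (x_root_ne_zero (P := P) (AffineWeyl.rootIdx b θ j)) ?_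
  rw [mul_add, ← mul_assoc, mul_left_comm, x_mul_demazureOp, x_mul_demazureOp, x_mul_demazureOp,
    map_mul]
  ring

lemma demazureOp_mem_orderIdeal (j : Option b.support) {k : ℕ} {f : FormalGroupAlgebra F B}
    (hf : f ∈ orderIdeal F B (k + 1)) : demazureOp b θ F B j f ∈ orderIdeal F B k := by
  refine mem_orderIdeal_of_x_mul F B (P.ne_zero (AffineWeyl.rootIdx b θ j)) ?_
  rw [x_mul_demazureOp]
  exact Ideal.sub_mem _ hf (map_mem_orderIdeal F B _ hf)

/-- The composite Demazure operator as an additive map. -/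
def demazureOpsHom (b : P.Base) (θ : ι) (F : FormalGroup R) [F.IsComm] (B : Module.Basis σ ℤ T)
    (K : List (Option b.support)) : FormalGroupAlgebra F B →+ FormalGroupAlgebra F B :=
  AddMonoidHom.mk' (demazureOps b θ F B K) fun f g => by
    induction K with
    | nil => rfl
    | cons j K ih => exact (congrArg (demazureOp b θ F B j) ih).trans (demazureOp_add j _ _)

lemma demazureOpsHom_apply (K : List (Option b.support)) (f : FormalGroupAlgebra F B) :
    demazureOpsHom b θ F B K f = demazureOps b θ F B K f := rfl

lemma demazureOps_mem_orderIdeal (K : List (Option b.support)) {k : ℕ}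
    {f : FormalGroupAlgebra F B} (hf : f ∈ orderIdeal F B (k + K.length)) :
    demazureOps b θ F B K f ∈ orderIdeal F B k := by
  induction K generalizing k with
  | nil => exact hf
  | cons j K ih =>
    refine demazureOp_mem_orderIdeal j (ih ?_)
    rwa [List.length_cons, ← add_assoc, add_right_comm] at hf

lemma augmentation_demazureOps_of_lt {K : List (Option b.support)} {m : ℕ}
    {f : FormalGroupAlgebra F B} (hf : f ∈ orderIdeal F B m) (hK : K.length < m) :
    augmentation F B (demazureOps b θ F B K f) = 0 := by
  rw [← mem_orderIdeal_one]
  exact demazureOps_mem_orderIdeal K (orderIdeal_anti F B (by omega) hf)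

lemma exists_demazureOp_demazureOp (j : Option b.support) (f : FormalGroupAlgebra F B) :
    ∃ c, demazureOp b θ F B j (demazureOp b θ F B j f) = c * demazureOp b θ F B j f := by
  obtain ⟨c, hc⟩ := exists_X_mul_X (F := F) (B := B) b θ j
  refine ⟨c, RootLocalization.algebraMap_injective (P := P) ?_⟩
  have h1 := coeffSum_XSeq_mul b θ [j, j] f
  have h2 := coeffSum_XSeq_mul b θ [j] f
  have e : XSeq F B b θ [j, j] = c • XSeq F B b θ [j] := by simpa [XSeq] using hc
  rw [e, smul_mul_assoc, ← algebraMap_smul (RootLocalization P F B) c, map_smul, h2] at h1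
  rw [map_mul]
  exact h1.symm

lemma augmentation_demazureOps_of_double {A D : List (Option b.support)} {c : Option b.support}
    {m : ℕ} {f : FormalGroupAlgebra F B} (hf : f ∈ orderIdeal F B m)
    (hK : (A ++ c :: c :: D).length ≤ m) :
    augmentation F B (demazureOps b θ F B (A ++ c :: c :: D) f) = 0 := by
  rw [demazureOps_append]
  have e : demazureOps b θ F B (c :: c :: D) f =
      demazureOp b θ F B c (demazureOp b θ F B c (demazureOps b θ F B D f)) := rfl
  obtain ⟨r, hr⟩ := exists_demazureOp_demazureOp (θ := θ) c (demazureOps b θ F B D f)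
  rw [e, hr]
  simp only [List.length_append, List.length_cons] at hK
  refine augmentation_demazureOps_of_lt (m := A.length + 1) ?_ (by omega)
  refine Ideal.mul_mem_left _ _ (demazureOp_mem_orderIdeal c (demazureOps_mem_orderIdeal D ?_))
  exact orderIdeal_anti F B (by omega) hf

lemma augmentation_demazureOp_x (j : Option b.support) (μ : T) :
    augmentation F B (demazureOp b θ F B j (x F B μ)) =
      (P.toLinearMap μ (P.coroot (AffineWeyl.rootIdx b θ j)) : ℤ) := by
  set n := P.toLinearMap μ (P.coroot (AffineWeyl.rootIdx b θ j)) with hn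
  have h1 : x F B (P.root (AffineWeyl.rootIdx b θ j)) *
      (demazureOp b θ F B j (x F B μ) - (n : FormalGroupAlgebra F B)) ∈ orderIdeal F B 2 := by
    have e : reflectionMap b θ F B j (x F B μ) = x F B (μ - n • P.root (AffineWeyl.rootIdx b θ j)) :=
      (map_x F B _ _).trans (congrArg (x F B) (simple_right_smul b θ j μ))
    rw [mul_sub, x_mul_demazureOp, e, ← Ideal.Quotient.eq_zero_iff_mem, map_sub, map_sub, map_mul,
      map_intCast]
    have h2 := map_sub (xModSq F B) μ (n • P.root (AffineWeyl.rootIdx b θ j))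
    rw [map_zsmul] at h2
    change Ideal.Quotient.mk _ (x F B (μ - _)) = Ideal.Quotient.mk _ (x F B μ) -
      n • Ideal.Quotient.mk _ (x F B _) at h2
    rw [h2, zsmul_eq_mul]
    ring
  have h2 := mem_orderIdeal_of_x_mul F B (P.ne_zero (AffineWeyl.rootIdx b θ j)) h1
  rw [mem_orderIdeal_one, map_sub, sub_eq_zero, map_intCast] at h2
  exact h2

/-- The product of the `x_μ`, `μ ∈ M`. -/
def xProd (F : FormalGroup R) [F.IsComm] (B : Module.Basis σ ℤ T) (M : List T) :
    FormalGroupAlgebra F B := (M.map (x F B)).prod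

lemma xProd_mem_orderIdeal (M : List T) : xProd F B M ∈ orderIdeal F B M.length := by
  induction M with
  | nil => exact mem_orderIdeal_zero F B _
  | cons μ M ih =>
    rw [List.length_cons, add_comm]
    exact mul_mem_orderIdeal F B (x_mem_orderIdeal F B μ) ih

lemma demazureOp_xProd_sub_mem (j : Option b.support) (M : List T) :
    demazureOp b θ F B j (xProd F B M) -
      ((leibnizTerms ((AffineWeyl.simple b θ j).right • ·)
        (fun μ => P.toLinearMap μ (P.coroot (AffineWeyl.rootIdx b θ j))) M).map
          fun c => c.1 • xProd F B c.2).sum ∈ orderIdeal F B M.length := by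
  induction M with
  | nil => exact mem_orderIdeal_zero F B _
  | cons μ M ih =>
    set p : T → ℤ := fun μ => P.toLinearMap μ (P.coroot (AffineWeyl.rootIdx b θ j)) with hp
    set s : T → T := ((AffineWeyl.simple b θ j).right • ·) with hs
    have e1 : xProd F B (μ :: M) = x F B μ * xProd F B M := List.prod_cons
    have e2 : ((leibnizTerms s p (μ :: M)).map fun c => c.1 • xProd F B c.2).sum =
        p μ • xProd F B M + x F B (s μ) *
          ((leibnizTerms s p M).map fun c => c.1 • xProd F B c.2).sum := by
      rw [leibnizTerms, List.map_cons, List.sum_cons, List.map_map, ← List.sum_map_mul_left]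
      congr 3
      funext c
      change c.1 • xProd F B (s μ :: c.2) = x F B (s μ) * (c.1 • xProd F B c.2)
      rw [mul_smul_comm]
      rfl
    have e3 : reflectionMap b θ F B j (x F B μ) = x F B (s μ) := map_x F B _ _
    rw [e1, e2, demazureOp_mul, e3, List.length_cons]
    have h1 : (demazureOp b θ F B j (x F B μ) - (p μ : FormalGroupAlgebra F B)) * xProd F B M ∈
        orderIdeal F B (M.length + 1) := by
      rw [add_comm]
      refine mul_mem_orderIdeal F B ?_ (xProd_mem_orderIdeal M)
      rw [mem_orderIdeal_one, map_sub, augmentation_demazureOp_x, map_intCast, sub_self]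
    have h2 := mul_mem_orderIdeal F B (x_mem_orderIdeal F B (s μ)) ih
    rw [add_comm 1] at h2
    convert Ideal.add_mem _ h1 h2 using 1
    rw [zsmul_eq_mul]
    ring

/-- The leading coefficient of a composite Demazure operator on a product of `x_μ`s. -/
lemma augmentation_demazureOps_xProd (K : List (Option b.support)) (M : List T)
    (h : K.length = M.length) :
    augmentation F B (demazureOps b θ F B K.reverse (xProd F B M)) =
      (iterLeibniz (fun j μ => (AffineWeyl.simple b θ j).right • μ)
        (fun j μ => P.toLinearMap μ (P.coroot (AffineWeyl.rootIdx b θ j))) K M : ℤ) := by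
  induction K generalizing M with
  | nil =>
    obtain rfl : M = [] := List.eq_nil_of_length_eq_zero h.symm
    simp [demazureOps, xProd, iterLeibniz]
  | cons j K ih =>
    rw [List.reverse_cons, demazureOps_append]
    have e := demazureOp_xProd_sub_mem (F := F) (B := B) (θ := θ) j M
    have e2 := augmentation_demazureOps_of_lt (θ := θ) (K := K.reverse) e
      (by rw [List.length_reverse, ← h, List.length_cons]; omega)
    rw [← demazureOpsHom_apply, map_sub, map_sub, sub_eq_zero] at e2
    refine e2.trans ?_
    rw [map_list_sum, map_list_sum, iterLeibniz, List.map_map, List.map_map]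
    push_cast
    rw [List.map_map]
    refine congrArg List.sum (List.map_congr_left fun c hc => ?_)
    have hl := length_of_mem_leibnizTerms hc
    simp only [Function.comp_apply, map_zsmul, demazureOpsHom_apply]
    rw [ih c.2 (by rw [List.length_cons] at h; omega), zsmul_eq_mul, Int.cast_mul]

/-- The alternating word of length `m` extending the `p`-th alternating word. -/
def altExtend {J : Type*} (i j : J) (m p : ℕ) : List J :=
  if p % 2 = 1 then altWord i j m else altWord j i m

lemma altEnum_append_drop {J : Type*} (i j : J) {m p : ℕ} (h : p < 2 * m - 1) :
    altEnum i j p ++ (altExtend i j m p).drop ((p + 1) / 2) = altExtend i j m p := by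
  have : altEnum i j p = (altExtend i j m p).take ((p + 1) / 2) := by
    unfold altEnum altExtend
    split_ifs <;> rw [take_altWord _ _ (by omega)]
  rw [this, List.take_append_drop]

lemma length_altEnum {J : Type*} (i j : J) (p : ℕ) : (altEnum i j p).length = (p + 1) / 2 := by
  unfold altEnum
  split_ifs <;> rw [length_altWord]

lemma length_altExtend {J : Type*} (i j : J) (m p : ℕ) : (altExtend i j m p).length = m := by
  unfold altExtend
  split_ifs <;> rw [length_altWord]

/-- A combination of alternating Demazure operators of length less than `m` that preserves `S`
has coefficients in `S`, up to a determinant with known augmentation. -/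
lemma exists_det_mul_mem_range (i j : Option b.support) (m : ℕ) {f₀ : FormalGroupAlgebra F B}
    (hf₀ : f₀ ∈ orderIdeal F B m) : ∃ δ : FormalGroupAlgebra F B,
    augmentation F B δ = ∏ p : Fin (2 * m - 1),
      augmentation F B (demazureOps b θ F B (altExtend i j m p) f₀) ∧
    ∀ q : Fin (2 * m - 1) → RootLocalization P F B,
      (∀ f, ∃ g, ∑ p, q p * algebraMap _ _ (demazureOps b θ F B (altEnum i j p) f) =
        algebraMap (FormalGroupAlgebra F B) _ g) →
      ∀ p, ∃ g, algebraMap _ _ δ * q p = algebraMap (FormalGroupAlgebra F B) _ g := by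
  let M : Matrix (Fin (2 * m - 1)) (Fin (2 * m - 1)) (FormalGroupAlgebra F B) :=
    Matrix.of fun p u => demazureOps b θ F B (altEnum i j p)
      (demazureOps b θ F B ((altExtend i j m u).drop (((u : ℕ) + 1) / 2)) f₀)
  have hM : ∀ p u, M p u = demazureOps b θ F B (altEnum i j p ++
      (altExtend i j m u).drop (((u : ℕ) + 1) / 2)) f₀ := fun p u =>
    (demazureOps_append b θ _ _ _).symm
  refine ⟨M.det, ?_, fun q hq p => ?_⟩
  · rw [RingHom.map_det, Matrix.det_of_isLowerTriangular]
    · refine Finset.prod_congr rfl fun p _ => ?_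
      rw [RingHom.mapMatrix_apply, Matrix.map_apply, hM, altEnum_append_drop i j p.2]
    · intro p u hpu
      have hpu' : (p : ℕ) < u := by simpa using hpu
      have hu := u.2
      rw [RingHom.mapMatrix_apply, Matrix.map_apply, hM]
      by_cases hl : ((p : ℕ) + 1) / 2 < ((u : ℕ) + 1) / 2
      · refine augmentation_demazureOps_of_lt hf₀ ?_
        rw [List.length_append, length_altEnum, List.length_drop, length_altExtend]
        omega
      · have h1 : (p : ℕ) % 2 = 1 := by omega
        have h2 : (u : ℕ) = p + 1 := by omega
        have h3 : ¬ ((p : ℕ) + 1) % 2 = 1 := by omega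
        have h4 : ((p : ℕ) + 1 + 1) / 2 = ((p : ℕ) + 1) / 2 := by omega
        obtain ⟨A, c, D, hA⟩ := exists_altWord_append_drop i j (l := ((p : ℕ) + 1) / 2) (m := m)
          (by omega) (by omega)
        rw [h2, altEnum, altExtend, if_pos h1, if_neg h3, h4, hA]
        refine augmentation_demazureOps_of_double hf₀ ?_
        rw [← hA, List.length_append, length_altWord, List.length_drop, length_altWord]
        omega
  · choose g hg using hq
    let N := (algebraMap (FormalGroupAlgebra F B) (RootLocalization P F B)).mapMatrix M
    have h1 : Matrix.vecMul q N = fun u : Fin (2 * m - 1) =>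
      algebraMap (FormalGroupAlgebra F B) (RootLocalization P F B)
        (g (demazureOps b θ F B ((altExtend i j m u).drop (((u : ℕ) + 1) / 2)) f₀)) := by
      funext u
      exact hg _
    have h2 : Matrix.vecMul (Matrix.vecMul q N) N.adjugate = N.det • q := by
      rw [Matrix.vecMul_vecMul, Matrix.mul_adjugate, Matrix.vecMul_smul, Matrix.vecMul_one]
    have h3 : N.adjugate = (algebraMap (FormalGroupAlgebra F B) (RootLocalization P F B)).mapMatrix
        M.adjugate := (RingHom.map_adjugate _ _).symm
    have h4 : N.det = algebraMap _ _ M.det := (RingHom.map_det _ _).symm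
    refine ⟨∑ u : Fin (2 * m - 1), g (demazureOps b θ F B ((altExtend i j m u).drop (((u : ℕ) + 1) / 2)) f₀) *
      M.adjugate u p, ?_⟩
    have h5 := congrFun h2 p
    rw [h1, h3, h4, Pi.smul_apply, smul_eq_mul] at h5
    rw [← h5, map_sum]
    simp only [map_mul]
    rfl

/-- A criterion for the braid relation, up to shorter words. -/
lemma IsCoeffRing.braid_mem {i j : Option b.support} {O : Subring (RootLocalization P F B)}
    (hO : IsCoeffRing b θ {i, j} O) {m : ℕ} (hm : 0 < m)
    (hprod : AffineWeyl.wordProd b θ (altWord i j m) = AffineWeyl.wordProd b θ (altWord j i m))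
    (htop : topCoeff P F B b θ (altWord i j m) = topCoeff P F B b θ (altWord j i m))
    {f₀ : FormalGroupAlgebra F B} (hf₀ : f₀ ∈ orderIdeal F B m)
    (hO' : ∀ δ : FormalGroupAlgebra F B, augmentation F B δ = ∏ p : Fin (2 * m - 1),
      augmentation F B (demazureOps b θ F B (altExtend i j m p) f₀) →
      ∀ q ∈ O, (∃ g, algebraMap _ _ δ * q = algebraMap (FormalGroupAlgebra F B) _ g) →
        ∃ g, q = algebraMap (FormalGroupAlgebra F B) _ g) :
    XSeq F B b θ (altWord i j m) - XSeq F B b θ (altWord j i m) ∈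
      Submodule.span (FormalGroupAlgebra F B) (XSeq F B b θ '' {K | K.length < m}) := by
  obtain ⟨q, hq⟩ := hO.exists_sub_eq_sum hm hprod htop
  obtain ⟨δ, hδ, h⟩ := exists_det_mul_mem_range (θ := θ) i j m hf₀
  have h1 := h (fun p => q p) fun f => by
    refine ⟨demazureOps b θ F B (altWord i j m) f - demazureOps b θ F B (altWord j i m) f, ?_⟩
    have h2 := congrArg (fun a => coeffSum (a * (f • 1))) hq
    simp only [sub_mul, Finset.sum_mul, map_sub, map_sum, coeffSum_XSeq_mul] at h2
    rw [map_sub, h2]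
    refine Finset.sum_congr rfl fun p _ => ?_
    have e : q p • XSeq F B b θ (altEnum i j p) * f • (1 : TwistedAffine P F B) =
      (q p : RootLocalization P F B) • (XSeq F B b θ (altEnum i j p) * f • 1) :=
      smul_mul_assoc (q p : RootLocalization P F B) _ _
    rw [e, map_smul, coeffSum_XSeq_mul, smul_eq_mul]
  rw [hq]
  refine Submodule.sum_mem _ fun p _ => ?_
  obtain ⟨g, hg⟩ := hO' δ hδ _ (q p).2 (h1 p)
  have e : q p • XSeq F B b θ (altEnum i j p) = g • XSeq F B b θ (altEnum i j p) := by
    rw [← algebraMap_smul (RootLocalization P F B) g, ← hg]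
    rfl
  rw [e]
  refine Submodule.smul_mem _ _ (Submodule.subset_span ⟨_, ?_, rfl⟩)
  change (altEnum i j p).length < m
  rw [length_altEnum]
  omega

end TwistedAffine

end Rank2

section Rank2Model

/-- The action of two simple reflections on the pairings of a weight with the two coroots. -/
def refl2 (p q : ℤ) : Bool → ℤ × ℤ → ℤ × ℤ
  | true, v => (-v.1, v.2 - v.1 * p)
  | false, v => (v.1 - v.2 * q, -v.2)

/-- The two coordinates. -/
def pair2 : Bool → ℤ × ℤ → ℤ
  | true, v => v.1
  | false, v => v.2

/-- The action of two simple reflections on combinations of the two simple roots. -/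
def coordRefl (p q : ℤ) : Bool → ℤ × ℤ → ℤ × ℤ
  | true, c => (-c.1 - c.2 * q, c.2)
  | false, c => (c.1, -c.2 - c.1 * p)

/-- The coordinates of the inversions of a word in two simple reflections. -/
def coordRoots (p q : ℤ) : List Bool → List (ℤ × ℤ)
  | [] => []
  | c :: K => (cond c (1, 0) (0, 1)) :: (coordRoots p q K).map (coordRefl p q c)

/-- The coordinates of `w v - v` in terms of the two simple roots. -/
def displacement (p q : ℤ) (v : ℤ × ℤ) : List Bool → ℤ × ℤ
  | [] => (0, 0)
  | true :: K => (-(displacement p q v K).1 - (v.1 + (displacement p q v K).2 * q),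
      (displacement p q v K).2)
  | false :: K => ((displacement p q v K).1,
      -(displacement p q v K).2 - (v.2 + (displacement p q v K).1 * p))

lemma map_altWord_true {J : Type*} (i j : J) (k : ℕ) :
    (altWord true false k).map (fun c => cond c i j) = altWord i j k :=
  altWord_map _ true false k

lemma map_altWord_false {J : Type*} (i j : J) (k : ℕ) :
    (altWord false true k).map (fun c => cond c i j) = altWord j i k :=
  altWord_map _ false true k

end Rank2Model

namespace ExchangeWords

variable {J G : Type*} [Group G] {s : J → G} {I : G → List J} (h : ExchangeWords s I)
include h

lemma length_tail {i : J} {K : List J}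
    (hK : (I ((i :: K).map s).prod).length = (i :: K).length) :
    (I (K.map s).prod).length = K.length := by
  refine le_antisymm (h.le K) ?_
  have h1 := h.le_of_prod_eq (w := ((i :: K).map s).prod) (l := i :: I (K.map s).prod)
    (by rw [List.map_cons, List.prod_cons, h.prod_eq, List.map_cons, List.prod_cons])
  rw [hK, List.length_cons, List.length_cons] at h1
  omega

lemma le_of_altWord_eq {m k : ℕ} {i j : J} (hm0 : 0 < m)
    (hm : ((altWord i j m).map s).prod = ((altWord j i m).map s).prod)
    (hk : (I ((altWord i j k).map s).prod).length = k) : k ≤ m := by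
  by_contra! hlt
  obtain ⟨r, rfl⟩ : ∃ r, k = m + 1 + r := ⟨k - (m + 1), by omega⟩
  clear hlt
  induction r generalizing i j with
  | zero =>
    obtain ⟨m, rfl⟩ : ∃ m', m = m' + 1 := ⟨m - 1, by omega⟩
    have e : ((altWord i j (m + 1 + 1)).map s).prod = ((altWord j i m).map s).prod := by
      rw [altWord, List.map_cons, List.prod_cons, ← hm, altWord, List.map_cons, List.prod_cons,
        h.mul_mul_cancel]
    have h1 := h.le (altWord j i m)
    rw [add_zero, e] at hk
    rw [length_altWord, hk] at h1
    omega
  | succ r ih =>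
    refine ih hm.symm ?_
    have := h.length_tail (i := i) (K := altWord j i (m + 1 + r)) (by
      rw [List.length_cons, length_altWord]
      exact hk)
    rwa [length_altWord] at this

end ExchangeWords

lemma prod_altWord_eq_pow_mul {J G : Type*} [Group G] {s : J → G} (hs : ∀ j, s j * s j = 1)
    (i j : J) (k : ℕ) :
    ((altWord i j k).map s).prod = (s i * s j) ^ k * ((altWord j i k).map s).prod := by
  have inv : ∀ j, (s j)⁻¹ = s j := fun j => inv_eq_of_mul_eq_one_right (hs j)
  induction k generalizing i j with
  | zero => simp [altWord]
  | succ k ih =>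
    have h1 : s j * (s i * s j) ^ k = ((s i * s j) ^ k)⁻¹ * s j := by
      have h2 : SemiconjBy (s j) (s i * s j) (s i * s j)⁻¹ := by
        rw [SemiconjBy, mul_inv_rev, inv, inv, mul_assoc (s j)]
      have h3 := h2.pow_right k
      rw [inv_pow] at h3
      exact h3
    rw [altWord, List.map_cons, List.prod_cons, altWord, List.map_cons, List.prod_cons, ih i j,
      ← mul_assoc (s j), h1, ← mul_assoc, ← mul_assoc, pow_succ', mul_assoc (s i * s j) (_ ^ k),
      mul_inv_cancel, mul_one, mul_assoc (s i), hs, mul_one]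

namespace AffineWeyl

variable {ι T L : Type*} [AddCommGroup T] [AddCommGroup L] {P : RootPairing ι ℤ T L}
  {b : P.Base} {θ : ι} {i j : Option b.support} {p q : ℤ}

/-- The pairings with two simple coroots. -/
def pairings (b : P.Base) (θ : ι) (i j : Option b.support) (μ : T) : ℤ × ℤ :=
  (P.toLinearMap μ (P.coroot (rootIdx b θ i)), P.toLinearMap μ (P.coroot (rootIdx b θ j)))

lemma pairing_eq_toLinearMap (k l : ι) : P.toLinearMap (P.root k) (P.coroot l) = P.pairing k l :=
  rfl

variable (hp : P.pairing (rootIdx b θ i) (rootIdx b θ j) = p)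
  (hq : P.pairing (rootIdx b θ j) (rootIdx b θ i) = q)
include hp hq

lemma pairings_smul (c : Bool) (μ : T) :
    refl2 p q c (pairings b θ i j μ) =
      pairings b θ i j ((simple b θ (cond c i j)).right • μ) := by
  cases c <;> simp only [refl2, pairings, cond, TwistedAffine.simple_right_smul, map_sub, map_zsmul,
    LinearMap.sub_apply, LinearMap.smul_apply, smul_eq_mul, pairing_eq_toLinearMap, hp, hq,
    P.pairing_same] <;> ring_nf

lemma smul_comb (c : Bool) (x : ℤ × ℤ) :
    (simple b θ (cond c i j)).right •
        (x.1 • P.root (rootIdx b θ i) + x.2 • P.root (rootIdx b θ j)) =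
      (coordRefl p q c x).1 • P.root (rootIdx b θ i) +
        (coordRefl p q c x).2 • P.root (rootIdx b θ j) := by
  cases c <;> simp only [coordRefl, cond, TwistedAffine.simple_right_smul, map_add, map_zsmul,
    LinearMap.add_apply, LinearMap.smul_apply, smul_eq_mul, pairing_eq_toLinearMap, hp, hq,
    P.pairing_same] <;> module

lemma act_wordProd_map (K : List Bool) (v : T × ℤ) :
    act (wordProd b θ (K.map fun c => cond c i j)) v = v +
      (displacement p q (pairings b θ i j v.1) K).1 • simpleRoot b θ i +
      (displacement p q (pairings b θ i j v.1) K).2 • simpleRoot b θ j := by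
  induction K with
  | nil => simp [displacement, wordProd, act_one]
  | cons c K ih =>
    rw [List.map_cons, TwistedAffine.wordProd_cons, act_mul, ih, act_simple]
    have hi : (simpleRoot b θ i).1 = P.root (rootIdx b θ i) := rfl
    have hj : (simpleRoot b θ j).1 = P.root (rootIdx b θ j) := rfl
    cases c <;> simp only [displacement, cond, Prod.fst_add, Prod.smul_fst, map_add, map_zsmul,
      LinearMap.add_apply, LinearMap.smul_apply, smul_eq_mul, pairing_eq_toLinearMap, hp, hq,
      P.pairing_same, hi, hj, pairings] <;> module

lemma wordProd_altWord_eq {m : ℕ} (h : ∀ v, displacement p q v (altWord true false m) =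
      displacement p q v (altWord false true m)) :
    wordProd b θ (altWord i j m) = wordProd b θ (altWord j i m) := by
  have e1 := map_altWord_true i j m
  have e2 := map_altWord_false i j m
  rw [← e1, ← e2]
  refine ext_act fun v => ?_
  rw [act_wordProd_map hp hq, act_wordProd_map hp hq, h]

lemma pairings_wordProd_smul (K : List Bool) (μ : T) :
    pairings b θ i j ((wordProd b θ (K.map fun c => cond c i j)).right • μ) =
      K.foldr (refl2 p q) (pairings b θ i j μ) := by
  induction K with
  | nil => simp [wordProd]
  | cons c K ih =>
    rw [List.map_cons, TwistedAffine.wordProd_cons, SemidirectProduct.mul_right, mul_smul,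
      ← pairings_smul hp hq, ih, List.foldr_cons]

lemma foldr_refl2_eq {k : ℕ}
    (h : wordProd b θ (altWord i j k) = wordProd b θ (altWord j i k)) :
    (altWord true false k).foldr (refl2 p q) (2, p) =
      (altWord false true k).foldr (refl2 p q) (2, p) := by
  have e1 := map_altWord_true i j k
  have e2 := map_altWord_false i j k
  have hα : pairings b θ i j (P.root (rootIdx b θ i)) = (2, p) := by
    rw [pairings, pairing_eq_toLinearMap, pairing_eq_toLinearMap, hp, P.pairing_same]
  rw [← hα, ← pairings_wordProd_smul hp hq, ← pairings_wordProd_smul hp hq, e1, e2, h]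

end AffineWeyl

namespace TwistedAffine

open AffineWeyl FormalGroupAlgebra

variable {ι R T L σ : Type*} [CommRing R] [AddCommGroup T] [AddCommGroup L]
  {P : RootPairing ι ℤ T L} {F : FormalGroup R} [F.IsComm] {B : Module.Basis σ ℤ T} [Finite σ]
  {b : P.Base} {θ : ι} [IsDomain R] [CharZero R]

lemma topCoeff_mul {i j : Option b.support} {p q : ℤ}
    (hp : P.pairing (rootIdx b θ i) (rootIdx b θ j) = p)
    (hq : P.pairing (rootIdx b θ j) (rootIdx b θ i) = q) (K : List Bool) :
    topCoeff P F B b θ (K.map fun c => cond c i j) *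
      algebraMap _ _ (xProd F B ((coordRoots p q K).map fun x =>
        x.1 • P.root (rootIdx b θ i) + x.2 • P.root (rootIdx b θ j))) = (-1) ^ K.length := by
  induction K with
  | nil => simp [topCoeff, coordRoots, xProd]
  | cons c K ih =>
    have h1 := congrArg ((simple b θ (cond c i j)) • ·) ih
    have h2 : reflectionMap b θ F B (cond c i j) (xProd F B ((coordRoots p q K).map fun x =>
        x.1 • P.root (rootIdx b θ i) + x.2 • P.root (rootIdx b θ j))) =
        xProd F B (((coordRoots p q K).map (coordRefl p q c)).map fun x =>
          x.1 • P.root (rootIdx b θ i) + x.2 • P.root (rootIdx b θ j)) := by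
      rw [xProd, xProd, map_list_prod, List.map_map, List.map_map, List.map_map, List.map_map]
      refine congrArg List.prod (List.map_congr_left fun x _ => ?_)
      exact (map_x F B _ _).trans (congrArg (FormalGroupAlgebra.x F B) (smul_comb hp hq c x))
    simp only [smul_mul', smul_pow', smul_neg, smul_one, AffineWeyl.smul_algebraMap] at h1
    change _ * algebraMap _ _ (reflectionMap b θ F B (cond c i j) _) = _ at h1
    rw [h2] at h1
    have h3 : xProd F B ((coordRoots p q (c :: K)).map fun x =>
        x.1 • P.root (rootIdx b θ i) + x.2 • P.root (rootIdx b θ j)) =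
        FormalGroupAlgebra.x F B (P.root (rootIdx b θ (cond c i j))) *
          xProd F B (((coordRoots p q K).map (coordRefl p q c)).map fun x =>
          x.1 • P.root (rootIdx b θ i) + x.2 • P.root (rootIdx b θ j)) := by
      rw [coordRoots, List.map_cons, xProd, List.map_cons, List.prod_cons]
      cases c <;> simp [xProd]
    rw [h3, List.map_cons, topCoeff_cons, map_mul, List.length_cons, pow_succ, ← h1]
    have h4 := xInv_mul (P := P) (F := F) (B := B) (rootIdx b θ (cond c i j))
    linear_combination (-(simple b θ (cond c i j) • topCoeff P F B b θ
      (K.map fun c => cond c i j)) * algebraMap _ _ (xProd F B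
        (((coordRoots p q K).map (coordRefl p q c)).map fun x =>
          x.1 • P.root (rootIdx b θ i) + x.2 • P.root (rootIdx b θ j)))) * h4

lemma topCoeff_altWord_eq {i j : Option b.support} {p q : ℤ}
    (hp : P.pairing (rootIdx b θ i) (rootIdx b θ j) = p)
    (hq : P.pairing (rootIdx b θ j) (rootIdx b θ i) = q) {m : ℕ}
    (h : (coordRoots p q (altWord true false m)).Perm (coordRoots p q (altWord false true m))) :
    topCoeff P F B b θ (altWord i j m) = topCoeff P F B b θ (altWord j i m) := by
  have e1 := map_altWord_true i j m
  have e2 := map_altWord_false i j m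
  have h1 := topCoeff_mul (F := F) (B := B) hp hq (altWord true false m)
  have h2 := topCoeff_mul (F := F) (B := B) hp hq (altWord false true m)
  rw [length_altWord, e1] at h1
  rw [length_altWord, e2, ← h1] at h2
  have h3 : xProd F B ((coordRoots p q (altWord true false m)).map fun x =>
        x.1 • P.root (rootIdx b θ i) + x.2 • P.root (rootIdx b θ j)) =
      xProd F B ((coordRoots p q (altWord false true m)).map fun x =>
        x.1 • P.root (rootIdx b θ i) + x.2 • P.root (rootIdx b θ j)) :=
    ((h.map _).map _).prod_eq
  rw [h3] at h2 h1
  refine (mul_right_cancel₀ ?_ h2).symm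
  intro h0
  rw [h0, mul_zero] at h1
  exact pow_ne_zero m (neg_ne_zero.2 one_ne_zero) h1.symm

lemma augmentation_demazureOps_altWord {i j : Option b.support} {p q : ℤ}
    (hp : P.pairing (rootIdx b θ i) (rootIdx b θ j) = p)
    (hq : P.pairing (rootIdx b θ j) (rootIdx b θ i) = q) (K : List Bool) {M : List T}
    (h : K.length = M.length) :
    augmentation F B (demazureOps b θ F B (K.map fun c => cond c i j) (xProd F B M)) =
      (iterLeibniz (refl2 p q) pair2 K.reverse (M.map (pairings b θ i j)) : ℤ) := by
  have h1 := augmentation_demazureOps_xProd (F := F) (B := B) (θ := θ)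
    (K.reverse.map fun c => cond c i j) M (by simpa using h)
  rw [← List.map_reverse, List.reverse_reverse] at h1
  rw [h1, iterLeibniz_map (s' := refl2 p q) (p' := pair2) (fun c => cond c i j) (pairings b θ i j)
    (fun c μ => pairings_smul hp hq c μ) (fun c μ => by cases c <;> rfl)]

end TwistedAffine

namespace AffineWeyl

variable {ι T L : Type*} [AddCommGroup T] [AddCommGroup L] {P : RootPairing ι ℤ T L}
  {b : P.Base} {θ : ι} {i j : Option b.support}

lemma exists_pairing_eq_one (hsc : Submodule.span ℤ (Set.range P.coroot) = ⊤) (k : b.support) :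
    ∃ ω : T, P.toLinearMap ω (P.coroot k) = 1 := by
  let C : Module.Basis b.support ℤ L := Module.Basis.mk b.linearIndepOn_coroot (by
    rw [← hsc, ← b.span_int_coroot_support, Set.image_eq_range])
  obtain ⟨ω, hω⟩ := (LinearMap.IsPerfPair.bijective_left P.toLinearMap).2 (C.coord k)
  refine ⟨ω, ?_⟩
  have hC : P.coroot k = C k := by simp [C]
  rw [hω, hC]
  simp

lemma pairing_mem [Finite ι] [P.IsReduced] (k l : ι) : (P.pairing k l, P.pairing l k) ∈
    ({(0, 0), (1, 1), (-1, -1), (1, 2), (2, 1), (-1, -2), (-2, -1), (1, 3), (3, 1), (-1, -3),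
        (-3, -1), (2, 2), (-2, -2)} : Set (ℤ × ℤ)) := by
  have h := P.pairingIn_pairingIn_mem_set_of_isCrystal_of_isRed k l
  have e : ∀ k l, P.pairingIn ℤ k l = P.pairing k l := fun k l => P.algebraMap_pairingIn ℤ k l
  rwa [e, e] at h

lemma pairing_nonpos_symm [Finite ι] [P.IsReduced] {k l : ι} (h : P.pairing k l ≤ 0) :
    P.pairing l k ≤ 0 := by
  have := pairing_mem (P := P) k l
  simp only [Set.mem_insert_iff, Set.mem_singleton_iff, Prod.mk.injEq] at this
  omega

lemma pairing_none_right (k : ι) :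
    P.pairing k (rootIdx b θ none) = -P.pairing k θ :=
  P.pairing_reflectionPerm_self_right k θ

lemma pairing_simple_nonpos [Finite ι] [P.IsReduced] (hθ : IsHighestRoot b θ) (hij : i ≠ j) :
    P.pairing (rootIdx b θ i) (rootIdx b θ j) ≤ 0 := by
  have key : ∀ k : b.support, P.pairing k (rootIdx b θ none) ≤ 0 := fun k => by
    rw [pairing_none_right]
    have := (hθ.pairing_of_isPos (RootPairing.Base.isPos_of_mem_support k.2)).1
    omega
  rcases i with _ | i <;> rcases j with _ | j
  · exact absurd rfl hij
  · exact pairing_nonpos_symm (key j)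
  · exact key i
  · have h := b.pairingIn_le_zero_of_ne (i := i) (j := j)
      (fun h => hij (congrArg some (Subtype.ext h))) i.2 j.2
    rwa [show P.pairingIn ℤ (i : ι) j = P.pairing i j from P.algebraMap_pairingIn ℤ _ _] at h

variable {I : AffineWeyl P → List (Option b.support)}

/-- Two simple reflections whose roots are opposite generate an infinite group. -/
lemma eq_zero_of_pairing_neg_two [NoZeroSMulDivisors ℤ T]
    (hp : P.pairing (rootIdx b θ i) (rootIdx b θ j) = -2)
    (hq : P.pairing (rootIdx b θ j) (rootIdx b θ i) = -2) {k : ℕ}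
    (h : wordProd b θ (altWord i j k) = wordProd b θ (altWord j i k)) : k = 0 := by
  have h1 : (simple b θ i * simple b θ j) ^ k = 1 := by
    have := prod_altWord_eq_pow_mul (simple_mul_self b θ) i j k
    change wordProd b θ _ = _ * wordProd b θ _ at this
    rw [h] at this
    exact (mul_eq_right.1 this.symm)
  have hi : (simpleRoot b θ i).1 = P.root (rootIdx b θ i) := rfl
  have hj : (simpleRoot b θ j).1 = P.root (rootIdx b θ j) := rfl
  set δ := simpleRoot b θ i + simpleRoot b θ j with hδ
  have h2 : act (simple b θ i * simple b θ j) δ = δ := by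
    rw [act_mul, act_simple, act_simple]
    simp only [hδ, Prod.fst_add, Prod.fst_sub, Prod.smul_fst, map_add, map_sub, map_zsmul,
      LinearMap.add_apply, LinearMap.sub_apply, LinearMap.smul_apply, hi, hj,
      pairing_eq_toLinearMap, hp, hq, P.pairing_same, smul_eq_mul]
    module
  have h3 : act (simple b θ i * simple b θ j) (simpleRoot b θ i) =
      simpleRoot b θ i + (2 : ℤ) • δ := by
    rw [act_mul, act_simple, act_simple]
    simp only [hδ, Prod.fst_sub, Prod.smul_fst, map_sub, map_zsmul,
      LinearMap.sub_apply, LinearMap.smul_apply, hi, hj,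
      pairing_eq_toLinearMap, hp, hq, P.pairing_same, smul_eq_mul]
    module
  have h4 : ∀ n : ℕ, act ((simple b θ i * simple b θ j) ^ n) (simpleRoot b θ i) =
      simpleRoot b θ i + (2 * n : ℤ) • δ := by
    intro n
    induction n with
    | zero => simp [act_one]
    | succ n ih =>
      have e : ∀ v v', act (simple b θ i * simple b θ j) (v + v') =
          act (simple b θ i * simple b θ j) v + act (simple b θ i * simple b θ j) v' := by
        intro v v'
        rw [← sub_neg_eq_add, act_sub, act_neg, sub_neg_eq_add]
      rw [pow_succ', act_mul, ih, e, h3, act_zsmul, h2]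
      push_cast
      module
  have h5 := h4 k
  rw [h1, act_one, left_eq_add] at h5
  by_contra hk
  have h6 : δ = 0 := by
    have hz : (2 * k : ℤ) ≠ 0 := by omega
    refine Prod.ext ?_ ?_
    · exact (smul_eq_zero.1 (congrArg Prod.fst h5)).resolve_left hz
    · exact (smul_eq_zero.1 (congrArg Prod.snd h5)).resolve_left hz
  have h7 : simpleRoot b θ j = -simpleRoot b θ i := by
    rw [eq_neg_iff_add_eq_zero, add_comm]
    exact h6
  have h8 := not_isPosRoot_neg (isPosRoot_simpleRoot (θ := θ) i)
  rw [← h7] at h8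
  exact h8 (isPosRoot_simpleRoot j)

lemma eq_zero_or_eq_of_altWord_eq (h : ExchangeWords (simple b θ) I) {p q : ℤ}
    (hp : P.pairing (rootIdx b θ i) (rootIdx b θ j) = p)
    (hq : P.pairing (rootIdx b θ j) (rootIdx b θ i) = q) {m k : ℕ} (hm0 : 0 < m)
    (hm : wordProd b θ (altWord i j m) = wordProd b θ (altWord j i m))
    (hne : ∀ k < m, 0 < k → (altWord true false k).foldr (refl2 p q) (2, p) ≠
      (altWord false true k).foldr (refl2 p q) (2, p))
    (hk : wordProd b θ (altWord i j k) = wordProd b θ (altWord j i k))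
    (hlen : (I (wordProd b θ (altWord i j k))).length = k) : k = 0 ∨ k = m := by
  have h1 := h.le_of_altWord_eq hm0 hm hlen
  by_contra! h2
  exact hne k (by omega) (by omega) (foldr_refl2_eq hp hq hk)

end AffineWeyl

namespace TwistedAffine

open AffineWeyl

variable {ι R T L σ : Type*} [CommRing R] [AddCommGroup T] [AddCommGroup L]
  {P : RootPairing ι ℤ T L} {F : FormalGroup R} [F.IsComm] {B : Module.Basis σ ℤ T} [Finite σ]
  {b : P.Base} {θ : ι} [IsDomain R] [CharZero R]

lemma isCoeffRing_top (C : Set (Option b.support)) :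
    IsCoeffRing b θ C (⊤ : Subring (RootLocalization P F B)) :=
  ⟨fun _ => trivial, fun _ _ _ => trivial, fun _ _ => trivial⟩

/-- The products of the `x_γ`, for `γ` a root that takes the value one on the coroot lattice. -/
def primitiveSubmonoid (P : RootPairing ι ℤ T L) (F : FormalGroup R) [F.IsComm]
    (B : Module.Basis σ ℤ T) : Submonoid (FormalGroupAlgebra F B) :=
  Submonoid.closure
    {f | ∃ k, (∃ l, P.toLinearMap (P.root k) l = 1) ∧ f = FormalGroupAlgebra.x F B (P.root k)}

lemma dvd_of_dvd_mul_of_mem_primitiveSubmonoid {d : FormalGroupAlgebra F B}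
    (hd : d ∈ primitiveSubmonoid P F B) {δ f : FormalGroupAlgebra F B}
    (hδ : FormalGroupAlgebra.augmentation F B δ ≠ 0) (h : d ∣ δ * f) : d ∣ f ∧ d ≠ 0 := by
  induction hd using Submonoid.closure_induction generalizing f with
  | mem d hd =>
    obtain ⟨k, ⟨l, hl⟩, rfl⟩ := hd
    exact ⟨FormalGroupAlgebra.x_dvd_of_dvd_mul F B (P.toLinearMap.flip l) hl hδ h,
      x_root_ne_zero k⟩
  | one => exact ⟨one_dvd _, one_ne_zero⟩
  | mul d d' _ _ ih ih' =>
    obtain ⟨⟨g, rfl⟩, h0⟩ := ih ((dvd_mul_right d d').trans h)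
    rw [mul_left_comm] at h
    obtain ⟨h1, h0'⟩ := ih' ((mul_dvd_mul_iff_left h0).1 h)
    exact ⟨mul_dvd_mul_left d h1, mul_ne_zero h0 h0'⟩

/-- The fractions whose denominators are products of the `x_γ` for primitive roots `γ`. -/
def primitiveSubring (P : RootPairing ι ℤ T L) (F : FormalGroup R) [F.IsComm]
    (B : Module.Basis σ ℤ T) : Subring (RootLocalization P F B) where
  carrier := {q | ∃ d ∈ primitiveSubmonoid P F B, ∃ g : FormalGroupAlgebra F B,
    algebraMap _ _ d * q = algebraMap _ _ g}
  mul_mem' := by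
    rintro q q' ⟨d, hd, g, hg⟩ ⟨d', hd', g', hg'⟩
    exact ⟨d * d', mul_mem hd hd', g * g', by rw [map_mul, map_mul, ← hg, ← hg']; ring⟩
  one_mem' := ⟨1, one_mem _, 1, by simp⟩
  add_mem' := by
    rintro q q' ⟨d, hd, g, hg⟩ ⟨d', hd', g', hg'⟩
    exact ⟨d * d', mul_mem hd hd', d' * g + d * g', by
      rw [map_mul, map_add, map_mul, map_mul, ← hg, ← hg']; ring⟩
  zero_mem' := ⟨1, one_mem _, 0, by simp⟩
  neg_mem' := by
    rintro q ⟨d, hd, g, hg⟩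
    exact ⟨d, hd, -g, by rw [map_neg, ← hg]; ring⟩

lemma isCoeffRing_primitiveSubring {C : Set (Option b.support)}
    (hC : ∀ j ∈ C, ∃ l, P.toLinearMap (P.root (rootIdx b θ j)) l = 1) :
    IsCoeffRing b θ C (primitiveSubring P F B) where
  algebraMap_mem f := ⟨1, one_mem _, f, by simp⟩
  smul_mem w q := by
    rintro ⟨d, hd, g, hg⟩
    have h := congrArg (w • ·) hg
    simp only [smul_mul', AffineWeyl.smul_algebraMap] at h
    refine ⟨_, ?_, _, h⟩
    clear h hg
    induction hd using Submonoid.closure_induction with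
    | mem d hd =>
      obtain ⟨k, ⟨l, hl⟩, rfl⟩ := hd
      refine Submonoid.subset_closure ⟨(w.right : P.Aut).indexEquiv k,
        ⟨(coweightAction P w.right (Multiplicative.ofAdd l)).toAdd, ?_⟩, ?_⟩
      · rw [← RootPairing.weylGroup_smul_root, RootPairing.toLinearMap_smul_coweightAction]
        exact hl
      · rw [← RootPairing.weylGroup_smul_root, FormalGroupAlgebra.map_x]
        rfl
    | one => rw [map_one]; exact one_mem _
    | mul d d' _ _ ih ih' => rw [map_mul]; exact mul_mem ih ih'
  xInv_mem j hj := ⟨_, Submonoid.subset_closure ⟨_, hC j hj, rfl⟩, 1, by rw [xInv_mul, map_one]⟩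

/-- The case of the braid relation in which a leading coefficient is one. -/
lemma braid_mem_of_eq_one {i j : Option b.support} {p q : ℤ}
    (hp : P.pairing (rootIdx b θ i) (rootIdx b θ j) = p)
    (hq : P.pairing (rootIdx b θ j) (rootIdx b θ i) = q) {m : ℕ} (hm : 0 < m)
    (hprod : wordProd b θ (altWord i j m) = wordProd b θ (altWord j i m))
    (hroots : (coordRoots p q (altWord true false m)).Perm
      (coordRoots p q (altWord false true m)))
    (M : List T) (hM : M.length = m)
    (h1 : iterLeibniz (refl2 p q) pair2 (altWord true false m).reverse
      (M.map (pairings b θ i j)) = 1)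
    (h2 : iterLeibniz (refl2 p q) pair2 (altWord false true m).reverse
      (M.map (pairings b θ i j)) = 1) :
    XSeq F B b θ (altWord i j m) - XSeq F B b θ (altWord j i m) ∈
      Submodule.span (FormalGroupAlgebra F B) (XSeq F B b θ '' {K | K.length < m}) := by
  refine (isCoeffRing_top _).braid_mem hm hprod (topCoeff_altWord_eq hp hq hroots)
    (hM ▸ xProd_mem_orderIdeal (F := F) (B := B) M) ?_
  rintro δ hδ q' - ⟨g, hg⟩
  have a1 := augmentation_demazureOps_altWord (F := F) (B := B) hp hq (altWord true false m)
    (M := M) (by rw [length_altWord, hM])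
  have a2 := augmentation_demazureOps_altWord (F := F) (B := B) hp hq (altWord false true m)
    (M := M) (by rw [length_altWord, hM])
  rw [h1, map_altWord_true, Int.cast_one] at a1
  rw [h2, map_altWord_false, Int.cast_one] at a2
  rw [Finset.prod_eq_one fun r _ => by unfold altExtend; split_ifs <;> assumption] at hδ
  obtain ⟨u, hu⟩ := FormalGroupAlgebra.isUnit_of_augmentation F B
    (hδ ▸ isUnit_one : IsUnit (FormalGroupAlgebra.augmentation F B δ))
  refine ⟨↑u⁻¹ * g, ?_⟩
  rw [map_mul, ← hg, ← mul_assoc, ← map_mul, ← hu, Units.inv_mul, map_one, one_mul]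

/-- The case of the braid relation in which the two simple roots are primitive. -/
lemma braid_mem_of_primitive {i j : Option b.support} {p q : ℤ}
    (hp : P.pairing (rootIdx b θ i) (rootIdx b θ j) = p)
    (hq : P.pairing (rootIdx b θ j) (rootIdx b θ i) = q) {m : ℕ} (hm : 0 < m)
    (hprod : wordProd b θ (altWord i j m) = wordProd b θ (altWord j i m))
    (hroots : (coordRoots p q (altWord true false m)).Perm
      (coordRoots p q (altWord false true m)))
    (hi : ∃ l, P.toLinearMap (P.root (rootIdx b θ i)) l = 1)
    (hj : ∃ l, P.toLinearMap (P.root (rootIdx b θ j)) l = 1)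
    (M : List T) (hM : M.length = m)
    (h1 : iterLeibniz (refl2 p q) pair2 (altWord true false m).reverse
      (M.map (pairings b θ i j)) ≠ 0)
    (h2 : iterLeibniz (refl2 p q) pair2 (altWord false true m).reverse
      (M.map (pairings b θ i j)) ≠ 0) :
    XSeq F B b θ (altWord i j m) - XSeq F B b θ (altWord j i m) ∈
      Submodule.span (FormalGroupAlgebra F B) (XSeq F B b θ '' {K | K.length < m}) := by
  refine (isCoeffRing_primitiveSubring (by rintro c (rfl | rfl) <;> assumption)).braid_mem hm hprod
    (topCoeff_altWord_eq hp hq hroots) (hM ▸ xProd_mem_orderIdeal (F := F) (B := B) M) ?_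
  rintro δ hδ q' ⟨d, hd, g', hg'⟩ ⟨g, hg⟩
  have a1 := augmentation_demazureOps_altWord (F := F) (B := B) hp hq (altWord true false m)
    (M := M) (by rw [length_altWord, hM])
  have a2 := augmentation_demazureOps_altWord (F := F) (B := B) hp hq (altWord false true m)
    (M := M) (by rw [length_altWord, hM])
  rw [map_altWord_true] at a1
  rw [map_altWord_false] at a2
  have hδ0 : FormalGroupAlgebra.augmentation F B δ ≠ 0 := by
    rw [hδ]
    refine Finset.prod_ne_zero_iff.2 fun r _ => ?_
    unfold altExtend
    split_ifs
    · rw [a1]; exact_mod_cast h1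
    · rw [a2]; exact_mod_cast h2
  have e : d * g = δ * g' := by
    refine RootLocalization.algebraMap_injective (P := P) ?_
    rw [map_mul, map_mul, ← hg, ← hg']
    ring
  obtain ⟨⟨r, rfl⟩, h0⟩ := dvd_of_dvd_mul_of_mem_primitiveSubmonoid hd hδ0 (Dvd.intro g e)
  refine ⟨r, ?_⟩
  rw [map_mul] at hg'
  refine mul_left_cancel₀ ?_ hg'
  rw [Ne, map_eq_zero_iff _ (RootLocalization.algebraMap_injective (P := P))]
  exact h0

lemma X_commute {i j : Option b.support}
    (hp : P.pairing (rootIdx b θ i) (rootIdx b θ j) = 0)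
    (hq : P.pairing (rootIdx b θ j) (rootIdx b θ i) = 0)
    (hprod : simple b θ i * simple b θ j = simple b θ j * simple b θ i) :
    X F B b θ i * X F B b θ j = X F B b θ j * X F B b θ i := by
  have key : ∀ i j : Option b.support, P.pairing (rootIdx b θ j) (rootIdx b θ i) = 0 →
      simple b θ i • xInv P F B (rootIdx b θ j) = xInv P F B (rootIdx b θ j) := by
    intro i j h
    rw [smul_xInv]
    congr 1
    refine P.root.injective ?_
    rw [← RootPairing.weylGroup_smul_root, simple_right_smul, pairing_eq_toLinearMap, h, zero_smul,
      sub_zero]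
  have expand : ∀ i j : Option b.support, P.pairing (rootIdx b θ j) (rootIdx b θ i) = 0 →
      X F B b θ i * X F B b θ j = (xInv P F B (rootIdx b θ i) * xInv P F B (rootIdx b θ j)) •
        (1 - η P F B (simple b θ i) - η P F B (simple b θ j) +
          η P F B (simple b θ i * simple b θ j)) := by
    intro i j h
    rw [X_eq, X_eq, smul_mul_assoc, sub_mul, one_mul, η_mul_smul, key i j h, mul_sub, mul_one,
      η_mul, ← smul_sub, smul_smul]
    congr 1
    abel
  rw [expand i j hq, expand j i hp, hprod, mul_comm (xInv P F B (rootIdx b θ i))]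
  congr 1
  abel

variable [Finite ι] [P.IsReduced] {I : AffineWeyl P → List (Option b.support)}

lemma braid_of_pairing (hsc : Submodule.span ℤ (Set.range P.coroot) = ⊤)
    (hθ : IsHighestRoot b θ) (h : ExchangeWords (simple b θ) I) {i j : Option b.support}
    (hij : i ≠ j)
    (hpq : (P.pairing (rootIdx b θ i) (rootIdx b θ j), P.pairing (rootIdx b θ j) (rootIdx b θ i)) ∈
      ({(0, 0), (-1, -1), (-1, -2), (-1, -3), (-2, -2)} : Set (ℤ × ℤ))) {k : ℕ}
    (hk : wordProd b θ (altWord i j k) = wordProd b θ (altWord j i k))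
    (hlen : (I (wordProd b θ (altWord i j k))).length = k) :
    XSeq F B b θ (altWord i j k) - XSeq F B b θ (altWord j i k) ∈
      Submodule.span (FormalGroupAlgebra F B) (XSeq F B b θ '' {K | K.length < k}) := by
  have hzero : XSeq F B b θ (altWord i j 0) - XSeq F B b θ (altWord j i 0) ∈
      Submodule.span (FormalGroupAlgebra F B) (XSeq F B b θ '' {K | K.length < 0}) := by
    rw [altWord, altWord, sub_self]
    exact Submodule.zero_mem _
  simp only [Set.mem_insert_iff, Set.mem_singleton_iff, Prod.mk.injEq] at hpq
  have hαα : ∀ c, P.toLinearMap (P.root c) (P.coroot c) = 2 := fun c => P.root_coroot_two c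
  have hα : pairings b θ i j (P.root (rootIdx b θ i)) =
      (2, P.pairing (rootIdx b θ i) (rootIdx b θ j)) := by
    rw [pairings, hαα, pairing_eq_toLinearMap]
  have hβ : pairings b θ i j (P.root (rootIdx b θ j)) =
      (P.pairing (rootIdx b θ j) (rootIdx b θ i), 2) := by
    rw [pairings, hαα, pairing_eq_toLinearMap]
  rcases hpq with ⟨hp, hq⟩ | ⟨hp, hq⟩ | ⟨hp, hq⟩ | ⟨hp, hq⟩ | ⟨hp, hq⟩
  · have hm : wordProd b θ (altWord i j 2) = wordProd b θ (altWord j i 2) :=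
      wordProd_altWord_eq hp hq fun v => by
        simp only [altWord, displacement]
        ext <;> ring
    rcases eq_zero_or_eq_of_altWord_eq h hp hq two_pos hm (by decide) hk hlen with rfl | rfl
    · exact hzero
    · have hm' : simple b θ i * simple b θ j = simple b θ j * simple b θ i := by
        simpa [wordProd, altWord] using hm
      have : XSeq F B b θ (altWord i j 2) - XSeq F B b θ (altWord j i 2) = 0 := by
        simpa [XSeq, altWord, sub_eq_zero] using X_commute hp hq hm'
      rw [this]
      exact Submodule.zero_mem _
  · have hm : wordProd b θ (altWord i j 3) = wordProd b θ (altWord j i 3) :=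
      wordProd_altWord_eq hp hq fun v => by
        simp only [altWord, displacement]
        ext <;> ring
    rcases eq_zero_or_eq_of_altWord_eq h hp hq three_pos hm (by decide) hk hlen with rfl | rfl
    · exact hzero
    · rw [hp] at hα
      rw [hq] at hβ
      refine braid_mem_of_primitive hp hq three_pos hm (by decide)
        ⟨P.coroot (rootIdx b θ i) + P.coroot (rootIdx b θ j), ?_⟩
        ⟨P.coroot (rootIdx b θ i) + P.coroot (rootIdx b θ j), ?_⟩
        [P.root (rootIdx b θ i), P.root (rootIdx b θ i), P.root (rootIdx b θ j)] rfl ?_ ?_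
      · rw [map_add, hαα, pairing_eq_toLinearMap, hp]; rfl
      · rw [map_add, hαα, pairing_eq_toLinearMap, hq]; rfl
      · simp only [List.map_cons, List.map_nil, hα, hβ]; decide
      · simp only [List.map_cons, List.map_nil, hα, hβ]; decide
  · have hm : wordProd b θ (altWord i j 4) = wordProd b θ (altWord j i 4) :=
      wordProd_altWord_eq hp hq fun v => by
        simp only [altWord, displacement]
        ext <;> ring
    rcases eq_zero_or_eq_of_altWord_eq h hp hq four_pos hm (by decide) hk hlen with rfl | rfl
    · exact hzero
    · obtain ⟨ω, hω⟩ : ∃ ω, P.toLinearMap ω (P.coroot (rootIdx b θ i)) = 1 := by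
        rcases i with _ | i
        · exfalso
          rcases j with _ | j
          · exact hij rfl
          · rw [pairing_none_right] at hq
            have h1 := (hθ.pairing_of_isPos (RootPairing.Base.isPos_of_mem_support j.2)).2.2
            have h2 : (j : ι) = θ := h1 (by
              change -P.pairing (j : ι) θ = -2 at hq
              omega)
            have h3 : P.pairing (P.reflectionPerm θ θ) (j : ι) = -1 := hp
            rw [h2, P.pairing_reflectionPerm_self_left, P.pairing_same] at h3
            omega
        · exact exists_pairing_eq_one hsc i
      rw [hp] at hα
      rw [hq] at hβ
      set c := P.toLinearMap ω (P.coroot (rootIdx b θ j)) with hc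
      have hadd : ∀ μ ν, pairings b θ i j (μ - ν) = pairings b θ i j μ - pairings b θ i j ν := by
        intro μ ν
        simp only [pairings, map_sub, LinearMap.sub_apply]
        rfl
      have hω' : pairings b θ i j ω = (1, c) := by rw [pairings, hω]
      set lam := ω - c • (P.root (rootIdx b θ i) + P.root (rootIdx b θ j)) with hlam
      have hlam' : pairings b θ i j lam = (1, 0) := by
        have h1 := congrArg Prod.fst hα
        have h2 := congrArg Prod.snd hα
        have h3 := congrArg Prod.fst hβ
        have h4 := congrArg Prod.snd hβ
        simp only [pairings] at h1 h2 h3 h4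
        simp only [pairings, hlam, map_sub, map_zsmul, map_add, LinearMap.sub_apply,
          LinearMap.smul_apply, LinearMap.add_apply, h1, h2, h3, h4, hω, ← hc]
        refine Prod.ext ?_ ?_ <;> simp
      refine braid_mem_of_eq_one hp hq four_pos hm (by decide)
        [lam, lam, lam, lam - P.root (rootIdx b θ i)] rfl ?_ ?_
      · simp only [List.map_cons, List.map_nil, hadd, hα, hlam']; decide
      · simp only [List.map_cons, List.map_nil, hadd, hα, hlam']; decide
  · have hm : wordProd b θ (altWord i j 6) = wordProd b θ (altWord j i 6) :=
      wordProd_altWord_eq hp hq fun v => by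
        simp only [altWord, displacement]
        ext <;> ring
    rcases eq_zero_or_eq_of_altWord_eq h hp hq (by norm_num) hm (by decide) hk hlen with rfl | rfl
    · exact hzero
    · rw [hp] at hα
      rw [hq] at hβ
      refine braid_mem_of_primitive hp hq (by norm_num) hm (by decide)
        ⟨P.coroot (rootIdx b θ i) + P.coroot (rootIdx b θ j), ?_⟩
        ⟨P.coroot (rootIdx b θ i) + (2 : ℤ) • P.coroot (rootIdx b θ j), ?_⟩
        [P.root (rootIdx b θ i), P.root (rootIdx b θ i), P.root (rootIdx b θ i),
          P.root (rootIdx b θ i), P.root (rootIdx b θ i), P.root (rootIdx b θ j)] rfl ?_ ?_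
      · rw [map_add, hαα, pairing_eq_toLinearMap, hp]; rfl
      · rw [map_add, map_zsmul, hαα, pairing_eq_toLinearMap, hq]; rfl
      · simp only [List.map_cons, List.map_nil, hα, hβ]; decide +kernel
      · simp only [List.map_cons, List.map_nil, hα, hβ]; decide +kernel
  · have : IsAddTorsionFree T := B.repr.toAddEquiv.injective.isAddTorsionFree B.repr.toAddMonoidHom
    obtain rfl := eq_zero_of_pairing_neg_two hp hq hk
    exact hzero

/-- The Demazure elements satisfy the relations of a Demazure algebra. -/
theorem demazureRelations (hsc : Submodule.span ℤ (Set.range P.coroot) = ⊤)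
    (hθ : IsHighestRoot b θ) (h : ExchangeWords (simple b θ) I) :
    DemazureRelations (FormalGroupAlgebra F B) (simple b θ) I (X F B b θ) where
  leibniz j f := ⟨_, _, X_mul_smul b θ j f⟩
  quadratic := exists_X_mul_X b θ
  braid i j k hij hk hlen := by
    have h1 := pairing_mem (P := P) (rootIdx b θ i) (rootIdx b θ j)
    have h2 := pairing_simple_nonpos hθ hij
    simp only [Set.mem_insert_iff, Set.mem_singleton_iff, Prod.mk.injEq] at h1
    by_cases h3 : P.pairing (rootIdx b θ i) (rootIdx b θ j) = -2 ∧
      P.pairing (rootIdx b θ j) (rootIdx b θ i) = -1 ∨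
      P.pairing (rootIdx b θ i) (rootIdx b θ j) = -3 ∧
      P.pairing (rootIdx b θ j) (rootIdx b θ i) = -1
    · have h4 := braid_of_pairing (F := F) (B := B) hsc hθ h hij.symm (k := k) (by
        simp only [Set.mem_insert_iff, Set.mem_singleton_iff, Prod.mk.injEq]
        omega) hk.symm (by
          change (I ((altWord j i k).map (simple b θ)).prod).length = k
          rwa [← hk])
      rw [← neg_sub]
      exact Submodule.neg_mem _ h4
    · exact braid_of_pairing hsc hθ h hij (by
        simp only [Set.mem_insert_iff, Set.mem_singleton_iff, Prod.mk.injEq]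
        omega) hk hlen

end TwistedAffine

/-- A family of finitely supported functions that is triangular with respect to a degree is linearly
independent. -/
lemma linearIndependent_of_triangular {A U G : Type*} [CommRing A] [IsDomain A] (f : U → G →₀ A)
    (deg : U → ℕ) (pos : U → G) (h0 : ∀ u, f u (pos u) ≠ 0)
    (h1 : ∀ u v, v ≠ u → f u (pos v) ≠ 0 → deg v < deg u) : LinearIndependent A f := by
  rw [linearIndependent_iff]
  intro c hc
  by_contra hne
  obtain ⟨v, hv, hmax⟩ := c.support.exists_max_image deg (Finsupp.support_nonempty_iff.2 hne)
  have h2 := DFunLike.congr_fun hc (pos v)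
  rw [Finsupp.linearCombination_apply, Finsupp.sum, Finsupp.finsetSum_apply,
    Finset.sum_eq_single v] at h2
  · rw [Finsupp.smul_apply, smul_eq_mul, Finsupp.zero_apply] at h2
    exact mul_ne_zero (Finsupp.mem_support_iff.1 hv) (h0 v) h2
  · intro u hu huv
    rw [Finsupp.smul_apply, smul_eq_mul]
    by_contra h3
    have := h1 u v huv.symm (right_ne_zero_of_mul h3)
    exact absurd (hmax u hu) (by omega)
  · exact fun h => absurd hv h

namespace AffineWeyl

variable {ι T L : Type*} [AddCommGroup T] [AddCommGroup L] {P : RootPairing ι ℤ T L}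
  {b : P.Base} {θ : ι} {I : AffineWeyl P → List (Option b.support)}
  (hI : ∀ w, IsReducedSeq b θ (I w) w)

include hI in
lemma length_eq (w : AffineWeyl P) : length b θ w = (I w).length := by
  refine le_antisymm (Nat.sInf_le ⟨I w, (hI w).1, rfl⟩) (le_csInf ⟨_, I w, (hI w).1, rfl⟩ ?_)
  rintro _ ⟨l, hl, rfl⟩
  exact (hI w).2 l hl

lemma left_mul_of_mem_finiteWeyl (u : AffineWeyl P) {v : AffineWeyl P} (hv : v ∈ finiteWeyl P) :
    (u * v).left = u.left := by
  obtain ⟨g, rfl⟩ := hv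
  simp

lemma exists_mul_of_left_eq {u w : AffineWeyl P} (h : u.left = w.left) :
    ∃ v ∈ finiteWeyl P, w = u * v := by
  refine ⟨SemidirectProduct.inr (u.right⁻¹ * w.right), ⟨_, rfl⟩, ?_⟩
  refine SemidirectProduct.ext ?_ ?_ <;> simp [h]

lemma exists_minReps_mul (w : AffineWeyl P) :
    ∃ u ∈ minReps b θ, ∃ v ∈ finiteWeyl P, w = u * v := by
  classical
  have hex : ∃ n, ∃ v ∈ finiteWeyl P, length b θ (w * v) = n := ⟨_, 1, one_mem _, rfl⟩
  obtain ⟨v, hv, hn⟩ := Nat.find_spec hex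
  refine ⟨w * v, fun v' hv' => ?_, v⁻¹, inv_mem hv, by simp⟩
  rw [hn, mul_assoc]
  exact Nat.find_min' hex ⟨v * v', mul_mem hv hv', rfl⟩

variable (hcompat : IsCompatible b θ I)
include hI hcompat

lemma length_mul {u v : AffineWeyl P} (hu : u ∈ minReps b θ) (hv : v ∈ finiteWeyl P) :
    length b θ (u * v) = length b θ u + length b θ v := by
  rw [length_eq hI, length_eq hI, length_eq hI, hcompat u hu v hv, List.length_append]

lemma eq_one_of_length_eq_zero {v : AffineWeyl P} (h : length b θ v = 0) : v = 1 := by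
  rw [length_eq hI, List.length_eq_zero_iff] at h
  rw [← (hI v).1, h]
  rfl

lemma minReps_eq_of_left_eq {u w : AffineWeyl P} (hu : u ∈ minReps b θ) (hw : w ∈ minReps b θ)
    (h : u.left = w.left) : w = u := by
  obtain ⟨v, hv, rfl⟩ := exists_mul_of_left_eq h
  have h1 := length_mul hI hcompat hu hv
  have h2 := hw v⁻¹ (inv_mem hv)
  rw [mul_inv_cancel_right] at h2
  rw [eq_one_of_length_eq_zero hI hcompat (v := v) (by omega), mul_one]

lemma minReps_length_le {u w : AffineWeyl P} (hu : u ∈ minReps b θ) (h : u.left = w.left) :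
    length b θ u ≤ length b θ w := by
  obtain ⟨v, hv, rfl⟩ := exists_mul_of_left_eq h
  exact hu v hv

end AffineWeyl

namespace TwistedAffine

open AffineWeyl

variable {ι R T L σ : Type*} [CommRing R] [AddCommGroup T] [AddCommGroup L]
  {P : RootPairing ι ℤ T L} {F : FormalGroup R} [F.IsComm] {B : Module.Basis σ ℤ T} [Finite σ]
  {b : P.Base} {θ : ι}

section Span

variable {I : AffineWeyl P → List (Option b.support)}

lemma smul_one_mul (f : FormalGroupAlgebra F B) (a : TwistedAffine P F B) :
    (f • (1 : TwistedAffine P F B)) * a = f • a := by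
  rw [smul_mul_assoc, one_mul]

lemma X_mem_demazure (j : Option b.support) : X F B b θ j ∈ demazure F B b θ :=
  Subring.subset_closure (Or.inr ⟨j, rfl⟩)

lemma smul_mem_demazure (f : FormalGroupAlgebra F B) {a : TwistedAffine P F B}
    (ha : a ∈ demazure F B b θ) : f • a ∈ demazure F B b θ := by
  rw [← smul_one_mul]
  exact mul_mem (Subring.subset_closure (Or.inl ⟨f, rfl⟩)) ha

lemma XSeq_mem_demazure (K : List (Option b.support)) : XSeq F B b θ K ∈ demazure F B b θ := by
  refine list_prod_mem fun a ha => ?_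
  obtain ⟨j, -, rfl⟩ := List.mem_map.1 ha
  exact X_mem_demazure j

theorem span_eq_demazure (h : ExchangeWords (simple b θ) I)
    (hX : DemazureRelations (FormalGroupAlgebra F B) (simple b θ) I (X F B b θ)) :
    (Submodule.span (FormalGroupAlgebra F B) (Set.range fun w => XSeq F B b θ (I w)) :
      Set (TwistedAffine P F B)) = demazure F B b θ := by
  set N := Submodule.span (FormalGroupAlgebra F B) (Set.range fun w => XSeq F B b θ (I w)) with hN
  have hK : ∀ K, XSeq F B b θ K ∈ N := fun K =>
    Submodule.span_mono (Set.image_subset_range _ _) (hX.prod_mem_wordSpan h K)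
  refine Set.Subset.antisymm ?_ fun a ha => ?_
  · intro a ha
    refine Submodule.span_induction (p := fun a _ => a ∈ demazure F B b θ) ?_ (zero_mem _)
      (fun _ _ _ _ => add_mem) (fun f _ _ => smul_mem_demazure f) ha
    rintro _ ⟨w, rfl⟩
    exact XSeq_mem_demazure _
  · suffices ∀ y ∈ N, a * y ∈ N by
      have := this 1 (hK [])
      rwa [mul_one] at this
    refine Subring.closure_induction (p := fun a _ => ∀ y ∈ N, a * y ∈ N) ?_ ?_ ?_ ?_ ?_ ?_ ha
    · rintro _ (⟨f, rfl⟩ | ⟨j, rfl⟩) y hy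
      · dsimp only
        rw [smul_one_mul]
        exact N.smul_mem f hy
      · refine Submodule.span_induction (p := fun y _ => X F B b θ j * y ∈ N) ?_ ?_ ?_ ?_ hy
        · rintro _ ⟨w, rfl⟩
          dsimp only
          rw [← XSeq_cons]
          exact hK _
        · rw [mul_zero]; exact N.zero_mem
        · intro y y' _ _ h h'
          rw [mul_add]; exact N.add_mem h h'
        · intro f y hy h
          rw [X_mul_smul]
          exact N.add_mem (N.smul_mem _ h) (N.smul_mem _ hy)
    · intro y _; rw [zero_mul]; exact N.zero_mem
    · intro y hy; rwa [one_mul]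
    · intro a a' _ _ h h' y hy
      rw [add_mul]; exact N.add_mem (h y hy) (h' y hy)
    · intro a _ h y hy
      have e : -a * y = -(a * y) := neg_mul a y
      rw [e]; exact N.neg_mem (h y hy)
    · intro a a' _ _ h h' y hy
      rw [mul_assoc]; exact h _ (h' y hy)

end Span

lemma coeff_of_mem_ηSpan {C : Set (Option b.support)} {O : Subring (RootLocalization P F B)} {n : ℕ}
    {a : TwistedAffine P F B} (ha : a ∈ ηSpan b θ C O n) {v : AffineWeyl P} (hv : a.coeff v ≠ 0) :
    ∃ K : List (Option b.support), wordProd b θ K = v ∧ K.length < n := by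
  classical
  induction ha using Submodule.span_induction with
  | mem a ha =>
    obtain ⟨K, ⟨_, hn⟩, rfl⟩ := ha
    refine ⟨K, ?_, hn⟩
    by_contra h
    simp [η, h] at hv
  | zero => simp at hv
  | add a a' _ _ h h' =>
    by_cases h0 : a.coeff v = 0
    · exact h' (by simpa [h0] using hv)
    · exact h h0
  | smul c a _ h =>
    refine h fun h0 => hv ?_
    have : c • a = (c : RootLocalization P F B) • a := rfl
    rw [this, SkewMonoidAlgebra.coeff_smul, Finsupp.smul_apply, h0, smul_zero]

/-- The projection `pr` as a linear map. -/
def prLin (P : RootPairing ι ℤ T L) (F : FormalGroup R) [F.IsComm] (B : Module.Basis σ ℤ T) :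
    TwistedAffine P F B →ₗ[RootLocalization P F B] TwistedLattice P F B :=
  { pr P F B with
    map_smul' := fun _ _ => SkewMonoidAlgebra.mapDomain_smul }

lemma prLin_apply (a : TwistedAffine P F B) : prLin P F B a = pr P F B a := rfl

lemma pr_smul_η (q : RootLocalization P F B) (w : AffineWeyl P) :
    pr P F B (q • η P F B w) = SkewMonoidAlgebra.single w.left q := by
  rw [smul_η]
  exact SkewMonoidAlgebra.mapDomain_single

lemma pr_smul (f : FormalGroupAlgebra F B) (a : TwistedAffine P F B) :
    pr P F B (f • a) = f • pr P F B a := by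
  rw [← algebraMap_smul (RootLocalization P F B) f, ← algebraMap_smul (RootLocalization P F B) f]
  exact (prLin P F B).map_smul _ _

lemma coeff_pr_of_mem_ηSpan {C : Set (Option b.support)} {O : Subring (RootLocalization P F B)}
    {n : ℕ} {a : TwistedAffine P F B} (ha : a ∈ ηSpan b θ C O n) {l : Multiplicative L}
    (hl : (pr P F B a).coeff l ≠ 0) :
    ∃ K : List (Option b.support), (wordProd b θ K).left = l ∧ K.length < n := by
  classical
  induction ha using Submodule.span_induction with
  | mem a ha =>
    obtain ⟨K, ⟨_, hn⟩, rfl⟩ := ha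
    refine ⟨K, ?_, hn⟩
    by_contra h
    have e := pr_smul_η (F := F) (B := B) 1 (wordProd b θ K)
    rw [one_smul] at e
    simp [e, h] at hl
  | zero => simp at hl
  | add a a' _ _ h h' =>
    by_cases h0 : (pr P F B a).coeff l = 0
    · exact h' (by simpa [h0] using hl)
    · exact h h0
  | smul c a _ h =>
    refine h fun h0 => hl ?_
    have : c • a = (c : RootLocalization P F B) • a := rfl
    rw [this, ← prLin_apply, map_smul, SkewMonoidAlgebra.coeff_smul, Finsupp.smul_apply, prLin_apply,
      h0, smul_zero]

section Independence

lemma linearIndependent_of_coeff [IsDomain R] [CharZero R] {G U : Type*} [Monoid G]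
    [MulSemiringAction G (RootLocalization P F B)]
    {f : U → SkewMonoidAlgebra (RootLocalization P F B) G}
    (h : LinearIndependent (RootLocalization P F B) fun u => (f u).coeff) :
    LinearIndependent (FormalGroupAlgebra F B) f := by
  have h1 : LinearIndependent (RootLocalization P F B) f :=
    LinearIndependent.of_comp (SkewMonoidAlgebra.coeffLinearEquiv (S := RootLocalization P F B)
      (k := RootLocalization P F B) (G := G)).toLinearMap h
  have : FaithfulSMul (FormalGroupAlgebra F B) (RootLocalization P F B) :=
    (faithfulSMul_iff_algebraMap_injective _ _).2 (RootLocalization.algebraMap_injective (P := P))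
  refine h1.restrict_scalars fun f g hfg => RootLocalization.algebraMap_injective (P := P) ?_
  simpa [Algebra.smul_def] using hfg

variable [IsDomain R] [CharZero R] {I : AffineWeyl P → List (Option b.support)}
  (hI : ∀ w, IsReducedSeq b θ (I w) w)
include hI

theorem linearIndependent_XSeq :
    LinearIndependent (FormalGroupAlgebra F B) (fun w : AffineWeyl P => XSeq F B b θ (I w)) := by
  have key : ∀ w, ∃ a ∈ ηSpan b θ Set.univ (⊤ : Subring (RootLocalization P F B)) (I w).length,
      XSeq F B b θ (I w) = topCoeff P F B b θ (I w) • η P F B w + a := fun w => by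
    refine ⟨_, (isCoeffRing_top Set.univ).XSeq_sub_mem (K := I w) (by simp), ?_⟩
    rw [(hI w).1]
    abel
  refine linearIndependent_of_coeff (linearIndependent_of_triangular _
    (fun w => (I w).length) id (fun w => ?_) fun w v hv h => ?_)
  · obtain ⟨a, ha, e⟩ := key w
    have h0 : a.coeff w = 0 := by
      by_contra h
      obtain ⟨K, hK, hl⟩ := coeff_of_mem_ηSpan ha h
      exact absurd ((hI w).2 K hK) (by omega)
    rw [e, smul_η]
    simpa [h0] using topCoeff_ne_zero b θ (I w)
  · obtain ⟨a, ha, e⟩ := key w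
    rw [e, smul_η] at h
    have h2 : a.coeff v ≠ 0 := by
      simpa [Finsupp.single_apply, hv.symm] using h
    obtain ⟨K, hK, hl⟩ := coeff_of_mem_ηSpan ha h2
    exact ((hI v).2 K hK).trans_lt hl

theorem linearIndependent_frakX (hcompat : IsCompatible b θ I) :
    LinearIndependent (FormalGroupAlgebra F B)
      (fun u : minReps b θ => frakX F B b θ (I u)) := by
  have key : ∀ w, ∃ a ∈ ηSpan b θ Set.univ (⊤ : Subring (RootLocalization P F B)) (I w).length,
      frakX F B b θ (I w) =
        SkewMonoidAlgebra.single w.left (topCoeff P F B b θ (I w)) + pr P F B a := fun w => by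
    refine ⟨_, (isCoeffRing_top Set.univ).XSeq_sub_mem (K := I w) (by simp), ?_⟩
    rw [(hI w).1, map_sub, pr_smul_η, frakX]
    abel
  refine linearIndependent_of_coeff (linearIndependent_of_triangular _
    (fun u : minReps b θ => (I (u : AffineWeyl P)).length) (fun u => (u : AffineWeyl P).left)
    (fun w => ?_) fun w v hv h => ?_)
  · obtain ⟨a, ha, e⟩ := key w
    have h0 : (pr P F B a).coeff (w : AffineWeyl P).left = 0 := by
      by_contra h
      obtain ⟨K, hK, hl⟩ := coeff_pr_of_mem_ηSpan ha h
      have h1 := minReps_length_le hI hcompat w.2 hK.symm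
      rw [length_eq hI, length_eq hI] at h1
      exact absurd ((hI _).2 K rfl) (by omega)
    rw [e]
    simpa [h0] using topCoeff_ne_zero b θ (I w)
  · obtain ⟨a, ha, e⟩ := key w
    rw [e] at h
    have hne : (w : AffineWeyl P).left ≠ (v : AffineWeyl P).left := fun h' =>
      hv (Subtype.ext (minReps_eq_of_left_eq hI hcompat w.2 v.2 h'))
    have h2 : (pr P F B a).coeff (v : AffineWeyl P).left ≠ 0 := by
      simpa [Finsupp.single_apply, hne] using h
    obtain ⟨K, hK, hl⟩ := coeff_pr_of_mem_ηSpan ha h2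
    have h1 := minReps_length_le hI hcompat v.2 hK.symm
    rw [length_eq hI, length_eq hI] at h1
    exact h1.trans_lt (((hI _).2 K rfl).trans_lt hl)

end Independence

end TwistedAffine

namespace AffineWeyl

variable {ι T L : Type*} [AddCommGroup T] [AddCommGroup L] {P : RootPairing ι ℤ T L}

lemma act_s (k : ι) (v : T × ℤ) :
    act (s P k) v = (v.1 - P.toLinearMap v.1 (P.coroot k) • P.root k, v.2) := by
  rw [s, act_inr]
  rfl

lemma s_reflectionPerm (i k : ι) : s P (P.reflectionPerm i k) = s P i * s P k * s P i := by
  refine ext_act fun v => ?_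
  rw [act_mul, act_mul, act_s, act_s, act_s, act_s]
  refine Prod.ext ?_ rfl
  simp only [P.coroot_reflectionPerm, P.root_reflectionPerm, P.reflection_apply,
    P.coreflection_apply, map_sub, map_zsmul, LinearMap.sub_apply, LinearMap.smul_apply,
    pairing_eq_toLinearMap, P.pairing_same, smul_eq_mul, LinearMap.flip_apply,
    RootPairing.coroot', RootPairing.root']
  module

lemma s_reflectionPerm_self (k : ι) : s P (P.reflectionPerm k k) = s P k := by
  refine ext_act fun v => ?_
  rw [act_s, act_s]
  simp

lemma s_mul_self (k : ι) : s P k * s P k = 1 := by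
  refine ext_act fun v => ?_
  rw [act_mul, act_s, act_s, act_one]
  refine Prod.ext ?_ rfl
  simp only [map_sub, map_zsmul, LinearMap.sub_apply, LinearMap.smul_apply,
    pairing_eq_toLinearMap, P.pairing_same, smul_eq_mul]
  module

lemma s_mem_finiteWeyl (k : ι) : s P k ∈ finiteWeyl P := ⟨_, rfl⟩

/-- The finite part of a simple reflection. -/
lemma inr_simple_right (b : P.Base) (θ : ι) (j : Option b.support) :
    (SemidirectProduct.inr (simple b θ j).right : AffineWeyl P) = s P (rootIdx b θ j) := by
  rcases j with _ | j
  · rw [rootIdx, s_reflectionPerm_self]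
    simp [simple, s, t]
  · rfl

end AffineWeyl

namespace TwistedAffine

open AffineWeyl

variable {ι R T L σ : Type*} [CommRing R] [AddCommGroup T] [AddCommGroup L]
  {P : RootPairing ι ℤ T L} {F : FormalGroup R} [F.IsComm] {B : Module.Basis σ ℤ T} [Finite σ]
  {b : P.Base} {θ : ι}

/-- The Demazure element `(1 / x_γ) (1 - η_{s_γ})` of a root `γ`. -/
def rootX (P : RootPairing ι ℤ T L) (F : FormalGroup R) [F.IsComm] (B : Module.Basis σ ℤ T)
    (k : ι) : TwistedAffine P F B := xInv P F B k • (1 - η P F B (s P k))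

lemma η_s (k : ι) : η P F B (s P k) = 1 - FormalGroupAlgebra.x F B (P.root k) • rootX P F B k := by
  rw [rootX, ← algebraMap_smul (RootLocalization P F B), smul_smul, xInv_mul, one_smul,
    sub_sub_cancel]

lemma η_s_mul_rootX_mul (i k : ι) :
    η P F B (s P i) * rootX P F B k * η P F B (s P i) = rootX P F B (P.reflectionPerm i k) := by
  have e : (((s P i).right : P.Aut).indexEquiv k) = P.reflectionPerm i k := by
    refine P.root.injective ?_
    rw [← RootPairing.weylGroup_smul_root, P.root_reflectionPerm, P.reflection_apply]
    rfl
  rw [rootX, rootX, η_mul_smul, smul_mul_assoc, mul_sub, mul_one, sub_mul, η_mul, η_mul, η_mul,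
    s_mul_self, η_one, smul_xInv, e, s_reflectionPerm]

lemma η_s_mem_of_rootX_mem {k : ι} (h : rootX P F B k ∈ demazure F B b θ) :
    η P F B (s P k) ∈ demazure F B b θ := by
  rw [η_s]
  exact sub_mem (one_mem _) (smul_mem_demazure _ h)

lemma rootX_mem_demazure [Finite ι] [P.IsReduced] (k : ι) :
    rootX P F B k ∈ demazure F B b θ := by
  refine b.induction_reflect k (p := fun k => rootX P F B k ∈ demazure F B b θ) ?_ ?_ ?_
  · intro k hk
    rw [← η_s_mul_rootX_mul]
    have h := η_s_mem_of_rootX_mem hk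
    exact mul_mem (mul_mem h hk) h
  · intro k hk
    exact X_mem_demazure (F := F) (B := B) (b := b) (θ := θ) (some ⟨k, hk⟩)
  · intro k i hk hi
    rw [← η_s_mul_rootX_mul]
    have h : η P F B (s P i) ∈ demazure F B b θ :=
      η_s_mem_of_rootX_mem (X_mem_demazure (F := F) (B := B) (b := b) (θ := θ) (some ⟨i, hi⟩))
    exact mul_mem (mul_mem h hk) h

lemma k_single (l : Multiplicative L) (q : RootLocalization P F B) :
    k P F B (SkewMonoidAlgebra.single l q) = q • η P F B (SemidirectProduct.inl l) := by
  rw [smul_η]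
  exact SkewMonoidAlgebra.mapDomain_single

lemma k_smul (f : FormalGroupAlgebra F B) (z : TwistedLattice P F B) :
    k P F B (f • z) = f • k P F B z := SkewMonoidAlgebra.mapDomain_smul

lemma pr_k (z : TwistedLattice P F B) : pr P F B (k P F B z) = z := by
  induction z using SkewMonoidAlgebra.induction_on with
  | zero => simp
  | single l q => rw [k_single, pr_smul_η, SemidirectProduct.left_inl]
  | add z z' h h' => rw [map_add, map_add, h, h']

lemma k_injective : Function.Injective (k P F B) := Function.LeftInverse.injective pr_k

lemma pr_k_mul (z : TwistedLattice P F B) (a : TwistedAffine P F B) :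
    pr P F B (k P F B z * a) = z * pr P F B a := by
  induction a using SkewMonoidAlgebra.induction_on with
  | zero => simp
  | single w q =>
    induction z using SkewMonoidAlgebra.induction_on with
    | zero => simp
    | single l p =>
      rw [k_single, ← smul_η, pr_smul_η, smul_mul_assoc, η_mul_smul, η_mul, smul_smul, pr_smul_η,
        SkewMonoidAlgebra.single_mul_single]
      simp
      rfl
    | add z z' h h' => rw [map_add, add_mul, map_add, add_mul, h, h']
  | add a a' h h' => rw [mul_add, map_add, map_add, mul_add, h, h']

lemma pr_mul_X_some (a : TwistedAffine P F B) (i : b.support) :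
    pr P F B (a * X F B b θ (some i)) = 0 := by
  induction a using SkewMonoidAlgebra.induction_on with
  | zero => simp
  | single w q =>
    have h : (w * s P i).left = w.left := left_mul_of_mem_finiteWeyl w (s_mem_finiteWeyl _)
    rw [← smul_η, X_eq, smul_mul_assoc, η_mul_smul, mul_sub, mul_one, η_mul, smul_smul, smul_sub,
      map_sub, pr_smul_η, pr_smul_η]
    change _ - SkewMonoidAlgebra.single (w * s P i).left _ = 0
    rw [h, sub_self]
  | add a a' h h' => rw [add_mul, map_add, h, h', add_zero]

/-- The Demazure elements preserve the Peterson subalgebra, in the sense of this formula. -/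
lemma k_pr_X_mul (j : Option b.support) (a : TwistedAffine P F B) :
    k P F B (pr P F B (X F B b θ j * a)) =
      X F B b θ j * k P F B (pr P F B a) * η P F B (s P (rootIdx b θ j)) +
        k P F B (pr P F B a) * rootX P F B (rootIdx b θ j) := by
  induction a using SkewMonoidAlgebra.induction_on with
  | zero => simp
  | single w q =>
    have h1 : simple b θ j * SemidirectProduct.inl w.left * s P (rootIdx b θ j) =
        SemidirectProduct.inl (simple b θ j * w).left := by
      rw [← inr_simple_right]
      refine SemidirectProduct.ext (by simp) ?_
      have := congrArg SemidirectProduct.right (simple_mul_self b θ j)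
      simpa using this
    rw [← smul_η, X_mul_smul_η, pr_smul_η, k_single, X_mul_smul_η, map_sub, pr_smul_η, pr_smul_η,
      map_sub, k_single, k_single, sub_mul, smul_mul_assoc, smul_mul_assoc, η_mul, η_mul, h1, rootX,
      smul_mul_assoc, η_mul_smul, mul_sub, mul_one, η_mul]
    have h2 : (SemidirectProduct.inl w.left : AffineWeyl P) • xInv P F B (rootIdx b θ j) =
        xInv P F B (rootIdx b θ j) := one_smul P.weylGroup _
    rw [h2, smul_smul, smul_sub, mul_comm q]
    abel
  | add a a' h h' =>
    simp only [mul_add, map_add, add_mul, h, h']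
    abel

section Main

variable [Finite ι] [P.IsReduced] {I : AffineWeyl P → List (Option b.support)}

lemma k_pr_mem_demazure (hspan : (Submodule.span (FormalGroupAlgebra F B)
      (Set.range fun w => XSeq F B b θ (I w)) : Set (TwistedAffine P F B)) = demazure F B b θ)
    {a : TwistedAffine P F B} (ha : a ∈ demazure F B b θ) :
    k P F B (pr P F B a) ∈ demazure F B b θ := by
  have hK : ∀ K, k P F B (pr P F B (XSeq F B b θ K)) ∈ demazure F B b θ := by
    intro K
    induction K with
    | nil =>
      have e : pr P F B (XSeq F B b θ []) = 1 := by
        have := pr_smul_η (F := F) (B := B) 1 (1 : AffineWeyl P)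
        rwa [one_smul] at this
      rw [e, map_one]
      exact one_mem _
    | cons j K ih =>
      rw [XSeq_cons, k_pr_X_mul]
      have h := rootX_mem_demazure (F := F) (B := B) (b := b) (θ := θ) (rootIdx b θ j)
      exact add_mem (mul_mem (mul_mem (X_mem_demazure j) ih) (η_s_mem_of_rootX_mem h))
        (mul_mem ih h)
  have ha' : a ∈ (Submodule.span (FormalGroupAlgebra F B)
      (Set.range fun w => XSeq F B b θ (I w)) : Set (TwistedAffine P F B)) := hspan ▸ ha
  refine Submodule.span_induction
    (p := fun a _ => k P F B (pr P F B a) ∈ demazure F B b θ) ?_ ?_ ?_ ?_ ha'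
  · rintro _ ⟨w, rfl⟩
    exact hK _
  · rw [map_zero, map_zero]
    exact zero_mem _
  · intro a a' _ _ h h'
    rw [map_add, map_add]
    exact add_mem h h'
  · intro f a _ h
    rw [pr_smul, k_smul]
    exact smul_mem_demazure f h

variable (hθ : IsHighestRoot b θ) (hI : ∀ w, IsReducedSeq b θ (I w) w)
  (hcompat : IsCompatible b θ I)
include hθ hI hcompat

lemma pr_XSeq_of_notMem {w : AffineWeyl P} (hw : w ∉ minReps b θ) :
    pr P F B (XSeq F B b θ (I w)) = 0 := by
  obtain ⟨u, hu, v, hv, rfl⟩ := exists_minReps_mul (b := b) (θ := θ) w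
  rw [hcompat u hu v hv]
  rcases List.eq_nil_or_concat (I v) with h | ⟨K, j, h⟩
  · have : v = 1 := by
      rw [← (hI v).1, h]
      rfl
    rw [this, mul_one] at hw
    exact absurd hu hw
  · rw [List.concat_eq_append] at h
    have hj : j ≠ none := ne_none_of_mem_finiteWeyl hθ hv (h ▸ hI v)
    obtain ⟨i, rfl⟩ := Option.ne_none_iff_exists'.1 hj
    have e : XSeq F B b θ [some i] = X F B b θ (some i) := by simp [XSeq]
    rw [h, ← List.append_assoc, XSeq_append, e, pr_mul_X_some]

lemma pr_linearCombination (c : AffineWeyl P →₀ FormalGroupAlgebra F B) :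
    pr P F B (Finsupp.linearCombination (FormalGroupAlgebra F B)
      (fun w => XSeq F B b θ (I w)) c) =
    Finsupp.linearCombination (FormalGroupAlgebra F B)
      (fun w : minReps b θ => frakX F B b θ (I w))
      (Finsupp.lsubtypeDomain (R := FormalGroupAlgebra F B) (minReps b θ) c) := by
  classical
  induction c using Finsupp.induction_linear with
  | zero => simp
  | add c c' h h' => rw [map_add, map_add, h, h', map_add, map_add]
  | single w f =>
    rw [Finsupp.linearCombination_single, pr_smul]
    by_cases hw : w ∈ minReps b θ
    · have e : Finsupp.lsubtypeDomain (R := FormalGroupAlgebra F B) (minReps b θ)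
          (Finsupp.single w f) = Finsupp.single ⟨w, hw⟩ f := by
        ext v
        change (Finsupp.single w f : AffineWeyl P →₀ _) v = _
        simp [Finsupp.single_apply, Subtype.ext_iff]
      rw [e, Finsupp.linearCombination_single]
      rfl
    · have e : Finsupp.lsubtypeDomain (R := FormalGroupAlgebra F B) (minReps b θ)
          (Finsupp.single w f) = 0 := by
        ext v
        have : w ≠ v := fun h => hw (h ▸ v.2)
        exact Finsupp.single_eq_of_ne' this
      rw [e, map_zero, pr_XSeq_of_notMem hθ hI hcompat hw, smul_zero]

/-- The Peterson subalgebra is spanned by the `k(𝔛_{I_u})`. -/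
theorem span_eq_peterson (hspan : (Submodule.span (FormalGroupAlgebra F B)
      (Set.range fun w => XSeq F B b θ (I w)) : Set (TwistedAffine P F B)) = demazure F B b θ) :
    (Submodule.span (FormalGroupAlgebra F B)
      (Set.range fun u : minReps b θ => k P F B (frakX F B b θ (I u))) :
        Set (TwistedAffine P F B)) = peterson F B b θ := by
  ext z
  rw [peterson, ← hspan]
  constructor
  · intro hz
    obtain ⟨c, rfl⟩ := (Finsupp.mem_span_range_iff_exists_finsupp).1 hz
    refine ⟨_, ⟨∑ u ∈ c.support, c u • XSeq F B b θ (I u), Submodule.sum_mem _ fun u _ => Submodule.smul_mem _ (c u)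
      (Submodule.subset_span ⟨(u : AffineWeyl P), rfl⟩), rfl⟩, ?_⟩
    rw [map_sum, map_sum, Finsupp.sum]
    refine Finset.sum_congr rfl fun u _ => ?_
    rw [pr_smul, k_smul]
    rfl
  · rintro ⟨_, ⟨a, ha, rfl⟩, rfl⟩
    obtain ⟨c, rfl⟩ := (Finsupp.mem_span_range_iff_exists_finsupp).1 ha
    have e := pr_linearCombination (F := F) (B := B) hθ hI hcompat c
    rw [Finsupp.linearCombination_apply] at e
    rw [e, Finsupp.linearCombination_apply, Finsupp.sum, map_sum]
    refine Submodule.sum_mem _ fun u _ => ?_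
    rw [k_smul]
    exact Submodule.smul_mem _ _ (Submodule.subset_span ⟨u, rfl⟩)

end Main

end TwistedAffine

end FormalPeterson

/-- For a `W`-compatible choice of reduced sequences `I`, the `X_{I_w}` are an `S`-basis of
`𝐃_{W_a}`, the `k(𝔛_{I_u})` are an `S`-basis of the Peterson subalgebra, and the coefficients `c` of
`k(𝔛_{I_u})` and the structure constants `d` and `𝔡` (unique by linear independence) are related by
`𝔡_{u,v}^{w₃} = ∑_{w₂} c_{u,w₂} d_{w₂,v}^{w₃}`. -/
theorem mainTheorem8
    {ι T L σ R : Type*} [Finite ι] [Finite σ] [AddCommGroup T] [AddCommGroup L]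
    [CommRing R] [IsDomain R] [CharZero R]
    (P : RootPairing ι ℤ T L) [P.IsReduced]
    (hsc : Submodule.span ℤ (Set.range P.coroot) = ⊤)
    (b : P.Base) (θ : ι) (hθ : IsHighestRoot b θ)
    (B : Module.Basis σ ℤ T)
    (F : FormalGroup R) [F.IsComm]
    (I : AffineWeyl P → List (Option b.support))
    (hI : ∀ w, AffineWeyl.IsReducedSeq b θ (I w) w)
    (hcompat : AffineWeyl.IsCompatible b θ I) :
    LinearIndependent (FormalGroupAlgebra F B)
      (fun w : AffineWeyl P => TwistedAffine.XSeq F B b θ (I w)) ∧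
    (Submodule.span (FormalGroupAlgebra F B)
        (Set.range fun w : AffineWeyl P => TwistedAffine.XSeq F B b θ (I w)) :
        Set (TwistedAffine P F B)) = TwistedAffine.demazure F B b θ ∧
    LinearIndependent (FormalGroupAlgebra F B)
      (fun u : AffineWeyl.minReps b θ =>
        TwistedAffine.k P F B (TwistedAffine.frakX F B b θ (I u))) ∧
    (Submodule.span (FormalGroupAlgebra F B)
        (Set.range fun u : AffineWeyl.minReps b θ =>
          TwistedAffine.k P F B (TwistedAffine.frakX F B b θ (I u))) :
        Set (TwistedAffine P F B)) = TwistedAffine.peterson F B b θ ∧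
    ∃ (c : AffineWeyl.minReps b θ → AffineWeyl P →₀ FormalGroupAlgebra F B)
      (d : AffineWeyl P → AffineWeyl P → AffineWeyl P →₀ FormalGroupAlgebra F B)
      (𝔡 : AffineWeyl.minReps b θ → AffineWeyl.minReps b θ →
        AffineWeyl.minReps b θ →₀ FormalGroupAlgebra F B),
      (∀ u : AffineWeyl.minReps b θ,
        TwistedAffine.k P F B (TwistedAffine.frakX F B b θ (I u)) =
          Finsupp.linearCombination (FormalGroupAlgebra F B)
            (fun w : AffineWeyl P => TwistedAffine.XSeq F B b θ (I w)) (c u)) ∧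
      (∀ u : AffineWeyl.minReps b θ, c u u = 1) ∧
      (∀ u w : AffineWeyl.minReps b θ, w ≠ u → c u w = 0) ∧
      (∀ u v : AffineWeyl P,
        TwistedAffine.XSeq F B b θ (I u) * TwistedAffine.XSeq F B b θ (I v) =
          Finsupp.linearCombination (FormalGroupAlgebra F B)
            (fun w : AffineWeyl P => TwistedAffine.XSeq F B b θ (I w)) (d u v)) ∧
      (∀ u v : AffineWeyl.minReps b θ,
        TwistedAffine.frakX F B b θ (I u) * TwistedAffine.frakX F B b θ (I v) =
          Finsupp.linearCombination (FormalGroupAlgebra F B)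
            (fun w : AffineWeyl.minReps b θ => TwistedAffine.frakX F B b θ (I w)) (𝔡 u v)) ∧
      ∀ u v w₃ : AffineWeyl.minReps b θ,
        𝔡 u v w₃ = ∑ w₂ ∈ (c u).support, c u w₂ * d w₂ v w₃ := by 
  have hE := AffineWeyl.exchangeWords hθ hI
  have hX := TwistedAffine.demazureRelations (F := F) (B := B) hsc hθ hE
  have hspan := TwistedAffine.span_eq_demazure hE hX
  have hindep := TwistedAffine.linearIndependent_frakX (F := F) (B := B) hI hcompat
  have hk : ∀ u : AffineWeyl.minReps b θ, ∃ c : AffineWeyl P →₀ FormalGroupAlgebra F B,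
      Finsupp.linearCombination (FormalGroupAlgebra F B)
        (fun w : AffineWeyl P => TwistedAffine.XSeq F B b θ (I w)) c =
      TwistedAffine.k P F B (TwistedAffine.frakX F B b θ (I u)) := fun u => by
    rw [← LinearMap.mem_range, Finsupp.range_linearCombination, ← SetLike.mem_coe, hspan]
    exact TwistedAffine.k_pr_mem_demazure hspan (TwistedAffine.XSeq_mem_demazure _)
  have hm : ∀ u v : AffineWeyl P, ∃ c : AffineWeyl P →₀ FormalGroupAlgebra F B,
      Finsupp.linearCombination (FormalGroupAlgebra F B)
        (fun w : AffineWeyl P => TwistedAffine.XSeq F B b θ (I w)) c =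
      TwistedAffine.XSeq F B b θ (I u) * TwistedAffine.XSeq F B b θ (I v) := fun u v => by
    rw [← LinearMap.mem_range, Finsupp.range_linearCombination, ← SetLike.mem_coe, hspan]
    exact mul_mem (TwistedAffine.XSeq_mem_demazure _) (TwistedAffine.XSeq_mem_demazure _)
  choose c hc using hk
  choose d hd using hm
  have hcu : ∀ u : AffineWeyl.minReps b θ, Finsupp.lsubtypeDomain (R := FormalGroupAlgebra F B)
      (AffineWeyl.minReps b θ) (c u) = Finsupp.single u 1 := fun u => by
    refine hindep ?_
    rw [← TwistedAffine.pr_linearCombination hθ hI hcompat, hc, TwistedAffine.pr_k,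
      Finsupp.linearCombination_single, one_smul]
  refine ⟨TwistedAffine.linearIndependent_XSeq hI, hspan, ?_,
    TwistedAffine.span_eq_peterson hθ hI hcompat hspan, c, d,
    fun u v => ∑ w ∈ (c u).support, c u w • Finsupp.lsubtypeDomain (R := FormalGroupAlgebra F B)
      (AffineWeyl.minReps b θ) (d w v),
    fun u => (hc u).symm, fun u => ?_, fun u w hw => ?_, fun u v => (hd u v).symm,
    fun u v => ?_, fun u v w => ?_⟩
  · let kLin : TwistedLattice P F B →ₗ[FormalGroupAlgebra F B] TwistedAffine P F B :=
      { TwistedAffine.k P F B with map_smul' := TwistedAffine.k_smul }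
    exact hindep.map' kLin (LinearMap.ker_eq_bot.2 TwistedAffine.k_injective)
  · have h := DFunLike.congr_fun (hcu u) u
    rwa [Finsupp.single_eq_same] at h
  · have h := DFunLike.congr_fun (hcu u) w
    rwa [Finsupp.single_eq_of_ne hw] at h
  · have h1 := TwistedAffine.pr_k_mul (TwistedAffine.frakX F B b θ (I u))
      (TwistedAffine.XSeq F B b θ (I v))
    change _ = _ * TwistedAffine.frakX F B b θ (I v) at h1
    rw [← h1, ← hc, Finsupp.linearCombination_apply, Finsupp.sum, Finset.sum_mul, map_sum, map_sum]
    refine Finset.sum_congr rfl fun w _ => ?_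
    rw [smul_mul_assoc, TwistedAffine.pr_smul, ← hd, map_smul,
      TwistedAffine.pr_linearCombination hθ hI hcompat]
  · rw [Finsupp.finsetSum_apply]
    rfl
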